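/- Let $\Sigma$ be a compact connected Riemann surface of genus $g\ge 2$ with canonical bundle $\mathcal K$ (so $\deg\mathcal K=2g-2$), let $\mathcal T$ be a holomorphic line bundle on $\Sigma$, and let $\beta\in H^0(\mathcal K\mathcal T^{-1})$, $\delta\in H^0(\mathcal T^3\mathcal K^3)$ be holomorphic sections. Let $\mathcal H=(\mathcal V,\Phi)$ be the $\alpha$-cyclic $\mathsf G_2'$-Higgs bundle they define: $$\mathcal V=\mathcal T^2\mathcal K\oplus\mathcal T\mathcal K\oplus\mathcal T\oplus\mathcal O\oplus\mathcal T^{-1}\oplus\mathcal T^{-1}\mathcal K^{-1}\oplus\mathcal T^{-2}\mathcal K^{-1},$$ and $\Phi\in H^0(\mathrm{End}(\mathcal V)\otimes\mathcal K)$ has as its only possibly nonzero components $$\mathcal T^2\mathcal K\xrightarrow{\beta}\mathcal T\mathcal K\xrightarrow{1}\mathcal T\xrightarrow{-i\sqrt2\beta}\mathcal O\xrightarrow{-i\sqrt2\beta}\mathcal T^{-1}\xrightarrow{1}\mathcal T^{-1}\mathcal K^{-1}\xrightarrow{\beta}\mathcal T^{-2}\mathcal K^{-1},\qquad \mathcal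 T^{-1}\mathcal K^{-1}\xrightarrow{\delta}\mathcal T^2\mathcal K,\quad \mathcal T^{-2}\mathcal K^{-1}\xrightarrow{\delta}\mathcal T\mathcal K$$ (each twisted by $\mathcal K$ on the target). A degree-zero Higgs bundle is called stable if every proper nonzero $\Phi$-invariant holomorphic subbundle has negative degree; polystable if it is a direct sum of stable Higgs subbundles of degree zero; and strictly polystable if it is polystable but not stable. Then: 1. If $\mathcal H$ is polystable, then $-2g+2\le\deg\mathcal T\le 2g-2$. 2. If $\delta\ne0$ and $\beta\ne0$, then $\mathcal H$ is polystable if and only if $-2g+2\le\deg\mathcal T\le 2g-2$. Moreover, $\mathcal H$ is stable, except if $\deg\mathcal T=-g+1$ and $\beta$ and $\delta$ have the same divisor, in which case $\mathcal H$ is strictly polystable. 3. If $\delta=0$ and $\beta\neq0$, then $\mathcal H$ is polystable if and only if $-g+1<\deg\mathcal T\le 2g-2$, in which case $\mathcal H$ is stable. 4. If $\beta=0$ and $\delta\ne0$, then $\mathcal H$ is polystable if and only if $-2g+2\le\deg\mathcal T<-g+1$, in which case $\mathcal H$ is strictly polystable. 5. If $\beta=0$ and $\delta=0$, then $\mathcal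 H$ is polystable if and only if $\deg\mathcal T=-g+1$, in which case $\mathcal H$ is strictly polystable. -/

import Mathlib

open scoped Manifold ContDiff Topology Bundle
open Bundle

noncomputable section

set_option linter.unusedSectionVars false

namespace AlphaCyclic

universe u v

/-! ### Holomorphic subbundles and their degrees

Throughout, `X` is a Riemann surface, i.e. a complex manifold modelled on `ℂ`, and a holomorphic
vector bundle is a vector bundle `E` over `X` with analytic transition functions. -/

section Bundles

variable {X : Type u} [TopologicalSpace X] [ChartedSpace ℂ X]
variable (F : Type*) [NormedAddCommGroup F] [NormedSpace ℂ F]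
variable {E : X → Type v} [∀ x, AddCommGroup (E x)] [∀ x, Module ℂ (E x)]
  [TopologicalSpace (TotalSpace F E)] [∀ x, TopologicalSpace (E x)] [FiberBundle F E]

/-- The section `s` of `E` is holomorphic near `p`. -/
def HolAt (s : ∀ x, E x) (p : X) : Prop :=
  ContMDiffAt 𝓘(ℂ) (𝓘(ℂ).prod 𝓘(ℂ, F)) ω (fun x => TotalSpace.mk' F x (s x)) p

/-- `s₁, …, s_r` is a holomorphic frame near `p` of the family `W` of subspaces of the fibres. -/
def IsFrameAt (W : ∀ x, Submodule ℂ (E x)) (p : X) {r : ℕ} (s : Fin r → ∀ x, E x) : Prop :=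
  (∀ i, HolAt F (s i) p) ∧
    ∀ᶠ x in 𝓝 p, LinearIndependent ℂ (fun i => s i x) ∧
      Submodule.span ℂ (Set.range fun i => s i x) = W x

/-- The family `W` of subspaces is a holomorphic subbundle of `E`: locally it has a holomorphic
frame. -/
def IsHolSubbundle (W : ∀ x, Submodule ℂ (E x)) : Prop :=
  ∀ p, ∃ (r : ℕ) (s : Fin r → ∀ x, E x), IsFrameAt F W p s

/-- `f` is meromorphic near `p`, not identically zero there, and has order `n` at `p`, all of this
being read in the chart at `p`. -/
def HasMeroOrder (f : X → ℂ) (p : X) (n : ℤ) : Prop :=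
  MeromorphicAt (f ∘ (chartAt ℂ p).symm) (chartAt ℂ p p) ∧
    meromorphicOrderAt (f ∘ (chartAt ℂ p).symm) (chartAt ℂ p p) = (n : WithTop ℤ)

/-- `deg W = d` for the holomorphic subbundle `W` of rank `r` of `E`. Here `σ` restricts to a
meromorphic section of the line bundle `det(W)* = Λʳ W*`, not identically zero, whose order at `p`
is `ord p`, computed in a holomorphic frame; the degree of its divisor is `deg det(W)* = -deg W`. -/
def HasDegree (W : ∀ x, Submodule ℂ (E x)) (d : ℤ) : Prop :=
  ∃ (r : ℕ) (σ : ∀ x, (E x) [⋀^Fin r]→ₗ[ℂ] ℂ) (ord : X → ℤ),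
    (∀ p, ∃ s : Fin r → ∀ x, E x, IsFrameAt F W p s ∧
      HasMeroOrder (fun x => σ x fun i => s i x) p (ord p)) ∧
    (Function.support ord).Finite ∧ ∑ᶠ p, ord p = -d

variable (E) in
/-- `deg E = d` for a holomorphic vector bundle `E`. -/
def HasBundleDegree (d : ℤ) : Prop :=
  HasDegree F (fun x => (⊤ : Submodule ℂ (E x))) d

/-- The order of vanishing at `p` of a section of the holomorphic line bundle `L`. -/
def vanishingOrder {L : X → Type v} [∀ x, AddCommGroup (L x)] [∀ x, Module ℂ (L x)]
    [TopologicalSpace (TotalSpace ℂ L)] [∀ x, TopologicalSpace (L x)] [FiberBundle ℂ L]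
    (s : ∀ x, L x) (p : X) : WithTop ℤ :=
  meromorphicOrderAt
    ((fun x => (trivializationAt ℂ L p ⟨x, s x⟩).2) ∘ (chartAt ℂ p).symm) (chartAt ℂ p p)

end Bundles

/-- The compact connected Riemann surface `X` has genus `g`, i.e. its Euler characteristic is
`2 - 2g`. The Euler characteristic is taken as the degree (Euler number) of the holomorphic tangent
bundle. -/
def HasGenus (X : Type u) [TopologicalSpace X] [ChartedSpace ℂ X] [IsManifold 𝓘(ℂ) ω X]
    (g : ℕ) : Prop :=
  HasBundleDegree ℂ (fun x : X => TangentSpace 𝓘(ℂ) x) (2 - 2 * (g : ℤ))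

/-! ### Higgs bundles and (poly)stability -/

section Higgs

variable {X : Type u} [TopologicalSpace X] [ChartedSpace ℂ X] [IsManifold 𝓘(ℂ) ω X]
variable (F : Type*) [NormedAddCommGroup F] [NormedSpace ℂ F]
variable (E : X → Type v) [∀ x, AddCommGroup (E x)] [∀ x, Module ℂ (E x)]
  [TopologicalSpace (TotalSpace F E)] [∀ x, TopologicalSpace (E x)] [FiberBundle F E]

/-- A Higgs field on `E`: a holomorphic `End(E)`-valued `(1,0)`-form. -/
structure HiggsField where
  /-- the endomorphism `Φ(v)` of `E x` for a tangent vector `v` at `x` -/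
  toFun : ∀ x, TangentSpace 𝓘(ℂ) x →ₗ[ℂ] E x →ₗ[ℂ] E x
  holomorphic : ∀ (p : X) (v : ∀ x : X, TangentSpace 𝓘(ℂ) x) (s : ∀ x, E x),
    HolAt ℂ v p → HolAt F s p → HolAt F (fun x => toFun x (v x) (s x)) p

variable {F E}

/-- `W` is a Higgs subbundle of `(E, Φ)`: a holomorphic subbundle with `Φ(W) ⊆ W ⊗ K`. -/
def IsHiggsSub (Φ : HiggsField F E) (W : ∀ x, Submodule ℂ (E x)) : Prop :=
  IsHolSubbundle F W ∧ ∀ x v, ∀ w ∈ W x, Φ.toFun x v w ∈ W x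

/-- The Higgs subbundle `(W, Φ|_W)` has degree zero and is stable: every proper nonzero Higgs
subbundle of it has negative degree. -/
def IsStableSub (Φ : HiggsField F E) (W : ∀ x, Submodule ℂ (E x)) : Prop :=
  IsHiggsSub Φ W ∧ W ≠ ⊥ ∧ HasDegree F W 0 ∧
    ∀ W' : ∀ x, Submodule ℂ (E x), IsHiggsSub Φ W' → W' ≤ W → W' ≠ ⊥ → W' ≠ W →
      ∃ d : ℤ, HasDegree F W' d ∧ d < 0

/-- `(E, Φ)` has degree zero and is stable. -/
def IsStable (Φ : HiggsField F E) : Prop :=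
  IsStableSub Φ ⊤

/-- `(E, Φ)` is polystable (of degree zero): it is a direct sum of stable Higgs subbundles of
degree zero. -/
def IsPolystable (Φ : HiggsField F E) : Prop :=
  ∃ (k : ℕ) (W : Fin k → ∀ x, Submodule ℂ (E x)),
    (∀ i, IsStableSub Φ (W i)) ∧ ∀ x, DirectSum.IsInternal fun i => W i x

/-- Polystable but not stable. -/
def IsStrictlyPolystable (Φ : HiggsField F E) : Prop :=
  IsPolystable Φ ∧ ¬ IsStable Φ

end Higgs

/-! ### The line bundles `T^a K^b` -/

section Cocycles

variable {X : Type u} [TopologicalSpace X]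
variable (L : X → Type v) [∀ x, AddCommGroup (L x)] [∀ x, Module ℂ (L x)]
  [TopologicalSpace (TotalSpace ℂ L)] [∀ x, TopologicalSpace (L x)] [FiberBundle ℂ L]
  [VectorBundle ℂ ℂ L]

/-- The transition function, at `z`, of the line bundle `L` from the preferred trivialization at
`x` to the preferred trivialization at `y`. -/
def transition (x y z : X) : ℂ :=
  (trivializationAt ℂ L x).coordChangeL ℂ (trivializationAt ℂ L y) z 1

variable {L}

theorem transition_spec (x y z : X) (hx : z ∈ (trivializationAt ℂ L x).baseSet)
    (hy : z ∈ (trivializationAt ℂ L y).baseSet) (w : L z) :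
    (trivializationAt ℂ L y ⟨z, w⟩).2 =
      transition L x y z * (trivializationAt ℂ L x ⟨z, w⟩).2 := by
  have h1 := (trivializationAt ℂ L x).coordChangeL_apply (R := ℂ) (trivializationAt ℂ L y)
    ⟨hx, hy⟩ ((trivializationAt ℂ L x ⟨z, w⟩).2)
  rw [Trivialization.symm_apply_apply_mk _ hx] at h1
  rw [← h1, transition, mul_comm, ← smul_eq_mul, ← map_smul, smul_eq_mul, mul_one]

theorem transition_ne_zero (x y z : X) : transition L x y z ≠ 0 := by
  simp [transition]

theorem transition_self (x z : X) (hx : z ∈ (trivializationAt ℂ L x).baseSet) :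
    transition L x x z = 1 := by
  have h := transition_spec x x z hx hx ((trivializationAt ℂ L x).symm z 1)
  rw [Trivialization.apply_mk_symm _ hx] at h
  simpa using h.symm

theorem transition_comp (x y w z : X) (hx : z ∈ (trivializationAt ℂ L x).baseSet)
    (hy : z ∈ (trivializationAt ℂ L y).baseSet) (hw : z ∈ (trivializationAt ℂ L w).baseSet) :
    transition L y w z * transition L x y z = transition L x w z := by
  have h := fun a b ha hb =>
    transition_spec (L := L) a b z ha hb ((trivializationAt ℂ L x).symm z 1)
  have h1 := h x y hx hy
  have h2 := h y w hy hw
  have h3 := h x w hx hw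
  rw [Trivialization.apply_mk_symm _ hx] at h1 h3
  simp only [mul_one] at h1 h3
  rw [← h1, ← h2, h3]

end Cocycles

section Twist

variable {X : Type u} [TopologicalSpace X] [ChartedSpace ℂ X] [IsManifold 𝓘(ℂ) ω X]
variable (T : X → Type v) [∀ x, AddCommGroup (T x)] [∀ x, Module ℂ (T x)]
  [TopologicalSpace (TotalSpace ℂ T)] [∀ x, TopologicalSpace (T x)] [FiberBundle ℂ T]
  [VectorBundle ℂ ℂ T] [ContMDiffVectorBundle ω ℂ T 𝓘(ℂ)]

theorem contMDiffOn_transition (x y : X) :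
    ContMDiffOn 𝓘(ℂ) 𝓘(ℂ) ω (transition T x y)
      ((trivializationAt ℂ T x).baseSet ∩ (trivializationAt ℂ T y).baseSet) := 
  (contMDiffOn_coordChangeL (n := ω) (IB := 𝓘(ℂ)) (trivializationAt ℂ T x)
    (trivializationAt ℂ T y)).clm_apply contMDiffOn_const

/-- The open set over which the preferred trivializations at `x` of `T` and of the tangent bundle
are both defined. -/
def domain (x : X) : Set X :=
  (trivializationAt ℂ T x).baseSet ∩
    (trivializationAt ℂ (fun x : X => TangentSpace 𝓘(ℂ) x) x).baseSet

/-- The cocycle of `T^a K^b`, where `K`, the canonical bundle, is the dual of the tangent bundle. -/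
def twistCocycle (a b : ℤ) (x y z : X) : ℂ :=
  transition T x y z ^ a * transition (fun x : X => TangentSpace 𝓘(ℂ) x) x y z ^ (-b)

theorem twistCocycle_self (a b : ℤ) (x z : X) (hz : z ∈ domain T x) :
    twistCocycle T a b x x z = 1 := by
  rw [twistCocycle, transition_self x z hz.1, transition_self x z hz.2]
  simp

theorem twistCocycle_comp (a b : ℤ) (x y w z : X) (hx : z ∈ domain T x) (hy : z ∈ domain T y)
    (hw : z ∈ domain T w) :
    twistCocycle T a b y w z * twistCocycle T a b x y z = twistCocycle T a b x w z := by
  simp only [twistCocycle]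
  rw [← transition_comp x y w z hx.1 hy.1 hw.1, ← transition_comp x y w z hx.2 hy.2 hw.2,
    mul_zpow, mul_zpow]
  ring

theorem contMDiffOn_twistCocycle (a b : ℤ) (x y : X) :
    ContMDiffOn 𝓘(ℂ) 𝓘(ℂ) ω (twistCocycle T a b x y) (domain T x ∩ domain T y) := by
  have key : ∀ (f : X → ℂ) (s : Set X) (n : ℤ), ContMDiffOn 𝓘(ℂ) 𝓘(ℂ) ω f s →
      (∀ z, f z ≠ 0) → ContMDiffOn 𝓘(ℂ) 𝓘(ℂ) ω (fun z => f z ^ n) s := by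
    intro f s n hf h0
    cases n with
    | ofNat n => simpa using hf.pow n
    | negSucc n =>
      simp only [zpow_negSucc]
      exact (hf.pow (n + 1)).inv₀ fun z _ => pow_ne_zero _ (h0 z)
  refine ContMDiffOn.mul (key _ _ a ?_ fun z => transition_ne_zero x y z)
    (key _ _ (-b) ?_ fun z => transition_ne_zero x y z)
  · exact (contMDiffOn_transition T x y).mono fun z hz => ⟨hz.1.1, hz.2.1⟩
  · exact (contMDiffOn_transition (fun x : X => TangentSpace 𝓘(ℂ) x) x y).mono
      fun z hz => ⟨hz.1.2, hz.2.2⟩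

theorem isOpen_domain (x : X) : IsOpen (domain T x) :=
  (Trivialization.open_baseSet _).inter (Trivialization.open_baseSet _)

theorem mem_domain (x : X) : x ∈ domain T x :=
  ⟨FiberBundle.mem_baseSet_trivializationAt' x, FiberBundle.mem_baseSet_trivializationAt' x⟩

/-- The holomorphic line bundle `T^a K^b`. -/
def twist (a b : ℤ) : VectorBundleCore ℂ X ℂ X where
  baseSet := domain T
  isOpen_baseSet := isOpen_domain T
  indexAt x := x
  mem_baseSet_at := mem_domain T
  coordChange x y z := twistCocycle T a b x y z • ContinuousLinearMap.id ℂ ℂ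
  coordChange_self x z hz v := by simp [twistCocycle_self T a b x z hz]
  continuousOn_coordChange x y :=
    (contMDiffOn_twistCocycle T a b x y).continuousOn.smul continuousOn_const
  coordChange_comp x y w z hz v := by
    simp [← twistCocycle_comp T a b x y w z hz.1.1 hz.1.2 hz.2, mul_assoc]

theorem contMDiffOn_diag {n : ℕ} (a b : Fin n → ℤ) (x y : X) :
    ContMDiffOn 𝓘(ℂ) 𝓘(ℂ, (Fin n → ℂ) →L[ℂ] (Fin n → ℂ)) ω
      (fun z => ContinuousLinearMap.pi fun k =>
        twistCocycle T (a k) (b k) x y z • ContinuousLinearMap.proj (R := ℂ) (φ := fun _ : Fin n => ℂ) k)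
      (domain T x ∩ domain T y) := by
  have h : (fun z => ContinuousLinearMap.pi fun k =>
        twistCocycle T (a k) (b k) x y z • ContinuousLinearMap.proj (R := ℂ) (φ := fun _ : Fin n => ℂ) k) =
      fun z => ∑ k, twistCocycle T (a k) (b k) x y z •
        ((ContinuousLinearMap.single ℂ (fun _ : Fin n => ℂ) k).comp
          (ContinuousLinearMap.proj (R := ℂ) (φ := fun _ : Fin n => ℂ) k)) := by
    funext z
    ext w k
    simp [Finset.sum_apply, Pi.single_apply]
  rw [h]
  exact contMDiffOn_finsetSum fun k _ =>
    (contMDiffOn_twistCocycle T (a k) (b k) x y).smul contMDiffOn_const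

/-- The direct sum of the line bundles `T^(a k) K^(b k)`. -/
def twistSum {n : ℕ} (a b : Fin n → ℤ) : VectorBundleCore ℂ X (Fin n → ℂ) X where
  baseSet := domain T
  isOpen_baseSet := isOpen_domain T
  indexAt x := x
  mem_baseSet_at := mem_domain T
  coordChange x y z := ContinuousLinearMap.pi fun k =>
    twistCocycle T (a k) (b k) x y z • ContinuousLinearMap.proj k
  coordChange_self x z hz v := by
    ext k
    simp [twistCocycle_self T (a k) (b k) x z hz]
  continuousOn_coordChange x y := (contMDiffOn_diag T a b x y).continuousOn
  coordChange_comp x y w z hz v := by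
    ext k
    simp [← twistCocycle_comp T (a k) (b k) x y w z hz.1.1 hz.1.2 hz.2, mul_assoc]

instance (a b : ℤ) : (twist T a b).IsContMDiff 𝓘(ℂ) ω where
  contMDiffOn_coordChange x y :=
    (contMDiffOn_twistCocycle T a b x y).smul contMDiffOn_const

instance {n : ℕ} (a b : Fin n → ℤ) : (twistSum T a b).IsContMDiff 𝓘(ℂ) ω where
  contMDiffOn_coordChange x y := contMDiffOn_diag T a b x y

end Twist

/-! ### `α`-cyclic Higgs bundles -/

section Alpha

variable {X : Type u} [TopologicalSpace X] [ChartedSpace ℂ X] [IsManifold 𝓘(ℂ) ω X]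
variable (T : X → Type v) [∀ x, AddCommGroup (T x)] [∀ x, Module ℂ (T x)]
  [TopologicalSpace (TotalSpace ℂ T)] [∀ x, TopologicalSpace (T x)] [FiberBundle ℂ T]
  [VectorBundle ℂ ℂ T] [ContMDiffVectorBundle ω ℂ T 𝓘(ℂ)]

/-- The space `H⁰(T^a K^b)` of global holomorphic sections. -/
abbrev HolSection (a b : ℤ) : Type u :=
  ContMDiffSection 𝓘(ℂ) ℂ ω (twist T a b).Fiber

/-- The exponents of `T` in `T²K, TK, T, O, T⁻¹, T⁻¹K⁻¹, T⁻²K⁻¹`. -/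
def expT : Fin 7 → ℤ := ![2, 1, 1, 0, -1, -1, -2]

/-- The exponents of `K` in `T²K, TK, T, O, T⁻¹, T⁻¹K⁻¹, T⁻²K⁻¹`. -/
def expK : Fin 7 → ℤ := ![1, 1, 0, 0, 0, -1, -1]

/-- The holomorphic vector bundle `T²K ⊕ TK ⊕ T ⊕ O ⊕ T⁻¹ ⊕ T⁻¹K⁻¹ ⊕ T⁻²K⁻¹`. -/
abbrev alphaBundle : VectorBundleCore ℂ X (Fin 7 → ℂ) X :=
  twistSum T expT expK

/-- The matrix of the Higgs field, with columns as sources: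
`T²K → TK → T → O → T⁻¹ → T⁻¹K⁻¹ → T⁻²K⁻¹` by `β, 1, -i√2 β, -i√2 β, 1, β`, and
`T⁻¹K⁻¹ → T²K`, `T⁻²K⁻¹ → TK` by `δ`. -/
def alphaMatrix (β δ : ℂ) : Matrix (Fin 7) (Fin 7) ℂ :=
  let c : ℂ := -(Complex.I * (Real.sqrt 2 : ℂ))
  !![0, 0, 0, 0, 0, δ, 0;
     β, 0, 0, 0, 0, 0, δ;
     0, 1, 0, 0, 0, 0, 0;
     0, 0, c * β, 0, 0, 0, 0;
     0, 0, 0, c * β, 0, 0, 0;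
     0, 0, 0, 0, 1, 0, 0;
     0, 0, 0, 0, 0, β, 0]

variable {T}

/-- The coordinate of a tangent vector in the preferred trivialization at its base point. -/
def tangentCoord (x : X) : TangentSpace 𝓘(ℂ) x →ₗ[ℂ] ℂ :=
  ((trivializationAt ℂ (fun x : X => TangentSpace 𝓘(ℂ) x) x).continuousLinearMapAt ℂ x).toLinearMap

/-- The endomorphism `Φ(v)` of the fibre at `x`: the fibres at `x` of the line bundles `T^a K^b`
are identified with `ℂ` by the preferred trivializations of `T` and of the tangent bundle at `x`. -/
def alphaField (β : HolSection T (-1) 1) (δ : HolSection T 3 3) (x : X) :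
    TangentSpace 𝓘(ℂ) x →ₗ[ℂ] (alphaBundle T).Fiber x →ₗ[ℂ] (alphaBundle T).Fiber x :=
  (tangentCoord x).smulRight (Matrix.toLin' (alphaMatrix (β x) (δ x)))

theorem alphaMatrix_equivariant {τ κ : ℂ} (hτ : τ ≠ 0) (hκ : κ ≠ 0) (b d c : ℂ)
    (w : Fin 7 → ℂ) (k : Fin 7) :
    τ ^ expT k * κ ^ (-expK k) * (c • (alphaMatrix b d).mulVec w) k =
      ((κ * c) • (alphaMatrix (τ ^ (-1 : ℤ) * κ ^ (-1 : ℤ) * b)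
        (τ ^ (3 : ℤ) * κ ^ (-3 : ℤ) * d)).mulVec
          fun j => τ ^ expT j * κ ^ (-expK j) * w j) k := by
  simp only [Pi.smul_apply, smul_eq_mul, Matrix.mulVec, dotProduct, Fin.sum_univ_seven]
  fin_cases k <;> simp [alphaMatrix, expT, expK, zpow_neg] <;> field_simp

theorem alphaField_holomorphic (β : HolSection T (-1) 1) (δ : HolSection T 3 3) (p : X)
    (v : ∀ x : X, TangentSpace 𝓘(ℂ) x) (s : ∀ x, (alphaBundle T).Fiber x) (hv : HolAt ℂ v p)
    (hs : HolAt (Fin 7 → ℂ) s p) :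
    HolAt (Fin 7 → ℂ) (fun x => alphaField β δ x (v x) (s x)) p := by
  have hβ := β.contMDiff p
  have hδ := δ.contMDiff p
  unfold HolAt at hv hs ⊢
  rw [contMDiffAt_section] at hv hs hβ hδ ⊢
  have hs' := fun k => (contMDiffAt_pi_space.1 hs) k
  have key : ∀ᶠ x in 𝓝 p,
      (trivializationAt (Fin 7 → ℂ) (alphaBundle T).Fiber p
        ⟨x, alphaField β δ x (v x) (s x)⟩).2 =
      (trivializationAt ℂ (fun x : X => TangentSpace 𝓘(ℂ) x) p ⟨x, v x⟩).2 •
        (alphaMatrix (trivializationAt ℂ (twist T (-1) 1).Fiber p ⟨x, β x⟩).2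
          (trivializationAt ℂ (twist T 3 3).Fiber p ⟨x, δ x⟩).2).mulVec
          (trivializationAt (Fin 7 → ℂ) (alphaBundle T).Fiber p ⟨x, s x⟩).2 := by
    filter_upwards [(isOpen_domain T p).mem_nhds (mem_domain T p)] with x hx
    have e3 := transition_spec (L := fun x : X => TangentSpace 𝓘(ℂ) x) x p x
      (mem_domain T x).2 hx.2 (v x)
    have e4 : tangentCoord x (v x) =
        (trivializationAt ℂ (fun x : X => TangentSpace 𝓘(ℂ) x) x ⟨x, v x⟩).2 :=
      Trivialization.continuousLinearMapAt_apply_of_mem ℂ _ (mem_domain T x).2 _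
    rw [← e4] at e3
    rw [e3]
    ext k
    exact alphaMatrix_equivariant (transition_ne_zero (L := T) x p x)
      (transition_ne_zero (L := fun x : X => TangentSpace 𝓘(ℂ) x) x p x)
      (β x) (δ x) (tangentCoord x (v x)) (s x) k
  refine ContMDiffAt.congr_of_eventuallyEq ?_ key
  rw [contMDiffAt_pi_space]
  intro i
  have h : ∀ j, ContMDiffAt 𝓘(ℂ) 𝓘(ℂ) ω (fun x =>
      alphaMatrix (trivializationAt ℂ (twist T (-1) 1).Fiber p ⟨x, β x⟩).2
        (trivializationAt ℂ (twist T 3 3).Fiber p ⟨x, δ x⟩).2 i j) p := by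
    intro j
    fin_cases i <;> fin_cases j <;> simp [alphaMatrix] <;>
      first
        | exact contMDiffAt_const
        | exact hβ
        | exact hδ
        | exact (contMDiffAt_const.mul hβ).neg
  simp only [Pi.smul_apply, Matrix.mulVec, dotProduct, Fin.sum_univ_seven, smul_eq_mul]
  have m := fun j => (h j).mul (hs' j)
  exact hv.mul (((((((m 0).add (m 1)).add (m 2)).add (m 3)).add (m 4)).add (m 5)).add (m 6))

/-- The holomorphic sections `β` and `δ` have the same divisor. -/
def SameDivisor {a b a' b' : ℤ} (β : HolSection T a b) (δ : HolSection T a' b') : Prop :=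
  ∀ p, vanishingOrder β p = vanishingOrder δ p

/-- The Higgs field of the `α`-cyclic Higgs bundle determined by `T`, `β ∈ H⁰(T⁻¹K)` and
`δ ∈ H⁰(T³K³)`. -/
def alphaHiggs (β : HolSection T (-1) 1) (δ : HolSection T 3 3) :
    HiggsField (Fin 7 → ℂ) (alphaBundle T).Fiber where
  toFun := alphaField β δ
  holomorphic := alphaField_holomorphic β δ

end Alpha

end AlphaCyclic

end

/-!
The bundle is a sum of seven line bundles `L₀, …, L₆` of degrees `d₀, …, d₆`, and everything rests
on one estimate for the degree of a subbundle `W` of rank `r`. For a set `J` of `r` indices, the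
Plücker coordinate of `W` with index `J` is a holomorphic section of `(det W)* ⊗ ⨂_{j ∈ J} L_j`. If
it does not vanish at some point (`J` is then called a *pivot set* of the fibre), it has finitely
many zeros and `deg W = ∑_{j ∈ J} d_j - N`, where `N` is their number: `hasDegree_of_isPivot`. This
uses that a meromorphic function on a compact Riemann surface has as many zeros as poles
(`finsum_ord_eq_zero`), because the number of points at which it takes the value `c` is locally
constant in `c`. Stability is thereby reduced to finding, in a single fibre, a pivot set of negative
degree for every proper invariant subspace.

*Both sections nonzero.* In a fibre where `β, δ ≠ 0` the Higgs field has a one-dimensional kernel,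
spanned by `δ e₀ - β e₆`, and a complementary six-dimensional image, on which it acts as a weighted
cyclic shift of six coordinates. The pivot sets of an invariant subspace are permuted by the
rotations of the cycle, so their degrees can be averaged; since the coordinates `0` and `6` are
interchangeable on the image, the average can be made negative unless `deg L₀ = 0`, that is
`deg T = 1 - g` (`exists_isPivot_neg_or`). In the remaining case the subspace has two pivot sets of
degree zero that differ by exchanging `0` and `6`. A subbundle of degree zero has both of them in
every fibre, hence a local section whose coordinates `u₀`, `u₆` have no zeros and satisfy
`β u₀ = ± δ u₆`, so that `β` and `δ` have the same divisor (`sameDivisor_of_isPivot`).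

*The exception.* If `deg T = 1 - g` and the divisors agree, the kernel and the image extend to
complementary Higgs subbundles `L` and `P` of degree zero. If `P` is not stable, it has a subbundle
`W` of rank three with the pivot sets `{0, 2, 4}` and `{1, 3, 5}` in every fibre, and the bundle is
the sum of `L`, `W` and the image of `W` under the involution `(-1)^j`, with which the Higgs field
anticommutes: `isStrictlyPolystable_of_sameDivisor`.

*One section zero.* The bundle is then a sum of chains of line bundles, and an invariant subspace of
a chain is one of its tails (`isStableSub_coordSubspace`). Conversely, if the bundle is polystable,
a summand `L_j` killed by the Higgs field projects to the stable summands, and the saturation of its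
image is a Higgs subbundle, of degree at most zero; if `L_j` is generically in the image of the
Higgs field, the saturation is a proper subbundle and `d_j < 0` (`lineDeg_nonpos_of_isPolystable`).
For `δ = 0` this is applied to `L₆`, for `β = 0` to `L₀`.

The remaining bounds on `deg T` say that `T⁻¹K` and `T³K³` have nonnegative degree when `β`,
respectively `δ`, is not zero.
-/

noncomputable section

set_option linter.unusedSectionVars false

namespace AlphaCyclic

universe u v

/-! ### Punctured neighbourhoods and local multiplicities -/

section Analysis

open Filter

variable {X : Type u} [TopologicalSpace X]

/-- The topological part of the identity theorem: if near every point a property either holds or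
fails on a punctured neighbourhood, then on a connected space the same alternative occurs at every
point. -/
theorem eventually_punctured_or [T1Space X] [ConnectedSpace X] [∀ p : X, (𝓝[≠] p).NeBot]
    (G : X → Prop) (h : ∀ p, (∀ᶠ x in 𝓝[≠] p, ¬ G x) ∨ ∀ᶠ x in 𝓝[≠] p, G x) :
    (∀ p, ∀ᶠ x in 𝓝[≠] p, ¬ G x) ∨ ∀ p, ∀ᶠ x in 𝓝[≠] p, G x := by
  have open_aux : ∀ H : X → Prop, IsOpen {p | ∀ᶠ x in 𝓝[≠] p, H x} := by
    intro H
    rw [isOpen_iff_mem_nhds]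
    intro p hp
    obtain ⟨U, hU, hUo, hpU⟩ := eventually_nhds_iff.1 (eventually_nhdsWithin_iff.1 hp)
    filter_upwards [hUo.mem_nhds hpU] with q hq
    by_cases hqp : q = p
    · rw [hqp]; exact hp
    · refine eventually_nhdsWithin_of_eventually_nhds ?_
      filter_upwards [(hUo.sdiff isClosed_singleton).mem_nhds ⟨hq, hqp⟩] with x hx
      exact hU x hx.1 hx.2
  have hcl : IsClopen {p | ∀ᶠ x in 𝓝[≠] p, G x} := by
    refine ⟨?_, open_aux G⟩
    have : {p | ∀ᶠ x in 𝓝[≠] p, G x} = {p | ∀ᶠ x in 𝓝[≠] p, ¬ G x}ᶜ := by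
      ext p
      refine ⟨fun hp hp' => ?_, fun hp => (h p).resolve_left hp⟩
      have hp1 : ∀ᶠ x in 𝓝[≠] p, G x := hp
      have hp2 : ∀ᶠ x in 𝓝[≠] p, ¬ G x := hp'
      obtain ⟨x, hx⟩ := (hp1.and hp2).exists
      exact hx.2 hx.1
    rw [this]
    exact (open_aux _).isClosed_compl
  rcases isClopen_iff.1 hcl with h0 | h1
  · left
    intro p
    refine (h p).resolve_right fun hp => ?_
    have : p ∈ {p | ∀ᶠ x in 𝓝[≠] p, G x} := hp
    rw [h0] at this
    exact this
  · right
    intro p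
    have : p ∈ (Set.univ : Set X) := trivial
    rwa [← h1] at this

/-- A property that holds on a punctured neighbourhood of every point of a compact space fails only
at finitely many points. -/
theorem finite_setOf_not_of_punctured [CompactSpace X] (G : X → Prop)
    (h : ∀ p, ∀ᶠ x in 𝓝[≠] p, G x) : {x | ¬ G x}.Finite := by
  choose U hU using fun p => (eventually_nhds_iff.1 (eventually_nhdsWithin_iff.1 (h p)))
  obtain ⟨t, ht⟩ := isCompact_univ.elim_finite_subcover U (fun p => (hU p).2.1)
    fun p _ => Set.mem_iUnion.2 ⟨p, (hU p).2.2⟩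
  refine t.finite_toSet.subset fun x hx => ?_
  obtain ⟨p, hp, hxp⟩ := Set.mem_iUnion₂.1 (ht (Set.mem_univ x))
  by_contra hxt
  exact hx ((hU p).1 x hxp fun hxp' => hxt (by rw [Set.mem_singleton_iff.1 hxp']; exact hp))

/-- Conservation of number: if near each point `p` the multiplicity function `m' c` is, for `c`
close to the limit, the indicator function of `m p` points, then its total is that of `m`. -/
theorem eventually_finsum_eq [T2Space X] [CompactSpace X] {C : Type*} (l : Filter C) (m : X → ℕ)
    (hm : (Function.support m).Finite) (m' : C → X → ℕ)
    (h : ∀ p, ∀ U ∈ 𝓝 p, ∃ V ⊆ U, IsOpen V ∧ p ∈ V ∧ ∀ᶠ c in l, ∃ S : Finset X, ↑S ⊆ V ∧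
      S.card = m p ∧ ∀ q ∈ V, m' c q = (↑S : Set X).indicator 1 q) :
    ∀ᶠ c in l, (Function.support (m' c)).Finite ∧ ∑ᶠ q, m' c q = ∑ᶠ q, m q := by
  classical
  obtain ⟨U, hU, hUd⟩ := hm.t2_separation
  choose V hVU hVo hpV hV using fun p => h p (U p) ((hU p).2.mem_nhds (hU p).1)
  obtain ⟨t, ht⟩ := isCompact_univ.elim_finite_subcover V hVo
    fun p _ => Set.mem_iUnion.2 ⟨p, hpV p⟩
  have hall : ∀ᶠ c in l, ∀ p ∈ t ∪ hm.toFinset, ∃ S : Finset X, ↑S ⊆ V p ∧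
      S.card = m p ∧ ∀ q ∈ V p, m' c q = (↑S : Set X).indicator 1 q :=
    (Finset.eventually_all _).2 fun p _ => hV p
  filter_upwards [hall] with c hc
  choose! S hSV hSc hS using hc
  have hSt : ∀ p ∈ t, ∀ q ∈ V p, q ∉ hm.toFinset.biUnion S → m' c q = 0 := by
    intro p hp q hq hqS
    rw [hS p (Finset.mem_union_left _ hp) q hq, Set.indicator_of_notMem]
    intro hqp
    by_cases hpm : p ∈ hm.toFinset
    · exact hqS (Finset.mem_biUnion.2 ⟨p, hpm, hqp⟩)
    · have h0 : m p = 0 := by simpa using hpm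
      rw [← hSc p (Finset.mem_union_left _ hp), Finset.card_eq_zero] at h0
      rw [h0] at hqp
      simp at hqp
  have hind : m' c = (↑(hm.toFinset.biUnion S) : Set X).indicator 1 := by
    funext q
    by_cases hq : q ∈ hm.toFinset.biUnion S
    · rw [Set.indicator_of_mem (by exact hq)]
      obtain ⟨p, hp, hqp⟩ := Finset.mem_biUnion.1 hq
      rw [hS p (Finset.mem_union_right _ hp) q (hSV p (Finset.mem_union_right _ hp) hqp),
        Set.indicator_of_mem (by exact hqp)]
    · rw [Set.indicator_of_notMem (by exact hq)]
      obtain ⟨p, hp, hqp⟩ := Set.mem_iUnion₂.1 (ht (Set.mem_univ q))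
      exact hSt p hp q hqp hq
  constructor
  · rw [hind]
    exact (hm.toFinset.biUnion S).finite_toSet.subset Set.support_indicator_subset
  have hsum : ∑ᶠ q, m' c q = (hm.toFinset.biUnion S).card := by
    rw [hind, finsum_eq_sum_of_support_subset (s := hm.toFinset.biUnion S) _
      Set.support_indicator_subset, Finset.card_eq_sum_ones]
    exact Finset.sum_congr rfl fun q hq => Set.indicator_of_mem (by exact hq) _
  rw [hsum, Finset.card_biUnion, finsum_eq_sum _ hm]
  · exact Finset.sum_congr rfl fun p hp => hSc p (Finset.mem_union_right _ hp)
  · intro p hp q hq hpq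
    refine Finset.disjoint_coe.1 ?_
    exact ((hUd (by simpa using hp) (by simpa using hq) hpq).mono (hVU p) (hVU q)).mono
      (hSV p (Finset.mem_union_right _ hp)) (hSV q (Finset.mem_union_right _ hq))

/-- Near a zero of order `n`, an analytic function takes each small nonzero value exactly `n` times,
each time with multiplicity one: it is the `n`-th power of a local coordinate. -/
theorem exists_fiber_card {F : ℂ → ℂ} {z₀ : ℂ} {n : ℕ} (hF : AnalyticAt ℂ F z₀)
    (hn : analyticOrderAt F z₀ = n) (h0 : n ≠ 0) (U : Set ℂ) (hU : U ∈ 𝓝 z₀) :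
    ∃ V ⊆ U, IsOpen V ∧ z₀ ∈ V ∧ ∀ᶠ w in 𝓝[≠] (0 : ℂ), ∃ S : Finset ℂ, ↑S ⊆ V ∧ S.card = n ∧
      ∀ z ∈ V, AnalyticAt ℂ F z ∧ (F z = w ↔ z ∈ S) ∧
        (F z = w → analyticOrderAt (fun y => F y - w) z = 1) := by
  classical
  obtain ⟨g, hg, hg0, hFg⟩ := (hF.analyticOrderAt_eq_natCast).1 hn
  obtain ⟨a, ha⟩ : ∃ a : ℂ, a ^ n = g z₀ := IsAlgClosed.exists_pow_nat_eq _ (Nat.pos_of_ne_zero h0)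
  have ha0 : a ≠ 0 := by
    rintro rfl
    rw [zero_pow h0] at ha
    exact hg0 ha.symm
  -- an analytic `n`-th root of `g`
  set h : ℂ → ℂ := fun z => a * (g z / g z₀) ^ (1 / n : ℂ) with hh
  have hha : AnalyticAt ℂ h z₀ := by
    refine analyticAt_const.mul (AnalyticAt.cpow (hg.div analyticAt_const hg0) analyticAt_const ?_)
    rw [div_self hg0]
    exact Complex.one_mem_slitPlane
  have hhz : h z₀ = a := by simp [hh, div_self hg0]
  have hhn : ∀ z, h z ^ n = g z := by
    intro z
    rw [hh]
    simp only [mul_pow, one_div]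
    rw [Complex.cpow_nat_inv_pow _ h0, ha, mul_div_cancel₀ _ hg0]
  set ψ : ℂ → ℂ := fun z => (z - z₀) * h z with hψ
  have hψa : AnalyticAt ℂ ψ z₀ := (analyticAt_id.sub analyticAt_const).mul hha
  have hψz : ψ z₀ = 0 := by simp [hψ]
  have hψd : HasStrictDerivAt ψ a z₀ := by
    have h1 : HasDerivAt ψ (1 * h z₀ + (z₀ - z₀) * deriv h z₀) z₀ :=
      ((hasDerivAt_id z₀).sub_const z₀).mul hha.differentiableAt.hasDerivAt
    rw [sub_self, zero_mul, add_zero, one_mul, hhz] at h1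
    rw [← h1.deriv]
    exact hψa.hasStrictDerivAt
  have hFψ : ∀ᶠ z in 𝓝 z₀, F z = ψ z ^ n := by
    filter_upwards [hFg] with z hz
    rw [hz, hψ, mul_pow, hhn, smul_eq_mul]
  have hψs := hψd.hasStrictFDerivAt_equiv ha0
  set e := hψs.toOpenPartialHomeomorph ψ with he
  have hecoe : ∀ z, e z = ψ z := fun z => by
    rw [he, hψs.toOpenPartialHomeomorph_coe]
  have hez : z₀ ∈ e.source := hψs.mem_toOpenPartialHomeomorph_source
  have hd : ∀ᶠ z in 𝓝 z₀, deriv ψ z ≠ 0 := by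
    refine (hψa.deriv.continuousAt).eventually_ne ?_
    rw [hψd.hasDerivAt.deriv]
    exact ha0
  have hgood : ∀ᶠ z in 𝓝 z₀, (z ∈ U ∧ AnalyticAt ℂ ψ z ∧ deriv ψ z ≠ 0) ∧
      ∀ᶠ y in 𝓝 z, F y = ψ y ^ n :=
    ((eventually_mem_set.2 hU).and (hψa.eventually_analyticAt.and hd)).and
      (eventually_eventually_nhds.2 hFψ)
  -- a ball in the target over which everything is good
  have hball : ∀ᶠ w in 𝓝 (0 : ℂ), w ∈ e.target ∧ ((e.symm w ∈ U ∧ AnalyticAt ℂ ψ (e.symm w) ∧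
      deriv ψ (e.symm w) ≠ 0) ∧ ∀ᶠ y in 𝓝 (e.symm w), F y = ψ y ^ n) := by
    have hez0 : e z₀ = 0 := by rw [hecoe, hψz]
    have ht : (0 : ℂ) ∈ e.target := by rw [← hez0]; exact e.map_source hez
    have hs : e.symm 0 = z₀ := by rw [← hez0]; exact e.left_inv hez
    have hc := e.continuousAt_symm ht
    rw [ContinuousAt, hs] at hc
    exact (e.open_target.eventually_mem ht).and (hc.eventually hgood)
  obtain ⟨r, hr, hrb⟩ := Metric.eventually_nhds_iff_ball.1 hball
  have hV : ∀ z ∈ e.source ∩ e ⁻¹' Metric.ball 0 r, (z ∈ U ∧ AnalyticAt ℂ ψ z ∧ deriv ψ z ≠ 0) ∧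
      ∀ᶠ y in 𝓝 z, F y = ψ y ^ n := by
    rintro z ⟨hz, hzr⟩
    have := (hrb (e z) hzr).2
    rwa [e.left_inv hz] at this
  refine ⟨e.source ∩ e ⁻¹' Metric.ball 0 r, fun z hz => (hV z hz).1.1,
    e.isOpen_inter_preimage Metric.isOpen_ball, ⟨hez, ?_⟩, ?_⟩
  · rw [Set.mem_preimage, hecoe, hψz]
    exact Metric.mem_ball_self hr
  have hrn : ∀ᶠ w in 𝓝[≠] (0 : ℂ), w ≠ 0 ∧ ‖w‖ < r ^ n := by
    refine (eventually_mem_nhdsWithin).and (eventually_nhdsWithin_of_eventually_nhds ?_)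
    have : ContinuousAt (fun w : ℂ => ‖w‖) 0 := continuous_norm.continuousAt
    refine this.eventually_lt continuousAt_const ?_
    rw [norm_zero]
    exact pow_pos hr n
  filter_upwards [hrn] with w hw
  have hroot : ∀ ζ : ℂ, ζ ^ n = w → ζ ∈ Metric.ball (0 : ℂ) r := by
    intro ζ hζ
    rw [mem_ball_zero_iff]
    refine lt_of_pow_lt_pow_left₀ n hr.le ?_
    rw [← norm_pow, hζ]
    exact hw.2
  have hprim := Complex.isPrimitiveRoot_exp n h0
  have hmem : ∀ ζ : ℂ, ζ ∈ (Polynomial.nthRoots n w).toFinset ↔ ζ ^ n = w := fun ζ => by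
    rw [Multiset.mem_toFinset, Polynomial.mem_nthRoots (Nat.pos_of_ne_zero h0)]
  refine ⟨(Polynomial.nthRoots n w).toFinset.image e.symm, ?_, ?_, ?_⟩
  · intro z hz
    obtain ⟨ζ, hζ, rfl⟩ := Finset.mem_image.1 (Finset.mem_coe.1 hz)
    have hζr := hroot ζ ((hmem ζ).1 hζ)
    have hζt := (hrb ζ hζr).1
    refine ⟨e.map_target hζt, ?_⟩
    rw [Set.mem_preimage, e.right_inv hζt]
    exact hζr
  · rw [Finset.card_image_of_injOn, Multiset.toFinset_card_of_nodup
      (hprim.nthRoots_nodup hw.1), hprim.card_nthRoots, if_pos]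
    · obtain ⟨b, hb⟩ := IsAlgClosed.exists_pow_nat_eq w (Nat.pos_of_ne_zero h0)
      exact ⟨b, hb⟩
    · intro ζ hζ ξ hξ hζξ
      exact e.symm.injOn (hrb ζ (hroot ζ ((hmem ζ).1 hζ))).1 (hrb ξ (hroot ξ ((hmem ξ).1 hξ))).1 hζξ
  · intro z hz
    obtain ⟨⟨-, hza, hzd⟩, hzF⟩ := hV z hz
    have hFz : F z = ψ z ^ n := hzF.self_of_nhds
    refine ⟨(hza.pow n).congr (hzF.mono fun y hy => hy.symm), ?_, ?_⟩
    · rw [Finset.mem_image, hFz]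
      constructor
      · intro hzw
        exact ⟨ψ z, (hmem _).2 hzw, by rw [← hecoe]; exact e.left_inv hz.1⟩
      · rintro ⟨ζ, hζ, rfl⟩
        rw [← hecoe, e.right_inv (hrb ζ (hroot ζ ((hmem ζ).1 hζ))).1]
        exact (hmem ζ).1 hζ
    · intro hzw
      have hcongr : (fun y => F y - w) =ᶠ[𝓝 z] fun y => ψ y ^ n - w := by
        filter_upwards [hzF] with y hy
        rw [hy]
      rw [analyticOrderAt_congr hcongr]
      refine AnalyticAt.analyticOrderAt_eq_one_of_zero_deriv_ne_zero
        ((hza.pow n).sub analyticAt_const) ?_ ?_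
      · rw [← hFz, hzw, sub_self]
      · have hdv : HasDerivAt (fun y => ψ y ^ n - w) (n * ψ z ^ (n - 1) * deriv ψ z) z :=
          (hza.differentiableAt.hasDerivAt.pow n).sub_const w
        rw [hdv.deriv]
        refine mul_ne_zero (mul_ne_zero (Nat.cast_ne_zero.2 h0) (pow_ne_zero _ ?_)) hzd
        intro h00
        rw [h00, zero_pow h0] at hFz
        exact hw.1 (by rw [← hzw, hFz])

end Analysis

/-! ### Orders of meromorphic functions on a Riemann surface -/

section Charts

open Filter

variable {X : Type u} [TopologicalSpace X] [ChartedSpace ℂ X]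

/-- `f` is analytic at `p` in the chart at `p`. -/
def AnaAt (f : X → ℂ) (p : X) : Prop :=
  AnalyticAt ℂ (f ∘ (chartAt ℂ p).symm) (chartAt ℂ p p)

/-- `f` is meromorphic at `p` in the chart at `p`. -/
def MeroAt (f : X → ℂ) (p : X) : Prop :=
  MeromorphicAt (f ∘ (chartAt ℂ p).symm) (chartAt ℂ p p)

/-- The order of `f` at `p`, computed in the chart at `p`. -/
def ordAt (f : X → ℂ) (p : X) : WithTop ℤ :=
  meromorphicOrderAt (f ∘ (chartAt ℂ p).symm) (chartAt ℂ p p)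

theorem hasMeroOrder_iff {f : X → ℂ} {p : X} {n : ℤ} :
    HasMeroOrder f p n ↔ MeroAt f p ∧ ordAt f p = n :=
  Iff.rfl

theorem tendsto_chart_symm (p : X) {q : X} (hq : q ∈ (chartAt ℂ p).source) :
    Tendsto (chartAt ℂ p).symm (𝓝 (chartAt ℂ p q)) (𝓝 q) := by
  have := (chartAt ℂ p).continuousAt_symm ((chartAt ℂ p).map_source hq)
  rwa [ContinuousAt, (chartAt ℂ p).left_inv hq] at this

theorem eventually_chart_iff (p : X) {q : X} (hq : q ∈ (chartAt ℂ p).source) (P : X → Prop) :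
    (∀ᶠ z in 𝓝 (chartAt ℂ p q), P ((chartAt ℂ p).symm z)) ↔ ∀ᶠ x in 𝓝 q, P x := by
  refine ⟨fun h => ?_, fun h => (tendsto_chart_symm p hq).eventually h⟩
  filter_upwards [((chartAt ℂ p).continuousAt hq).eventually h,
    (chartAt ℂ p).open_source.mem_nhds hq] with x hx hxs
  rwa [(chartAt ℂ p).left_inv hxs] at hx

theorem eventually_punctured_chart_iff (p : X) {q : X} (hq : q ∈ (chartAt ℂ p).source)
    (P : X → Prop) :
    (∀ᶠ z in 𝓝[≠] (chartAt ℂ p q), P ((chartAt ℂ p).symm z)) ↔ ∀ᶠ x in 𝓝[≠] q, P x := by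
  rw [eventually_nhdsWithin_iff, eventually_nhdsWithin_iff, ← eventually_chart_iff p hq]
  refine eventually_congr ?_
  filter_upwards [(chartAt ℂ p).open_target.mem_nhds ((chartAt ℂ p).map_source hq)] with z hz
  have : (chartAt ℂ p).symm z ∈ ({q}ᶜ : Set X) ↔ z ∈ ({chartAt ℂ p q}ᶜ : Set ℂ) := by
    simp only [Set.mem_compl_iff, Set.mem_singleton_iff, not_iff_not]
    constructor
    · intro h; rw [← h, (chartAt ℂ p).right_inv hz]
    · intro h; rw [h, (chartAt ℂ p).left_inv hq]
  rw [this]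

theorem neBot_punctured (p : X) : (𝓝[≠] p).NeBot := by
  rw [← frequently_true_iff_neBot, Filter.Frequently]
  intro h
  rw [← eventually_punctured_chart_iff p (mem_chart_source ℂ p) (fun _ => ¬ True)] at h
  simp [NeBot.ne'] at h

theorem ordAt_congr {f g : X → ℂ} {p : X} (h : ∀ᶠ x in 𝓝[≠] p, f x = g x) :
    ordAt f p = ordAt g p :=
  meromorphicOrderAt_congr ((eventually_punctured_chart_iff p (mem_chart_source ℂ p) _).2 h)

theorem MeroAt.congr {f g : X → ℂ} {p : X} (hf : MeroAt f p) (h : ∀ᶠ x in 𝓝[≠] p, f x = g x) :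
    MeroAt g p :=
  MeromorphicAt.congr hf ((eventually_punctured_chart_iff p (mem_chart_source ℂ p) _).2 h)

theorem HasMeroOrder.congr {f g : X → ℂ} {p : X} {n : ℤ} (hf : HasMeroOrder f p n)
    (h : ∀ᶠ x in 𝓝[≠] p, f x = g x) : HasMeroOrder g p n :=
  ⟨MeroAt.congr hf.1 h, (ordAt_congr h).symm.trans hf.2⟩

theorem AnaAt.congr {f g : X → ℂ} {p : X} (hf : AnaAt f p) (h : ∀ᶠ x in 𝓝 p, f x = g x) :
    AnaAt g p :=
  AnalyticAt.congr hf ((eventually_chart_iff p (mem_chart_source ℂ p) _).2 h)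

theorem AnaAt.meroAt {f : X → ℂ} {p : X} (hf : AnaAt f p) : MeroAt f p :=
  AnalyticAt.meromorphicAt hf

theorem AnaAt.continuousAt {f : X → ℂ} {p : X} (hf : AnaAt f p) : ContinuousAt f p := by
  have h := AnalyticAt.continuousAt hf
  have hc : ContinuousAt ((f ∘ (chartAt ℂ p).symm) ∘ chartAt ℂ p) p :=
    ContinuousAt.comp h ((chartAt ℂ p).continuousAt (mem_chart_source ℂ p))
  refine hc.congr ?_
  filter_upwards [(chartAt ℂ p).open_source.mem_nhds (mem_chart_source ℂ p)] with x hx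
  simp [(chartAt ℂ p).left_inv hx]

theorem AnaAt.ordAt_nonneg {f : X → ℂ} {p : X} (hf : AnaAt f p) : 0 ≤ ordAt f p :=
  AnalyticAt.meromorphicOrderAt_nonneg hf

theorem AnaAt.ordAt_eq_zero_iff {f : X → ℂ} {p : X} (hf : AnaAt f p) :
    ordAt f p = 0 ↔ f p ≠ 0 := by
  have hp : (chartAt ℂ p).symm (chartAt ℂ p p) = p := (chartAt ℂ p).left_inv (mem_chart_source ℂ p)
  have h := AnalyticAt.analyticOrderAt_eq_zero hf
  rw [Function.comp_apply, hp] at h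
  rw [← h, ordAt, AnalyticAt.meromorphicOrderAt_eq hf]
  cases analyticOrderAt (f ∘ (chartAt ℂ p).symm) (chartAt ℂ p p) with
  | top => simp
  | coe n => simp

theorem AnaAt.hasMeroOrder_zero {f : X → ℂ} {p : X} (hf : AnaAt f p) (h : f p ≠ 0) :
    HasMeroOrder f p 0 :=
  ⟨hf.meroAt, hf.ordAt_eq_zero_iff.2 h⟩

theorem HasMeroOrder.mul {f g : X → ℂ} {p : X} {m n : ℤ} (hf : HasMeroOrder f p m)
    (hg : HasMeroOrder g p n) : HasMeroOrder (fun x => f x * g x) p (m + n) := by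
  refine ⟨MeromorphicAt.mul hf.1 hg.1, ?_⟩
  have := meromorphicOrderAt_mul hf.1 hg.1
  rw [hf.2, hg.2] at this
  exact_mod_cast this

theorem HasMeroOrder.inv {f : X → ℂ} {p : X} {m : ℤ} (hf : HasMeroOrder f p m) :
    HasMeroOrder (fun x => (f x)⁻¹) p (-m) := by
  refine ⟨MeromorphicAt.inv hf.1, ?_⟩
  have : meromorphicOrderAt (f ∘ (chartAt ℂ p).symm)⁻¹ (chartAt ℂ p p) = _ :=
    meromorphicOrderAt_inv
  rw [hf.2] at this
  exact this

theorem HasMeroOrder.div {f g : X → ℂ} {p : X} {m n : ℤ} (hf : HasMeroOrder f p m)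
    (hg : HasMeroOrder g p n) : HasMeroOrder (fun x => f x / g x) p (m - n) := by
  simpa only [div_eq_mul_inv, sub_eq_add_neg] using hf.mul hg.inv

theorem HasMeroOrder.zpow {f : X → ℂ} {p : X} {m : ℤ} (hf : HasMeroOrder f p m) (a : ℤ) :
    HasMeroOrder (fun x => f x ^ a) p (a * m) := by
  refine ⟨MeromorphicAt.zpow hf.1 a, ?_⟩
  have : meromorphicOrderAt ((f ∘ (chartAt ℂ p).symm) ^ a) (chartAt ℂ p p) = _ :=
    meromorphicOrderAt_zpow hf.1
  rw [hf.2] at this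
  exact_mod_cast this

theorem HasMeroOrder.prod {ι : Type*} (s : Finset ι) {f : ι → X → ℂ} {p : X} {m : ι → ℤ}
    (hf : ∀ i ∈ s, HasMeroOrder (f i) p (m i)) :
    HasMeroOrder (fun x => ∏ i ∈ s, f i x) p (∑ i ∈ s, m i) := by
  classical
  induction s using Finset.induction_on with
  | empty =>
    simp only [Finset.prod_empty, Finset.sum_empty]
    exact AnaAt.hasMeroOrder_zero (show AnalyticAt ℂ _ _ from analyticAt_const) one_ne_zero
  | insert a s ha ih =>
    simp only [Finset.prod_insert ha, Finset.sum_insert ha]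
    exact (hf a (Finset.mem_insert_self a s)).mul
      (ih fun i hi => hf i (Finset.mem_insert_of_mem hi))

theorem HasMeroOrder.unique {f : X → ℂ} {p : X} {m n : ℤ} (hf : HasMeroOrder f p m)
    (hg : HasMeroOrder f p n) : m = n := by
  have := hf.2.symm.trans hg.2
  exact_mod_cast this

theorem HasMeroOrder.eventually_ne_zero {f : X → ℂ} {p : X} {m : ℤ} (hf : HasMeroOrder f p m) :
    ∀ᶠ x in 𝓝[≠] p, f x ≠ 0 := by
  rw [← eventually_punctured_chart_iff p (mem_chart_source ℂ p)]
  refine (meromorphicOrderAt_ne_top_iff_eventually_ne_zero hf.1).1 ?_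
  rw [hf.2]
  exact WithTop.coe_ne_top

theorem MeroAt.exists_hasMeroOrder {f : X → ℂ} {p : X} (hf : MeroAt f p)
    (h : ∃ᶠ x in 𝓝[≠] p, f x ≠ 0) : ∃ m : ℤ, HasMeroOrder f p m := by
  have : ordAt f p ≠ ⊤ := by
    intro ht
    refine h ?_
    rw [← eventually_punctured_chart_iff p (mem_chart_source ℂ p)]
    simpa using meromorphicOrderAt_eq_top_iff.1 ht
  obtain ⟨m, hm⟩ := WithTop.ne_top_iff_exists.1 this
  exact ⟨m, hf, hm.symm⟩

theorem AnaAt.eventually_or {f : X → ℂ} {p : X} (hf : AnaAt f p) :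
    (∀ᶠ x in 𝓝 p, f x = 0) ∨ ∀ᶠ x in 𝓝[≠] p, f x ≠ 0 := by
  rw [← eventually_punctured_chart_iff p (mem_chart_source ℂ p),
    ← eventually_chart_iff p (mem_chart_source ℂ p)]
  exact AnalyticAt.eventually_eq_zero_or_eventually_ne_zero hf

theorem MeroAt.eventually_or {f : X → ℂ} {p : X} (hf : MeroAt f p) :
    (∀ᶠ x in 𝓝[≠] p, f x = 0) ∨ ∀ᶠ x in 𝓝[≠] p, f x ≠ 0 := by
  rw [← eventually_punctured_chart_iff p (mem_chart_source ℂ p),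
    ← eventually_punctured_chart_iff p (mem_chart_source ℂ p)]
  exact MeromorphicAt.eventually_eq_zero_or_eventually_ne_zero hf

theorem AnaAt.const (c : ℂ) (p : X) : AnaAt (fun _ => c) p :=
  show AnalyticAt ℂ (fun _ => c) _ from analyticAt_const

theorem AnaAt.mul {f g : X → ℂ} {p : X} (hf : AnaAt f p) (hg : AnaAt g p) :
    AnaAt (fun x => f x * g x) p :=
  AnalyticAt.mul hf hg

theorem AnaAt.add {f g : X → ℂ} {p : X} (hf : AnaAt f p) (hg : AnaAt g p) :
    AnaAt (fun x => f x + g x) p :=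
  AnalyticAt.add hf hg

theorem AnaAt.neg {f : X → ℂ} {p : X} (hf : AnaAt f p) : AnaAt (fun x => - f x) p :=
  AnalyticAt.neg hf

theorem AnaAt.sum {ι : Type*} (s : Finset ι) {f : ι → X → ℂ} {p : X}
    (hf : ∀ i ∈ s, AnaAt (f i) p) : AnaAt (fun x => ∑ i ∈ s, f i x) p :=
  Finset.analyticAt_fun_sum s hf

theorem AnaAt.prod {ι : Type*} (s : Finset ι) {f : ι → X → ℂ} {p : X}
    (hf : ∀ i ∈ s, AnaAt (f i) p) : AnaAt (fun x => ∏ i ∈ s, f i x) p :=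
  Finset.analyticAt_fun_prod s hf

theorem AnaAt.det {ι : Type*} [Fintype ι] [DecidableEq ι] {M : X → Matrix ι ι ℂ} {p : X}
    (hM : ∀ i j, AnaAt (fun x => M x i j) p) : AnaAt (fun x => (M x).det) p := by
  simp only [Matrix.det_apply']
  exact AnaAt.sum _ fun σ _ => (AnaAt.const _ p).mul (AnaAt.prod _ fun i _ => hM (σ i) i)

theorem contDiffAt_omega_iff {f : ℂ → ℂ} {z : ℂ} : ContDiffAt ℂ ω f z ↔ AnalyticAt ℂ f z := by
  rw [← contDiffWithinAt_univ, contDiffWithinAt_omega_iff_analyticWithinAt, analyticWithinAt_univ]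

theorem contMDiffAt_iff_anaAt {f : X → ℂ} {p : X} :
    ContMDiffAt 𝓘(ℂ) 𝓘(ℂ) ω f p ↔ AnaAt f p := by
  rw [contMDiffAt_iff]
  simp only [mfld_simps, contDiffWithinAt_univ, AnaAt]
  rw [contDiffAt_omega_iff]
  refine ⟨fun h => h.2, fun h => ⟨AnaAt.continuousAt h, h⟩⟩

/-- An analytic vector-valued function that is not identically zero near `p` is a power of the chart
coordinate times an analytic one that does not vanish at `p`. -/
theorem exists_pow_smul_of_anaAt {n : ℕ} {f : X → Fin n → ℂ} {p : X}
    (hf : ∀ k, AnaAt (fun x => f x k) p) (h : ∃ᶠ x in 𝓝[≠] p, f x ≠ 0) :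
    ∃ (m : ℕ) (g : X → Fin n → ℂ), (∀ k, AnaAt (fun x => g x k) p) ∧ g p ≠ 0 ∧
      ∀ᶠ x in 𝓝 p, f x = (chartAt ℂ p x - chartAt ℂ p p) ^ m • g x := by
  have hfa : AnalyticAt ℂ (f ∘ (chartAt ℂ p).symm) (chartAt ℂ p p) :=
    analyticAt_pi_iff.2 hf
  have hne : ¬ ∀ᶠ z in 𝓝 (chartAt ℂ p p), (f ∘ (chartAt ℂ p).symm) z = 0 := by
    intro h0
    refine h ?_
    rw [← eventually_punctured_chart_iff p (mem_chart_source ℂ p)]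
    exact eventually_nhdsWithin_of_eventually_nhds (by simpa using h0)
  obtain ⟨m, g, hg, hg0, hfg⟩ := hfa.exists_eventuallyEq_pow_smul_nonzero_iff.2 hne
  refine ⟨m, g ∘ chartAt ℂ p, fun k => ?_, hg0, ?_⟩
  · have hgk : AnalyticAt ℂ (fun z => g z k) (chartAt ℂ p p) := analyticAt_pi_iff.1 hg k
    refine AnalyticAt.congr hgk ?_
    filter_upwards [(chartAt ℂ p).open_target.mem_nhds (mem_chart_target ℂ p)] with z hz
    simp [(chartAt ℂ p).right_inv hz]
  · rw [← eventually_chart_iff p (mem_chart_source ℂ p)]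
    filter_upwards [hfg, (chartAt ℂ p).open_target.mem_nhds (mem_chart_target ℂ p)] with z hz hzt
    rw [Function.comp_apply] at hz
    rw [hz]
    simp [(chartAt ℂ p).right_inv hzt]

theorem hasMeroOrder_coord_pow (p : X) (m : ℕ) :
    HasMeroOrder (fun x => (chartAt ℂ p x - chartAt ℂ p p) ^ m) p m := by
  have h : ∀ᶠ z in 𝓝[≠] (chartAt ℂ p p), (z - chartAt ℂ p p) ^ m =
      ((fun x => (chartAt ℂ p x - chartAt ℂ p p) ^ m) ∘ (chartAt ℂ p).symm) z := by
    refine eventually_nhdsWithin_of_eventually_nhds ?_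
    filter_upwards [(chartAt ℂ p).open_target.mem_nhds (mem_chart_target ℂ p)] with z hz
    simp [(chartAt ℂ p).right_inv hz]
  refine ⟨MeromorphicAt.congr (by fun_prop) h, ?_⟩
  rw [← meromorphicOrderAt_congr h]
  exact meromorphicOrderAt_pow_id_sub_const (x := chartAt ℂ p p) (n := m)

variable [IsManifold 𝓘(ℂ) ω X]

theorem analyticAt_transition (p : X) {q : X} (hq : q ∈ (chartAt ℂ p).source) :
    AnalyticAt ℂ (chartAt ℂ p ∘ (chartAt ℂ q).symm) (chartAt ℂ q q) ∧
      deriv (chartAt ℂ p ∘ (chartAt ℂ q).symm) (chartAt ℂ q q) ≠ 0 := by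
  have key : ∀ p q r : X, r ∈ (chartAt ℂ p).source → r ∈ (chartAt ℂ q).source →
      AnalyticAt ℂ (chartAt ℂ p ∘ (chartAt ℂ q).symm) (chartAt ℂ q r) := by
    intro p q r hp hq
    rw [← contDiffAt_omega_iff, ← contMDiffAt_iff_contDiffAt]
    have h1 := (contMDiffOn_chart_symm (I := 𝓘(ℂ)) (n := ω) (x := q)).contMDiffAt
      ((chartAt ℂ q).open_target.mem_nhds ((chartAt ℂ q).map_source hq))
    refine ContMDiffAt.comp _ ?_ h1
    rw [(chartAt ℂ q).left_inv hq]
    exact (contMDiffOn_chart (I := 𝓘(ℂ)) (n := ω) (x := p)).contMDiffAt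
      ((chartAt ℂ p).open_source.mem_nhds hp)
  have hqq := mem_chart_source ℂ q
  have h1 := key p q q hq hqq
  have h2 := key q p q hqq hq
  refine ⟨h1, fun h0 => ?_⟩
  -- the transition in the other direction is an inverse
  have hv : (chartAt ℂ p ∘ (chartAt ℂ q).symm) (chartAt ℂ q q) = chartAt ℂ p q := by
    simp [(chartAt ℂ q).left_inv hqq]
  have hc : HasDerivAt ((chartAt ℂ q ∘ (chartAt ℂ p).symm) ∘ (chartAt ℂ p ∘ (chartAt ℂ q).symm))
      (deriv (chartAt ℂ q ∘ (chartAt ℂ p).symm) (chartAt ℂ p q) *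
        deriv (chartAt ℂ p ∘ (chartAt ℂ q).symm) (chartAt ℂ q q)) (chartAt ℂ q q) := by
    refine HasDerivAt.comp _ ?_ h1.differentiableAt.hasDerivAt
    rw [hv]
    exact h2.differentiableAt.hasDerivAt
  have hid : (chartAt ℂ q ∘ (chartAt ℂ p).symm) ∘ (chartAt ℂ p ∘ (chartAt ℂ q).symm)
      =ᶠ[𝓝 (chartAt ℂ q q)] id := by
    filter_upwards [(tendsto_chart_symm q hqq).eventually
      ((chartAt ℂ p).open_source.mem_nhds hq),
      (chartAt ℂ q).open_target.mem_nhds (mem_chart_target ℂ q)] with z hz hzt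
    simp [(chartAt ℂ p).left_inv hz, (chartAt ℂ q).right_inv hzt]
  have h3 := (hc.congr_of_eventuallyEq hid.symm).unique (hasDerivAt_id _)
  rw [h0, mul_zero] at h3
  exact zero_ne_one h3

/-- The order of a function does not depend on the chart. -/
theorem ordAt_eq (f : X → ℂ) (p : X) {q : X} (hq : q ∈ (chartAt ℂ p).source) :
    ordAt f q = meromorphicOrderAt (f ∘ (chartAt ℂ p).symm) (chartAt ℂ p q) := by
  obtain ⟨h1, h2⟩ := analyticAt_transition p hq
  have hqq := mem_chart_source ℂ q
  have h := meromorphicOrderAt_comp_of_deriv_ne_zero (f := f ∘ (chartAt ℂ p).symm) h1 h2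
  rw [show (chartAt ℂ p ∘ (chartAt ℂ q).symm) (chartAt ℂ q q) = chartAt ℂ p q by
    simp [(chartAt ℂ q).left_inv hqq]] at h
  rw [← h, ordAt]
  refine meromorphicOrderAt_congr (eventually_nhdsWithin_of_eventually_nhds ?_)
  filter_upwards [(tendsto_chart_symm q hqq).eventually ((chartAt ℂ p).open_source.mem_nhds hq)]
    with z hz
  simp [(chartAt ℂ p).left_inv hz]

end Charts

/-! ### A meromorphic function has as many zeros as poles -/

section DegreeZero

open Filter

variable {X : Type u} [TopologicalSpace X] [ChartedSpace ℂ X]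

/-- The multiplicity of `p` as a zero of `f`; it is `0` at a pole of `f`. -/
def zeroMult (f : X → ℂ) (p : X) : ℕ :=
  (ordAt f p).untop₀.toNat

theorem zeroMult_eq {f : X → ℂ} {p : X} {n : ℤ} (h : ordAt f p = n) : zeroMult f p = n.toNat := by
  simp [zeroMult, h]

theorem zeroMult_eq_zero {f : X → ℂ} {p : X} (h : ¬ 0 < ordAt f p) : zeroMult f p = 0 := by
  rw [zeroMult, Int.toNat_eq_zero]
  cases hf : ordAt f p with
  | top => simp
  | coe n =>
    rw [hf] at h
    simpa using h

variable [IsManifold 𝓘(ℂ) ω X]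

/-- Local conservation of number: if `w ≠ 0` is small, then near `p` the function `f - w` has
exactly as many zeros as `f` has at `p`, all of them simple. -/
theorem exists_local_zeros [T1Space X] {f : X → ℂ} {p : X} (hf : MeroAt f p)
    (hne : ordAt f p ≠ ⊤) (U : Set X) (hU : U ∈ 𝓝 p) :
    ∃ V ⊆ U, IsOpen V ∧ p ∈ V ∧ ∀ᶠ w in 𝓝[≠] (0 : ℂ), ∃ S : Finset X, ↑S ⊆ V ∧
      S.card = zeroMult f p ∧
        ∀ q ∈ V, zeroMult (fun x => f x - w) q = (↑S : Set X).indicator 1 q := by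
  classical
  by_cases hpos : 0 < ordAt f p
  · obtain ⟨n, hn⟩ : ∃ n : ℕ, ordAt f p = (n : ℤ) := by
      obtain ⟨m, hm⟩ := WithTop.ne_top_iff_exists.1 hne
      rw [← hm] at hpos ⊢
      have : 0 < m := by exact_mod_cast hpos
      exact ⟨m.toNat, by rw [Int.toNat_of_nonneg this.le]⟩
    have hn0 : n ≠ 0 := by
      rintro rfl
      rw [hn] at hpos
      simp at hpos
    set e := chartAt ℂ p with he
    have hps : p ∈ e.source := mem_chart_source ℂ p
    obtain ⟨g, hg, hg0, hfg⟩ := (meromorphicOrderAt_eq_int_iff hf).1 hn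
    set F : ℂ → ℂ := fun z => (z - e p) ^ n * g z with hF
    have hFa : AnalyticAt ℂ F (e p) :=
      ((analyticAt_id.sub analyticAt_const).pow n).mul hg
    have hFn : analyticOrderAt F (e p) = n :=
      (hFa.analyticOrderAt_eq_natCast).2 ⟨g, hg, hg0, Eventually.of_forall fun z => rfl⟩
    obtain ⟨W, hW, hWo, hpW⟩ := eventually_nhds_iff.1 (eventually_nhdsWithin_iff.1 hfg)
    have hWF : ∀ z ∈ W, ∀ᶠ y in 𝓝[≠] z, (f ∘ e.symm) y = F y := by
      intro z hz
      rw [eventually_nhdsWithin_iff]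
      by_cases hzp : z = e p
      · filter_upwards [hWo.mem_nhds hz] with y hy hyz
        rw [hW y hy (hzp ▸ hyz), hF, zpow_natCast, smul_eq_mul]
      · filter_upwards [(hWo.sdiff isClosed_singleton).mem_nhds ⟨hz, hzp⟩] with y hy _
        rw [hW y hy.1 hy.2, hF, zpow_natCast, smul_eq_mul]
    have hU' : e.target ∩ e.symm ⁻¹' U ∩ W ∈ 𝓝 (e p) :=
      inter_mem (inter_mem (e.open_target.mem_nhds (e.map_source hps))
        (tendsto_chart_symm p hps hU)) (hWo.mem_nhds hpW)
    obtain ⟨V', hV'U, hV'o, hpV', hV'⟩ := exists_fiber_card hFa hFn hn0 _ hU'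
    refine ⟨e.source ∩ e ⁻¹' V', ?_, e.isOpen_inter_preimage hV'o, ⟨hps, hpV'⟩, ?_⟩
    · rintro q ⟨hq, hqV⟩
      have := (hV'U hqV).1.2
      rwa [Set.mem_preimage, e.left_inv hq] at this
    filter_upwards [hV'] with w ⟨S, hSV, hSc, hS⟩
    have hSt : ∀ z ∈ S, z ∈ e.target := fun z hz => (hV'U (hSV hz)).1.1
    refine ⟨S.image e.symm, ?_, ?_, ?_⟩
    · intro q hq
      obtain ⟨z, hz, rfl⟩ := Finset.mem_image.1 (Finset.mem_coe.1 hq)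
      refine ⟨e.map_target (hSt z hz), ?_⟩
      rw [Set.mem_preimage, e.right_inv (hSt z hz)]
      exact hSV hz
    · rw [Finset.card_image_of_injOn fun z hz y hy => e.symm.injOn (hSt z hz) (hSt y hy), hSc,
        zeroMult_eq hn, Int.toNat_natCast]
    · rintro q ⟨hq, hqV⟩
      obtain ⟨hFq, hmem, hord⟩ := hS (e q) hqV
      have h1 : ordAt (fun x => f x - w) q = meromorphicOrderAt (fun z => F z - w) (e q) := by
        rw [ordAt_eq _ p hq]
        refine meromorphicOrderAt_congr ?_
        filter_upwards [hWF (e q) (hV'U hqV).2] with y hy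
        rw [← hy]
        rfl
      have hFw : AnalyticAt ℂ (fun z => F z - w) (e q) := hFq.sub analyticAt_const
      rw [hFw.meromorphicOrderAt_eq] at h1
      have hqS : q ∈ S.image e.symm ↔ e q ∈ S := by
        rw [Finset.mem_image]
        constructor
        · rintro ⟨z, hz, rfl⟩
          rwa [e.right_inv (hSt z hz)]
        · intro h
          exact ⟨e q, h, e.left_inv hq⟩
      by_cases hqw : F (e q) = w
      · rw [hord hqw] at h1
        rw [zeroMult_eq (n := 1) (by rw [h1]; rfl), Set.indicator_of_mem]
        · rfl
        · exact Finset.mem_coe.2 (hqS.2 (hmem.1 hqw))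
      · rw [hFw.analyticOrderAt_eq_zero.2 (sub_ne_zero.2 hqw)] at h1
        rw [zeroMult_eq (n := 0) (by rw [h1]; rfl), Set.indicator_of_notMem]
        · rfl
        · exact fun h => hqw (hmem.2 (hqS.1 (Finset.mem_coe.1 h)))
  · -- `f` stays away from `0` near `p`
    obtain ⟨ε, hε, hfε⟩ : ∃ ε > 0, ∀ᶠ x in 𝓝[≠] p, ε ≤ ‖f x‖ := by
      suffices h : ∃ ε > 0, ∀ᶠ z in 𝓝[≠] (chartAt ℂ p p), ε ≤ ‖(f ∘ (chartAt ℂ p).symm) z‖ by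
        obtain ⟨ε, hε, h⟩ := h
        exact ⟨ε, hε, (eventually_punctured_chart_iff p (mem_chart_source ℂ p) _).1 h⟩
      rcases lt_or_eq_of_le (not_lt.1 hpos) with h | h
      · refine ⟨1, one_pos, ?_⟩
        exact (tendsto_norm_atTop_iff_cobounded.2
          (tendsto_cobounded_of_meromorphicOrderAt_neg h)).eventually_ge_atTop 1
      · obtain ⟨c, hc0, hc⟩ := (tendsto_ne_zero_iff_meromorphicOrderAt_eq_zero hf).2 h
        refine ⟨‖c‖ / 2, half_pos (norm_pos_iff.2 hc0), ?_⟩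
        exact hc.norm.eventually_const_le (half_lt_self (norm_pos_iff.2 hc0))
    obtain ⟨W, hW, hWo, hpW⟩ := eventually_nhds_iff.1 (eventually_nhdsWithin_iff.1 hfε)
    refine ⟨W ∩ interior U, fun x hx => interior_subset hx.2, hWo.inter isOpen_interior,
      ⟨hpW, mem_interior_iff_mem_nhds.2 hU⟩, ?_⟩
    have hsmall : ∀ᶠ w in 𝓝[≠] (0 : ℂ), ‖w‖ < ε := by
      refine eventually_nhdsWithin_of_eventually_nhds ?_
      filter_upwards [Metric.ball_mem_nhds (0 : ℂ) hε] with w hw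
      simpa using hw
    filter_upwards [hsmall] with w hw
    refine ⟨∅, by simp, by simp [zeroMult_eq_zero hpos], fun q hq => ?_⟩
    simp only [Finset.coe_empty, Set.indicator_empty]
    refine zeroMult_eq_zero fun hq0 => ?_
    have hqε : ∀ᶠ x in 𝓝[≠] q, ε ≤ ‖f x‖ := by
      rw [eventually_nhdsWithin_iff]
      by_cases hqp : q = p
      · filter_upwards [hWo.mem_nhds hq.1] with y hy hyz
        exact hW y hy (hqp ▸ hyz)
      · filter_upwards [(hWo.sdiff isClosed_singleton).mem_nhds ⟨hq.1, hqp⟩] with y hy _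
        exact hW y hy.1 hy.2
    have ht := tendsto_zero_of_meromorphicOrderAt_pos hq0
    have hlt : ∀ᶠ z in 𝓝[≠] (chartAt ℂ q q),
        ‖((fun x => f x - w) ∘ (chartAt ℂ q).symm) z‖ < ε - ‖w‖ := by
      have := ht.norm
      rw [norm_zero] at this
      exact this.eventually_lt_const (sub_pos.2 hw)
    have hge := (eventually_punctured_chart_iff q (mem_chart_source ℂ q) _).2 hqε
    obtain ⟨z, hz1, hz2⟩ := (hlt.and hge).exists
    simp only [Function.comp_apply] at hz1
    have := norm_sub_norm_le (f ((chartAt ℂ q).symm z)) w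
    linarith

/-- The functions `1/f - 1/w` and `f - w` have the same zeros, with the same multiplicities. -/
theorem zeroMult_inv_sub_inv {f : X → ℂ} {p : X} {n m : ℤ} (hf : HasMeroOrder f p n) {w : ℂ}
    (hw : w ≠ 0) (hfw : HasMeroOrder (fun x => f x - w) p m) :
    zeroMult (fun x => (f x)⁻¹ - w⁻¹) p = zeroMult (fun x => f x - w) p := by
  have hc : ∀ c : ℂ, c ≠ 0 → HasMeroOrder (fun _ : X => c) p 0 := fun c hc =>
    (AnaAt.const c p).hasMeroOrder_zero hc
  have h1 : HasMeroOrder (fun x => (f x)⁻¹ - w⁻¹) p (m - n) := by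
    have := (hfw.div hf).mul (hc (-w⁻¹) (neg_ne_zero.2 (inv_ne_zero hw)))
    rw [add_zero] at this
    refine this.congr ?_
    filter_upwards [hf.eventually_ne_zero] with x hx
    field_simp
    ring
  rw [zeroMult_eq h1.2, zeroMult_eq hfw.2]
  -- compare the orders of `f`, `w` and `f - w`
  have hwm : MeromorphicAt (fun _ : ℂ => -w) (chartAt ℂ p p) := MeromorphicAt.const _ _
  have hw0 : meromorphicOrderAt (fun _ : ℂ => -w) (chartAt ℂ p p) = ((0 : ℤ) : WithTop ℤ) :=
    (hc (-w) (neg_ne_zero.2 hw)).2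
  have hfw' : meromorphicOrderAt (f ∘ (chartAt ℂ p).symm + fun _ => -w) (chartAt ℂ p p) = m := by
    rw [← hfw.2]
    congr 1
  have hn := hf.2
  rcases lt_trichotomy n 0 with h | h | h
  · have := meromorphicOrderAt_add_eq_left_of_lt (f₁ := f ∘ (chartAt ℂ p).symm) hwm
      (by rw [hn, hw0]; exact_mod_cast h)
    rw [hfw', hn] at this
    have hmn : m = n := by exact_mod_cast this
    rw [hmn, sub_self, Int.toNat_of_nonpos h.le]
    rfl
  · rw [h, sub_zero]
  · have := meromorphicOrderAt_add_eq_right_of_lt (f₂ := fun _ : ℂ => -w) hf.1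
      (by rw [hn, hw0]; exact_mod_cast h)
    rw [hfw', hw0] at this
    have hm0 : m = 0 := by exact_mod_cast this
    rw [hm0, Int.toNat_of_nonpos (by omega)]
    rfl

theorem finite_support_ord [T2Space X] [CompactSpace X] {f : X → ℂ} {ord : X → ℤ}
    (h : ∀ p, HasMeroOrder f p (ord p)) : (Function.support ord).Finite := by
  refine (finite_setOf_not_of_punctured (fun p => ord p = 0) fun p => ?_).subset fun p hp => hp
  -- the coordinate form of `f` has order zero at all points of a punctured neighbourhood
  have ha : ∀ᶠ z in 𝓝[≠] (chartAt ℂ p p), AnalyticAt ℂ (f ∘ (chartAt ℂ p).symm) z ∧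
      (f ∘ (chartAt ℂ p).symm) z ≠ 0 ∧ z ∈ (chartAt ℂ p).target :=
    (h p).1.eventually_analyticAt.and
      (((eventually_punctured_chart_iff p (mem_chart_source ℂ p) _).2
        (h p).eventually_ne_zero).and (eventually_nhdsWithin_of_eventually_nhds
          ((chartAt ℂ p).open_target.mem_nhds (mem_chart_target ℂ p))))
  have hq : ∀ᶠ z in 𝓝[≠] (chartAt ℂ p p), ord ((chartAt ℂ p).symm z) = 0 := by
    filter_upwards [ha] with z ⟨hz, hz0, hzt⟩
    have h1 := ordAt_eq f p ((chartAt ℂ p).map_target hzt)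
    rw [(chartAt ℂ p).right_inv hzt, hz.meromorphicOrderAt_eq,
      hz.analyticOrderAt_eq_zero.2 hz0] at h1
    have h2 := ((h ((chartAt ℂ p).symm z)).2.symm.trans h1)
    rw [ENat.map_zero, Nat.cast_zero] at h2
    exact_mod_cast h2
  exact (eventually_punctured_chart_iff p (mem_chart_source ℂ p) _).1 hq

/-- **A meromorphic function on a compact Riemann surface has as many zeros as poles.** -/
theorem finsum_ord_eq_zero [T2Space X] [CompactSpace X] [ConnectedSpace X] {f : X → ℂ}
    {ord : X → ℤ} (h : ∀ p, HasMeroOrder f p (ord p)) : ∑ᶠ p, ord p = 0 := by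
  have hnb : ∀ p : X, (𝓝[≠] p).NeBot := neBot_punctured
  have hmero : ∀ c p, MeroAt (fun x => f x - c) p := fun c p =>
    MeromorphicAt.sub (h p).1 (MeromorphicAt.const c _)
  by_cases hconst : ∃ c p, ordAt (fun x => f x - c) p = ⊤
  · -- `f` is constant
    obtain ⟨c, p, hcp⟩ := hconst
    have hall : ∀ q, ∀ᶠ x in 𝓝[≠] q, f x = c := by
      have hz : ∀ᶠ x in 𝓝[≠] p, f x = c := by
        rw [← eventually_punctured_chart_iff p (mem_chart_source ℂ p)]
        filter_upwards [meromorphicOrderAt_eq_top_iff.1 hcp] with z hz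
        exact sub_eq_zero.1 hz
      have hor : ∀ q, (∀ᶠ x in 𝓝[≠] q, ¬ f x = c) ∨ ∀ᶠ x in 𝓝[≠] q, f x = c := by
        intro q
        rcases (hmero c q).eventually_or with h2 | h2
        · right
          filter_upwards [h2] with x hx using sub_eq_zero.1 hx
        · left
          filter_upwards [h2] with x hx using sub_ne_zero.1 hx
      rcases eventually_punctured_or (fun x => f x = c) hor with h1 | h1
      · obtain ⟨x, hx⟩ := (hz.and (h1 p)).exists
        exact absurd hx.1 hx.2
      · exact h1
    have hord : ∀ q, ord q = 0 := by
      intro q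
      have hc : c ≠ 0 := by
        obtain ⟨x, hx⟩ := ((hall q).and (h q).eventually_ne_zero).exists
        exact hx.1 ▸ hx.2
      refine (h q).unique (((AnaAt.const c q).hasMeroOrder_zero hc).congr ?_)
      filter_upwards [hall q] with x hx using hx.symm
    simp [hord]
  push Not at hconst
  have hm : ∀ c p, ∃ m : ℤ, HasMeroOrder (fun x => f x - c) p m := fun c p => by
    obtain ⟨m, hm⟩ := WithTop.ne_top_iff_exists.1 (hconst c p)
    exact ⟨m, hmero c p, hm.symm⟩
  choose o ho using hm
  have hfin : ∀ c, (Function.support (zeroMult fun x => f x - c)).Finite := fun c => by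
    refine (finite_support_ord (ho c)).subset fun p hp hp0 => hp ?_
    rw [zeroMult_eq (ho c p).2, hp0]
    rfl
  set Z : ℂ → ℕ := fun c => ∑ᶠ p, zeroMult (fun x => f x - c) p with hZ
  -- the number of times `f` takes the value `c` is a locally constant function of `c`
  have hloc : IsLocallyConstant Z := by
    rw [IsLocallyConstant.iff_eventually_eq]
    intro c
    have h1 : ∀ᶠ w in 𝓝[≠] (0 : ℂ), ∑ᶠ p, zeroMult (fun x => (f x - c) - w) p = Z c := by
      refine (eventually_finsum_eq _ _ (hfin c) _ fun p U hU => ?_).mono fun w hw => hw.2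
      exact exists_local_zeros (hmero c p) (hconst c p) U hU
    have h2 : ∀ᶠ w in 𝓝 (0 : ℂ), Z (c + w) = Z c := by
      filter_upwards [eventually_nhdsWithin_iff.1 h1] with w hw
      by_cases hw0 : w = 0
      · rw [hw0, add_zero]
      · simp only [hZ, ← sub_sub]
        exact hw hw0
    have h3 : Tendsto (fun c' => c' - c) (𝓝 c) (𝓝 0) := by
      have : Continuous fun c' : ℂ => c' - c := by fun_prop
      simpa using this.tendsto c
    filter_upwards [h3.eventually h2] with c' hc'
    simpa using hc'
  -- for large `c` it is the number of poles of `f`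
  have hinv : ∀ p, HasMeroOrder (fun x => (f x)⁻¹) p (-ord p) := fun p => (h p).inv
  have hfin' : (Function.support (zeroMult fun x => (f x)⁻¹)).Finite := by
    refine (finite_support_ord h).subset fun p hp hp0 => hp ?_
    rw [zeroMult_eq (hinv p).2, hp0]
    rfl
  have hinf : ∀ᶠ w in 𝓝[≠] (0 : ℂ), Z w⁻¹ = ∑ᶠ p, zeroMult (fun x => (f x)⁻¹) p := by
    have h1 := eventually_finsum_eq (𝓝[≠] (0 : ℂ)) _ hfin' _ fun p U hU =>
      exists_local_zeros (hinv p).1 ((hinv p).2.trans_ne WithTop.coe_ne_top) U hU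
    filter_upwards [h1, self_mem_nhdsWithin] with w hw hw0
    rw [← hw.2]
    refine finsum_congr fun p => ?_
    rw [← zeroMult_inv_sub_inv (h p) (inv_ne_zero hw0) (ho w⁻¹ p), inv_inv]
  obtain ⟨w, hw⟩ := hinf.exists
  have hZ0 : ∑ᶠ p, zeroMult f p = ∑ᶠ p, zeroMult (fun x => (f x)⁻¹) p := by
    rw [← hw, hloc.apply_eq_of_isPreconnected isPreconnected_univ (Set.mem_univ w⁻¹)
      (Set.mem_univ 0), hZ]
    simp only [sub_zero]
  have hsplit : ∀ p, ord p = (zeroMult f p : ℤ) - (zeroMult (fun x => (f x)⁻¹) p : ℤ) := fun p => by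
    rw [zeroMult_eq (h p).2, zeroMult_eq (hinv p).2]
    omega
  have hfin0 : (Function.support (zeroMult f)).Finite := by simpa using hfin 0
  have hcast : ∀ m : X → ℕ, (Function.support m).Finite →
      (Function.support fun p => (m p : ℤ)).Finite := fun m hm =>
    hm.subset fun p hp hp0 => hp (by simp [hp0])
  have hcast' : ∀ m : X → ℕ, (Function.support m).Finite →
      ∑ᶠ p, (m p : ℤ) = ((∑ᶠ p, m p : ℕ) : ℤ) := fun m hm =>
    ((Nat.castAddMonoidHom ℤ).map_finsum hm).symm
  simp only [hsplit]
  rw [finsum_sub_distrib (hcast _ hfin0) (hcast _ hfin'), hcast' _ hfin0, hcast' _ hfin', hZ0,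
    sub_self]

end DegreeZero

/-! ### Sections in local coordinates, and the degree of `T^a K^b` -/

section Coordinates

open Filter

variable {X : Type u} [TopologicalSpace X] [ChartedSpace ℂ X] [IsManifold 𝓘(ℂ) ω X]
variable (T : X → Type v) [∀ x, AddCommGroup (T x)] [∀ x, Module ℂ (T x)]
  [TopologicalSpace (TotalSpace ℂ T)] [∀ x, TopologicalSpace (T x)] [FiberBundle ℂ T]
  [VectorBundle ℂ ℂ T] [ContMDiffVectorBundle ω ℂ T 𝓘(ℂ)]

theorem eventually_mem_domain (p : X) : ∀ᶠ x in 𝓝 p, x ∈ domain T p :=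
  (isOpen_domain T p).mem_nhds (mem_domain T p)

theorem twistCocycle_ne_zero (a b : ℤ) (x y z : X) : twistCocycle T a b x y z ≠ 0 :=
  mul_ne_zero (zpow_ne_zero _ (transition_ne_zero _ _ _))
    (zpow_ne_zero _ (transition_ne_zero _ _ _))

theorem twistCocycle_mul_symm (a b : ℤ) {p x : X} (hx : x ∈ domain T p) :
    twistCocycle T a b x p x * twistCocycle T a b p x x = 1 := by
  rw [twistCocycle_comp T a b p x p x hx (mem_domain T x) hx, twistCocycle_self T a b p x hx]

/-- A section of `⊕ T^(a k) K^(b k)` is holomorphic at `p` if and only if its coordinates in the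
trivialization at `p` are. -/
theorem holAt_iff {n : ℕ} (a b : Fin n → ℤ) (s : ∀ x, (twistSum T a b).Fiber x) (p : X) :
    HolAt (Fin n → ℂ) s p ↔
      ∀ k, AnaAt (fun x => twistCocycle T (a k) (b k) x p x * s x k) p := by
  rw [HolAt, contMDiffAt_section, contMDiffAt_pi_space]
  exact forall_congr' fun k => contMDiffAt_iff_anaAt

variable {T} in
/-- The value of a section of `T^a K^b` at `x` in the preferred trivialization at `x`. -/
def fiberCoord {a b : ℤ} (β : HolSection T a b) (x : X) : ℂ := β x

variable {T} in
theorem HolSection.anaAt {a b : ℤ} (β : HolSection T a b) (p : X) :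
    AnaAt (fun x => twistCocycle T a b x p x * fiberCoord β x) p := by
  have h := β.contMDiff p
  rw [contMDiffAt_section] at h
  exact contMDiffAt_iff_anaAt.1 h

theorem vanishingOrder_eq_ordAt {a b : ℤ} (β : HolSection T a b) (p : X) :
    vanishingOrder β p = ordAt (fun x => twistCocycle T a b x p x * fiberCoord β x) p :=
  rfl

/-- `deg L = d` for the line bundle `L = T^a K^b`, witnessed by a meromorphic section `m` of the
dual of `L`; here `m x` is its value in the preferred trivialization at `x`. -/
def HasTwistDegree (a b d : ℤ) : Prop :=
  ∃ (m : X → ℂ) (ord : X → ℤ),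
    (∀ p, HasMeroOrder (fun x => twistCocycle T a b p x x * m x) p (ord p)) ∧
    (Function.support ord).Finite ∧ ∑ᶠ p, ord p = -d

section Line

variable (L : X → Type v) [∀ x, AddCommGroup (L x)] [∀ x, Module ℂ (L x)]
  [TopologicalSpace (TotalSpace ℂ L)] [∀ x, TopologicalSpace (L x)] [FiberBundle ℂ L]
  [VectorBundle ℂ ℂ L]

theorem finrank_fiber (x : X) : Module.finrank ℂ (L x) = 1 := by
  have e := (trivializationAt ℂ L x).linearEquivAt ℂ x (FiberBundle.mem_baseSet_trivializationAt' x)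
  rw [e.finrank_eq, Module.finrank_self]

theorem IsFrameAt.card_eq {F : Type*} [NormedAddCommGroup F] [NormedSpace ℂ F]
    {E : X → Type v} [∀ x, AddCommGroup (E x)] [∀ x, Module ℂ (E x)]
    [TopologicalSpace (TotalSpace F E)] [∀ x, TopologicalSpace (E x)] [FiberBundle F E]
    {W : ∀ x, Submodule ℂ (E x)} {p : X} {r : ℕ} {s : Fin r → ∀ x, E x} (h : IsFrameAt F W p s) :
    r = Module.finrank ℂ (W p) := by
  have h' := h.2.self_of_nhds
  rw [← h'.2, finrank_span_eq_card h'.1, Fintype.card_fin]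

variable {L} in
/-- A meromorphic section of the dual of a line bundle, in preferred trivializations. -/
theorem exists_mero_dual [Nonempty X] {d : ℤ} (h : HasBundleDegree ℂ L d) :
    ∃ (m : X → ℂ) (ord : X → ℤ),
      (∀ p, HasMeroOrder (fun x => transition L p x x * m x) p (ord p)) ∧
      (Function.support ord).Finite ∧ ∑ᶠ p, ord p = -d := by
  obtain ⟨r, σ, ord, hσ, hfin, hsum⟩ := h
  obtain rfl : r = 1 := by
    obtain ⟨p⟩ := ‹Nonempty X›
    obtain ⟨s, hs, -⟩ := hσ p
    rw [hs.card_eq, finrank_top, finrank_fiber]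
  refine ⟨fun x => σ x fun _ => (trivializationAt ℂ L x).symm x 1, ord, fun p => ?_, hfin, hsum⟩
  obtain ⟨s, hs, hord⟩ := hσ p
  -- the frame is a nonvanishing holomorphic function times the frame of the trivialization
  set f : X → ℂ := fun x => (trivializationAt ℂ L p ⟨x, s 0 x⟩).2 with hf
  have hfa : AnaAt f p := by
    have h1 := hs.1 0
    rw [HolAt, contMDiffAt_section] at h1
    exact contMDiffAt_iff_anaAt.1 h1
  have hbase := (trivializationAt ℂ L p).open_baseSet.mem_nhds
    (FiberBundle.mem_baseSet_trivializationAt' p)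
  have hx' : ∀ x ∈ (trivializationAt ℂ L p).baseSet, ∀ w : L x,
      w = ((trivializationAt ℂ L p ⟨x, w⟩).2 * transition L p x x) •
        (trivializationAt ℂ L x).symm x 1 := by
    intro x hx w
    have hxx := FiberBundle.mem_baseSet_trivializationAt' (F := ℂ) (E := L) x
    refine ((trivializationAt ℂ L x).linearEquivAt ℂ x hxx).injective ?_
    rw [map_smul]
    change (trivializationAt ℂ L x ⟨x, w⟩).2 = _ •
      (trivializationAt ℂ L x ⟨x, (trivializationAt ℂ L x).symm x 1⟩).2
    rw [Trivialization.apply_mk_symm _ hxx, transition_spec p x x hx hxx w, smul_eq_mul, mul_one,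
      mul_comm]
  have hf0 : f p ≠ 0 := by
    intro h0
    have hp := hx' p (FiberBundle.mem_baseSet_trivializationAt' p) (s 0 p)
    rw [show (trivializationAt ℂ L p ⟨p, s 0 p⟩).2 = 0 from h0, zero_mul, zero_smul] at hp
    exact hs.2.self_of_nhds.1.ne_zero 0 hp
  have := hord.div (hfa.hasMeroOrder_zero hf0)
  rw [sub_zero] at this
  refine this.congr (eventually_nhdsWithin_of_eventually_nhds ?_)
  filter_upwards [hbase, hfa.continuousAt.eventually_ne hf0] with x hx hfx
  have h1 : (fun i => s i x) = fun _ : Fin 1 => (f x * transition L p x x) •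
      (trivializationAt ℂ L x).symm x (1 : ℂ) := by
    funext i
    rw [Subsingleton.elim i 0]
    exact hx' x hx (s 0 x)
  have h2 := (σ x).map_smul_univ (fun _ => f x * transition L p x x)
    (fun _ : Fin 1 => (trivializationAt ℂ L x).symm x (1 : ℂ))
  rw [h1, h2]
  simp only [Finset.univ_unique, Finset.prod_const, Finset.card_singleton, pow_one, smul_eq_mul]
  field_simp

end Line

variable {T} in
/-- The degree of `T^a K^b` is `a deg T + b (2g - 2)`. -/
theorem hasTwistDegree [Nonempty X] {g : ℕ} {t : ℤ} (hX : HasGenus X g)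
    (ht : HasBundleDegree ℂ T t) (a b : ℤ) :
    HasTwistDegree T a b (a * t + b * (2 * (g : ℤ) - 2)) := by
  obtain ⟨m, o, hm, hfin, hsum⟩ := exists_mero_dual ht
  obtain ⟨m', o', hm', hfin', hsum'⟩ := exists_mero_dual hX
  refine ⟨fun x => m x ^ a * m' x ^ (-b), fun p => a * o p + (-b) * o' p, fun p => ?_, ?_, ?_⟩
  · refine ((((hm p).zpow a).mul ((hm' p).zpow (-b)))).congr (Eventually.of_forall fun x => ?_)
    rw [twistCocycle, mul_zpow, mul_zpow]
    ring
  · refine (hfin.union hfin').subset fun p hp => ?_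
    by_contra h
    simp only [Set.mem_union, Function.mem_support, not_or, not_not] at h
    exact hp (by simp [h.1, h.2])
  · have h1 : (Function.support fun p => a * o p).Finite :=
      hfin.subset fun p hp hp0 => hp (by simp [hp0])
    have h2 : (Function.support fun p => -b * o' p).Finite :=
      hfin'.subset fun p hp hp0 => hp (by simp [hp0])
    rw [finsum_add_distrib h1 h2, ← mul_finsum, ← mul_finsum, hsum, hsum']
    ring

variable {T} in
/-- A nonzero holomorphic section has only isolated zeros. -/
theorem HolSection.eventually_ne_zero [T1Space X] [ConnectedSpace X] {a b : ℤ}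
    {β : HolSection T a b} (hβ : β ≠ 0) (p : X) : ∀ᶠ x in 𝓝[≠] p, fiberCoord β x ≠ 0 := by
  have hnb : ∀ p : X, (𝓝[≠] p).NeBot := neBot_punctured
  have hor : ∀ p, (∀ᶠ x in 𝓝 p, fiberCoord β x = 0) ∨ ∀ᶠ x in 𝓝[≠] p, fiberCoord β x ≠ 0 := by
    intro p
    refine (HolSection.anaAt β p).eventually_or.imp ?_ ?_ <;> intro h
    · filter_upwards [h] with x hx using
        (mul_eq_zero.1 hx).resolve_left (twistCocycle_ne_zero T a b x p x)
    · filter_upwards [h] with x hx using right_ne_zero_of_mul hx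
  rcases eventually_punctured_or (fun x => fiberCoord β x ≠ 0) fun p => (hor p).imp
    (fun h => eventually_nhdsWithin_of_eventually_nhds (h.mono fun x hx hx' => hx' hx)) id
    with h | h
  · refine absurd ?_ hβ
    ext x
    rcases hor x with h1 | h1
    · exact h1.self_of_nhds
    · obtain ⟨y, hy⟩ := ((h x).and h1).exists
      exact absurd hy.2 hy.1
  · exact h p

variable {T} in
theorem HolSection.exists_ne_zero {a b : ℤ} {β : HolSection T a b} (hβ : β ≠ 0) :
    ∃ x, fiberCoord β x ≠ 0 := by
  by_contra h
  push Not at h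
  exact hβ (by ext x; exact h x)

variable {T} in
/-- A line bundle with a nonzero holomorphic section has nonnegative degree. -/
theorem HolSection.degree_nonneg [T2Space X] [CompactSpace X] [ConnectedSpace X] {a b d : ℤ}
    {β : HolSection T a b} (hβ : β ≠ 0) (hd : HasTwistDegree T a b d) : 0 ≤ d := by
  have hnb : ∀ p : X, (𝓝[≠] p).NeBot := neBot_punctured
  obtain ⟨m, o, hm, hfin, hsum⟩ := hd
  have hb : ∀ p, ∃ k : ℤ, 0 ≤ k ∧
      HasMeroOrder (fun x => twistCocycle T a b x p x * fiberCoord β x) p k := by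
    intro p
    obtain ⟨k, hk⟩ := (HolSection.anaAt β p).meroAt.exists_hasMeroOrder
      ((HolSection.eventually_ne_zero hβ p).mono fun x hx =>
        mul_ne_zero (twistCocycle_ne_zero T a b x p x) hx).frequently
    refine ⟨k, ?_, hk⟩
    have := (HolSection.anaAt β p).ordAt_nonneg
    rw [(hasMeroOrder_iff.1 hk).2] at this
    exact_mod_cast this
  choose k hk0 hk using hb
  have hf : ∀ p, HasMeroOrder (fun x => fiberCoord β x * m x) p (k p + o p) := by
    intro p
    refine ((hk p).mul (hm p)).congr (eventually_nhdsWithin_of_eventually_nhds ?_)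
    filter_upwards [eventually_mem_domain T p] with x hx
    have := twistCocycle_mul_symm T a b hx
    linear_combination (fiberCoord β x * m x) * this
  have hfin1 := finite_support_ord hf
  have hsum1 := finsum_ord_eq_zero hf
  have hfink : (Function.support k).Finite := by
    refine (hfin1.union hfin).subset fun p hp => ?_
    by_contra h
    simp only [Set.mem_union, Function.mem_support, not_or, not_not] at h
    exact hp (by have := h.1; rw [h.2, add_zero] at this; exact this)
  rw [finsum_add_distrib hfink hfin, hsum] at hsum1
  have := finsum_nonneg hk0
  omega

end Coordinates

/-! ### Pivot sets of a subspace -/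

section Pivots

/-- `J` is a pivot set of `V ⊆ ℂⁿ`: the projection of `V` to the coordinates in `J` is bijective. In
other words, the Plücker coordinate of `V` with index `J` does not vanish. -/
def IsPivot {n : ℕ} (V : Submodule ℂ (Fin n → ℂ)) (J : Finset (Fin n)) : Prop :=
  J.card = Module.finrank ℂ V ∧ ∀ v ∈ V, (∀ j ∈ J, v j = 0) → v = 0

/-- Every set of coordinates that is linearly independent on `V` extends to a pivot set. -/
theorem exists_isPivot_of_linearIndepOn {n : ℕ} (V : Submodule ℂ (Fin n → ℂ)) (I : Finset (Fin n))
    (hI : ∀ c : Fin n → ℂ, (∀ v ∈ V, ∑ i ∈ I, c i * v i = 0) → ∀ i ∈ I, c i = 0) :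
    ∃ J, I ⊆ J ∧ IsPivot V J := by
  classical
  set φ : Fin n → Module.Dual ℂ V := fun i => (LinearMap.proj i).comp V.subtype with hφ
  have hIφ : LinearIndepOn ℂ φ (I : Set (Fin n)) := by
    rw [linearIndepOn_finset_iff]
    intro c hc
    refine hI c fun v hv => ?_
    have := LinearMap.congr_fun hc ⟨v, hv⟩
    simpa [hφ] using this
  obtain ⟨B, -, hIB, hsp, hB⟩ := exists_linearIndepOn_extension hIφ (Set.subset_univ _)
  have htop : Submodule.span ℂ (φ '' B) = ⊤ := by
    have h1 : ⨅ f ∈ Submodule.span ℂ (φ '' B), LinearMap.ker f = ⊥ := by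
      rw [eq_bot_iff]
      intro v hv
      simp only [Submodule.mem_iInf, LinearMap.mem_ker] at hv
      refine Subtype.ext (funext fun i => ?_)
      exact hv (φ i) (hsp ⟨i, Set.mem_univ i, rfl⟩)
    have h2 := Subspace.dualCoannihilator_dualAnnihilator_eq (W := Submodule.span ℂ (φ '' B))
    rw [← h2, eq_top_iff]
    intro f _
    rw [Submodule.mem_dualAnnihilator]
    intro w hw
    have : w = 0 := by
      rw [← Submodule.mem_bot ℂ, ← h1]
      simp only [Submodule.mem_iInf, LinearMap.mem_ker]
      exact fun f hf => (Submodule.mem_dualCoannihilator _).1 hw f hf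
    rw [this, map_zero]
  have : Fintype B := Fintype.ofFinite B
  have hIB' : I ⊆ B.toFinset := fun i hi => Set.mem_toFinset.2 (hIB hi)
  refine ⟨B.toFinset, hIB', ?_, ?_⟩
  · rw [← Subspace.dual_finrank_eq, ← finrank_top ℂ (Module.Dual ℂ V), ← htop,
      Set.image_eq_range, finrank_span_eq_card hB, Set.toFinset_card]
  · intro v hv h0
    have hk : ∀ f ∈ Submodule.span ℂ (φ '' B), f ⟨v, hv⟩ = 0 := by
      intro f hf
      refine Submodule.span_induction ?_ ?_ ?_ ?_ hf
      · rintro _ ⟨i, hi, rfl⟩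
        exact h0 i (by simpa using hi)
      · rfl
      · intro f g _ _ hf hg
        rw [LinearMap.add_apply, hf, hg, add_zero]
      · intro c f _ hf
        rw [LinearMap.smul_apply, hf, smul_zero]
    funext i
    exact hk (φ i) (hsp ⟨i, Set.mem_univ i, rfl⟩)

theorem exists_isPivot {n : ℕ} (V : Submodule ℂ (Fin n → ℂ)) : ∃ J, IsPivot V J := by
  obtain ⟨J, -, hJ⟩ := exists_isPivot_of_linearIndepOn V ∅ (by simp)
  exact ⟨J, hJ⟩

/-- The matrix of the `J`-coordinates of a basis of `V` is invertible if and only if `J` is a pivot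
set. -/
theorem det_ne_zero_iff_isPivot {n r : ℕ} {V : Submodule ℂ (Fin n → ℂ)} {s : Fin r → Fin n → ℂ}
    (hs : LinearIndependent ℂ s) (hV : Submodule.span ℂ (Set.range s) = V) {J : Finset (Fin n)}
    (hJ : J.card = r) :
    (Matrix.of fun i l => s i (J.orderEmbOfFin hJ l)).det ≠ 0 ↔ IsPivot V J := by
  have hcard : J.card = Module.finrank ℂ V := by
    rw [← hV, finrank_span_eq_card hs, Fintype.card_fin, hJ]
  set M : Matrix (Fin r) (Fin r) ℂ := Matrix.of fun i l => s i (J.orderEmbOfFin hJ l) with hM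
  have hvm : ∀ c : Fin r → ℂ, Matrix.vecMul c M = 0 ↔ ∀ j ∈ J, (∑ i, c i • s i) j = 0 := by
    intro c
    constructor
    · intro h j hj
      obtain ⟨l, rfl⟩ : ∃ l, J.orderEmbOfFin hJ l = j := by
        have : j ∈ Set.range (J.orderEmbOfFin hJ) := by
          rw [Finset.range_orderEmbOfFin]; exact hj
        exact this
      have := congrFun h l
      simpa [Matrix.vecMul, dotProduct, hM, Finset.sum_apply] using this
    · intro h
      funext l
      have := h _ (J.orderEmbOfFin_mem hJ l)
      simpa [Matrix.vecMul, dotProduct, hM, Finset.sum_apply] using this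
  constructor
  · intro hdet
    refine ⟨hcard, fun v hv h0 => ?_⟩
    rw [← hV, Submodule.mem_span_range_iff_exists_fun] at hv
    obtain ⟨c, rfl⟩ := hv
    have hc : c = 0 := by
      by_contra hc
      exact hdet (Matrix.exists_vecMul_eq_zero_iff.1 ⟨c, hc, (hvm c).2 h0⟩)
    simp [hc]
  · intro hp hdet
    obtain ⟨c, hc, hc0⟩ := Matrix.exists_vecMul_eq_zero_iff.2 hdet
    have h0 := hp.2 (∑ i, c i • s i)
      (by rw [← hV]; exact Submodule.sum_mem _ fun i _ =>
            Submodule.smul_mem _ _ (Submodule.subset_span ⟨i, rfl⟩))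
      ((hvm c).1 hc0)
    exact hc (funext fun i => Fintype.linearIndependent_iff.1 hs c h0 i)

theorem det_mul_col {r : ℕ} (c : Fin r → ℂ) (M : Matrix (Fin r) (Fin r) ℂ) :
    (Matrix.of fun i l => c l * M i l).det = (∏ l, c l) * M.det :=
  Matrix.det_mul_row c M

/-- All alternating forms change by the same factor under a change of basis. -/
theorem exists_alternating_factor {V : Type*} [AddCommGroup V] [Module ℂ V] {r : ℕ}
    {s s' : Fin r → V} (hs' : LinearIndependent ℂ s')
    (h : ∀ i, s i ∈ Submodule.span ℂ (Set.range s')) :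
    ∃ D : ℂ, ∀ σ : V [⋀^Fin r]→ₗ[ℂ] ℂ, σ s = D * σ s' := by
  set B := Module.Basis.span hs' with hB
  refine ⟨B.det fun i => ⟨s i, h i⟩, fun σ => ?_⟩
  have h1 := (σ.compLinearMap (Submodule.span ℂ (Set.range s')).subtype).eq_smul_basis_det B
  have h2 := congrArg (fun τ => τ fun i => (⟨s i, h i⟩ : Submodule.span ℂ (Set.range s'))) h1
  have hBs : ∀ i, (B i : V) = s' i := fun i => congrArg Subtype.val (Module.Basis.span_apply hs' i)
  simp only [AlternatingMap.compLinearMap_apply, AlternatingMap.smul_apply, smul_eq_mul,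
    Submodule.subtype_apply] at h2
  simp only [hBs] at h2
  rw [h2, mul_comm]

end Pivots

/-! ### Degrees of holomorphic subbundles -/

section Degrees

open Filter

variable {X : Type u} [TopologicalSpace X] [ChartedSpace ℂ X] [IsManifold 𝓘(ℂ) ω X]
variable {T : X → Type v} [∀ x, AddCommGroup (T x)] [∀ x, Module ℂ (T x)]
  [TopologicalSpace (TotalSpace ℂ T)] [∀ x, TopologicalSpace (T x)] [FiberBundle ℂ T]
  [VectorBundle ℂ ℂ T] [ContMDiffVectorBundle ω ℂ T 𝓘(ℂ)]

theorem IsHolSubbundle.finrank_eq [PreconnectedSpace X] {F : Type*} [NormedAddCommGroup F]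
    [NormedSpace ℂ F] {E : X → Type v} [∀ x, AddCommGroup (E x)] [∀ x, Module ℂ (E x)]
    [TopologicalSpace (TotalSpace F E)] [∀ x, TopologicalSpace (E x)] [FiberBundle F E]
    {W : ∀ x, Submodule ℂ (E x)} (hW : IsHolSubbundle F W) (p q : X) :
    Module.finrank ℂ (W p) = Module.finrank ℂ (W q) := by
  have hl : IsLocallyConstant fun x => Module.finrank ℂ (W x) := by
    rw [IsLocallyConstant.iff_eventually_eq]
    intro x
    obtain ⟨r, s, hs⟩ := hW x
    have hr := hs.card_eq
    filter_upwards [hs.2] with y hy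
    rw [← hr, ← hy.2, finrank_span_eq_card hy.1, Fintype.card_fin]
  exact hl.apply_eq_of_isPreconnected isPreconnected_univ (Set.mem_univ p) (Set.mem_univ q)

variable {n : ℕ} {a b : Fin n → ℤ}

/-- The `J`-minor of a frame, in the trivialization at `p`. -/
def frameMinor (T : X → Type v) [∀ x, AddCommGroup (T x)] [∀ x, Module ℂ (T x)]
    [TopologicalSpace (TotalSpace ℂ T)] [∀ x, TopologicalSpace (T x)] [FiberBundle ℂ T]
    [VectorBundle ℂ ℂ T] [ContMDiffVectorBundle ω ℂ T 𝓘(ℂ)]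
    {a b : Fin n → ℤ} {r : ℕ} (s : Fin r → ∀ x, (twistSum T a b).Fiber x) {J : Finset (Fin n)}
    (hJ : J.card = r) (p x : X) : ℂ :=
  (Matrix.of fun i l => twistCocycle T (a (J.orderEmbOfFin hJ l)) (b (J.orderEmbOfFin hJ l)) x p x *
    s i x (J.orderEmbOfFin hJ l)).det

/-- The alternating form that takes vectors of `ℂⁿ` to the determinant of their `J`-coordinates. -/
def minorForm (J : Finset (Fin n)) {r : ℕ} (hJ : J.card = r) : (Fin n → ℂ) [⋀^Fin r]→ₗ[ℂ] ℂ :=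
  Matrix.detRowAlternating.compLinearMap (LinearMap.funLeft ℂ ℂ (J.orderEmbOfFin hJ))

theorem frameMinor_eq {r : ℕ} (s : Fin r → ∀ x, (twistSum T a b).Fiber x) {J : Finset (Fin n)}
    (hJ : J.card = r) (p x : X) :
    frameMinor T s hJ p x = (∏ l, twistCocycle T (a (J.orderEmbOfFin hJ l))
      (b (J.orderEmbOfFin hJ l)) x p x) * minorForm J hJ fun i => s i x :=
  det_mul_col _ _

theorem anaAt_frameMinor {p : X} {r : ℕ} {s : Fin r → ∀ x, (twistSum T a b).Fiber x}
    (hs : ∀ i, HolAt (Fin n → ℂ) (s i) p) {J : Finset (Fin n)} (hJ : J.card = r) :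
    AnaAt (frameMinor T s hJ p) p :=
  AnaAt.det fun i _ => (holAt_iff T a b (s i) p).1 (hs i) _

theorem frameMinor_ne_zero_iff {p x : X} {r : ℕ} {s : Fin r → ∀ x, (twistSum T a b).Fiber x}
    {W : ∀ x, Submodule ℂ ((twistSum T a b).Fiber x)} (hs : LinearIndependent ℂ fun i => s i x)
    (hW : Submodule.span ℂ (Set.range fun i => s i x) = W x) {J : Finset (Fin n)}
    (hJ : J.card = r) : frameMinor T s hJ p x ≠ 0 ↔ IsPivot (W x) J := by
  rw [frameMinor_eq, mul_ne_zero_iff,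
    ← det_ne_zero_iff_isPivot (n := n) (s := fun i => s i x) (V := W x) hs hW hJ]
  exact and_iff_right (Finset.prod_ne_zero_iff.2 fun _ _ => twistCocycle_ne_zero T _ _ _ _ _)

/-- **Degrees and Plücker coordinates.** If the Plücker coordinate with index `J` of the subbundle
`W` of `⊕ L_k` is not identically zero, it is a nonzero holomorphic section of
`(det W)* ⊗ ⨂_{k ∈ J} L_k`; hence `deg W = ∑_{k ∈ J} deg L_k - N`, where `N` is the number of
zeros of this section. -/
theorem hasDegree_of_isPivot [T2Space X] [CompactSpace X] [ConnectedSpace X] {d : Fin n → ℤ}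
    (hd : ∀ k, HasTwistDegree T (a k) (b k) (d k))
    {W : ∀ x, Submodule ℂ ((twistSum T a b).Fiber x)} (hW : IsHolSubbundle (Fin n → ℂ) W)
    {J : Finset (Fin n)} {x₀ : X} (h₀ : IsPivot (W x₀) J) :
    ∃ N : ℤ, 0 ≤ N ∧ HasDegree (Fin n → ℂ) W (∑ k ∈ J, d k - N) ∧
      (N = 0 ↔ ∀ x, IsPivot (W x) J) := by
  have hnb : ∀ p : X, (𝓝[≠] p).NeBot := neBot_punctured
  choose m o hm hofin hosum using hd
  have hframe : ∀ p, ∃ s : Fin J.card → ∀ x, (twistSum T a b).Fiber x,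
      IsFrameAt (Fin n → ℂ) W p s := by
    intro p
    obtain ⟨r, s, hs⟩ := hW p
    obtain rfl : r = J.card := by rw [hs.card_eq, hW.finrank_eq p x₀]; exact h₀.1.symm
    exact ⟨s, hs⟩
  choose s hs using hframe
  have hiff : ∀ p, ∀ᶠ x in 𝓝 p, frameMinor T (s p) rfl p x ≠ 0 ↔ IsPivot (W x) J := by
    intro p
    filter_upwards [(hs p).2] with x hx
    exact frameMinor_ne_zero_iff hx.1 hx.2 rfl
  have hana : ∀ p, AnaAt (frameMinor T (s p) (J := J) rfl p) p := fun p =>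
    anaAt_frameMinor (hs p).1 rfl
  have hor : ∀ p, (∀ᶠ x in 𝓝 p, ¬ IsPivot (W x) J) ∨ ∀ᶠ x in 𝓝[≠] p, IsPivot (W x) J := by
    intro p
    rcases (hana p).eventually_or with h | h
    · left
      filter_upwards [h, hiff p] with x hx hx'
      rw [← hx']
      exact not_not.2 hx
    · right
      filter_upwards [h, eventually_nhdsWithin_of_eventually_nhds (hiff p)] with x hx hx'
      exact hx'.1 hx
  have hgen : ∀ p, ∀ᶠ x in 𝓝[≠] p, IsPivot (W x) J := by
    rcases eventually_punctured_or (fun x => IsPivot (W x) J) fun p => (hor p).imp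
      eventually_nhdsWithin_of_eventually_nhds id with h | h
    · rcases hor x₀ with h1 | h1
      · exact absurd h₀ h1.self_of_nhds
      · obtain ⟨y, hy⟩ := ((h x₀).and h1).exists
        exact absurd hy.2 hy.1
    · exact h
  have hord : ∀ p, ∃ k : ℤ, HasMeroOrder (frameMinor T (s p) (J := J) rfl p) p k := fun p =>
    (hana p).meroAt.exists_hasMeroOrder (by
      refine (?_ : ∀ᶠ x in 𝓝[≠] p, frameMinor T (s p) (J := J) rfl p x ≠ 0).frequently
      filter_upwards [hgen p, eventually_nhdsWithin_of_eventually_nhds (hiff p)] with x hx hx'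
      exact hx'.2 hx)
  choose k hk using hord
  have hk0 : ∀ p, 0 ≤ k p := fun p => by
    have := (hana p).ordAt_nonneg
    rw [(hasMeroOrder_iff.1 (hk p)).2] at this
    exact_mod_cast this
  have hkiff : ∀ p, k p = 0 ↔ IsPivot (W p) J := fun p => by
    rw [← (hiff p).self_of_nhds, ← (hana p).ordAt_eq_zero_iff, (hasMeroOrder_iff.1 (hk p)).2]
    exact_mod_cast Iff.rfl
  have hkfin : (Function.support k).Finite :=
    (finite_setOf_not_of_punctured _ hgen).subset fun p hp hp' => hp ((hkiff p).2 hp')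
  refine ⟨∑ᶠ p, k p, finsum_nonneg hk0, ⟨J.card, fun x => (∏ l, m (J.orderEmbOfFin rfl l) x) •
    minorForm J rfl, fun p => ∑ l, o (J.orderEmbOfFin rfl l) p + k p, fun p => ⟨s p, hs p, ?_⟩,
    ?_, ?_⟩, ?_⟩
  · have h1 := (HasMeroOrder.prod Finset.univ fun l _ => hm (J.orderEmbOfFin rfl l) p).mul (hk p)
    refine h1.congr (eventually_nhdsWithin_of_eventually_nhds ?_)
    filter_upwards [eventually_mem_domain T p] with x hx
    have h2 : ∏ l, (twistCocycle T (a (J.orderEmbOfFin rfl l)) (b (J.orderEmbOfFin rfl l)) x p x *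
        twistCocycle T (a (J.orderEmbOfFin rfl l)) (b (J.orderEmbOfFin rfl l)) p x x) = 1 :=
      Finset.prod_eq_one fun l _ => twistCocycle_mul_symm T _ _ hx
    rw [Finset.prod_mul_distrib] at h2
    rw [frameMinor_eq, Finset.prod_mul_distrib]
    change _ = (∏ l, m (J.orderEmbOfFin rfl l) x) * minorForm J rfl fun i => s p i x
    linear_combination ((∏ l, m (J.orderEmbOfFin rfl l) x) * minorForm J rfl fun i => s p i x) * h2
  · refine ((Set.finite_iUnion fun l => hofin (J.orderEmbOfFin rfl l)).union hkfin).subset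
      fun p hp => ?_
    by_contra h
    simp only [Set.mem_union, Set.mem_iUnion, Function.mem_support, not_or, not_exists,
      not_not] at h
    exact hp (by simp [h.1, h.2])
  · have hfs : (Function.support fun p => ∑ l, o (J.orderEmbOfFin rfl l) p).Finite := by
      refine (Set.finite_iUnion fun l => hofin (J.orderEmbOfFin rfl l)).subset fun p hp => ?_
      by_contra h
      simp only [Set.mem_iUnion, Function.mem_support, not_exists, not_not] at h
      exact hp (by simp [h])
    rw [finsum_add_distrib hfs hkfin, finsum_sum_comm _ _ fun l _ => hofin _]
    simp only [hosum]
    have h3 : ∑ l, d (J.orderEmbOfFin rfl l) = ∑ k ∈ J, d k := by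
      conv_rhs => rw [← Finset.image_orderEmbOfFin_univ J rfl]
      rw [Finset.sum_image fun i _ j _ hij => (J.orderEmbOfFin rfl).injective hij]
    rw [Finset.sum_neg_distrib, h3]
    ring
  · constructor
    · intro h x
      rw [← hkiff]
      by_contra hx
      have hpos : 0 < k x := lt_of_le_of_ne (hk0 x) (Ne.symm hx)
      exact absurd h (ne_of_gt (finsum_pos hk0 ⟨x, hpos⟩ hkfin))
    · intro h
      simp [(hkiff _).2 (h _)]

/-- The order at `p` of a section of `Λʳ W*` may be computed in any frame. -/
theorem IsFrameAt.hasMeroOrder_of_frame {W : ∀ x, Submodule ℂ ((twistSum T a b).Fiber x)} {p : X}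
    {r : ℕ} {s s' : Fin r → ∀ x, (twistSum T a b).Fiber x} (hs' : IsFrameAt (Fin n → ℂ) W p s')
    (hs : IsFrameAt (Fin n → ℂ) W p s)
    {σ : ∀ x, ((twistSum T a b).Fiber x) [⋀^Fin r]→ₗ[ℂ] ℂ} {k : ℤ}
    (h : HasMeroOrder (fun x => σ x fun i => s' i x) p k) :
    HasMeroOrder (fun x => σ x fun i => s i x) p k := by
  obtain ⟨J, hJ⟩ := exists_isPivot (n := n) (W p)
  have hJr : J.card = r := by rw [hs.card_eq]; exact hJ.1
  have h1 := (anaAt_frameMinor hs.1 hJr).hasMeroOrder_zero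
    ((frameMinor_ne_zero_iff hs.2.self_of_nhds.1 hs.2.self_of_nhds.2 hJr).2 hJ)
  have h2 := (anaAt_frameMinor hs'.1 hJr).hasMeroOrder_zero
    ((frameMinor_ne_zero_iff hs'.2.self_of_nhds.1 hs'.2.self_of_nhds.2 hJr).2 hJ)
  have h3 := h.mul (h1.div h2)
  rw [sub_zero, add_zero] at h3
  refine h3.congr ?_
  filter_upwards [h2.eventually_ne_zero, eventually_nhdsWithin_of_eventually_nhds hs.2,
    eventually_nhdsWithin_of_eventually_nhds hs'.2] with x hx hx1 hx2
  obtain ⟨D, hD⟩ := exists_alternating_factor (s := fun i => s i x) hx2.1 fun i => by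
    rw [hx2.2, ← hx1.2]
    exact Submodule.subset_span ⟨i, rfl⟩
  have h4 : frameMinor T s hJr p x = D * frameMinor T s' hJr p x := by
    rw [frameMinor_eq, frameMinor_eq, mul_left_comm]
    congr 1
    exact hD (minorForm J hJr)
  rw [hD (σ x), h4, mul_div_cancel_right₀ _ hx, mul_comm]

/-- The degree of a subbundle is well defined. -/
theorem HasDegree.unique [T2Space X] [CompactSpace X] [ConnectedSpace X]
    {W : ∀ x, Submodule ℂ ((twistSum T a b).Fiber x)} {d d' : ℤ}
    (h : HasDegree (Fin n → ℂ) W d) (h' : HasDegree (Fin n → ℂ) W d') : d = d' := by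
  obtain ⟨r, σ, o, hσ, hfin, hsum⟩ := h
  obtain ⟨r', σ', o', hσ', hfin', hsum'⟩ := h'
  obtain rfl : r = r' := by
    obtain ⟨p⟩ := (inferInstance : Nonempty X)
    obtain ⟨s, hs, -⟩ := hσ p
    obtain ⟨s', hs', -⟩ := hσ' p
    rw [hs.card_eq, hs'.card_eq]
  choose s hs hso using hσ
  choose s' hs' hso' using hσ'
  -- the order of `σ'` at `p` may be computed in the frame chosen for `σ`
  have hso'' : ∀ p, HasMeroOrder (fun x => σ' x fun i => s p i x) p (o' p) := fun p =>
    (hs' p).hasMeroOrder_of_frame (hs p) (hso' p)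
  have hf : ∀ p, HasMeroOrder (fun x => (σ x fun i => s x i x) / (σ' x fun i => s x i x)) p
      (o p - o' p) := by
    intro p
    refine ((hso p).div (hso'' p)).congr ?_
    filter_upwards [(hso'' p).eventually_ne_zero,
      eventually_nhdsWithin_of_eventually_nhds (hs p).2] with x hx hx1
    have hx2 := (hs x).2.self_of_nhds
    obtain ⟨D, hD⟩ := exists_alternating_factor (s := fun i => s p i x) hx2.1 fun i => by
      rw [hx2.2, ← hx1.2]
      exact Submodule.subset_span ⟨i, rfl⟩
    rw [hD (σ' x)] at hx
    rw [hD (σ x), hD (σ' x), mul_div_mul_left _ _ (left_ne_zero_of_mul hx)]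
  have := finsum_ord_eq_zero hf
  rw [finsum_sub_distrib hfin hfin', hsum, hsum'] at this
  omega

end Degrees

/-! ### Constructions of holomorphic subbundles -/

section Constructions

open Filter

variable {X : Type u} [TopologicalSpace X] [ChartedSpace ℂ X] [IsManifold 𝓘(ℂ) ω X]
variable {T : X → Type v} [∀ x, AddCommGroup (T x)] [∀ x, Module ℂ (T x)]
  [TopologicalSpace (TotalSpace ℂ T)] [∀ x, TopologicalSpace (T x)] [FiberBundle ℂ T]
  [VectorBundle ℂ ℂ T] [ContMDiffVectorBundle ω ℂ T 𝓘(ℂ)]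
variable {n : ℕ} {a b : Fin n → ℤ}

theorem IsHolSubbundle.exists_degree_le [T2Space X] [CompactSpace X] [ConnectedSpace X]
    {d : Fin n → ℤ} (hd : ∀ k, HasTwistDegree T (a k) (b k) (d k))
    {W : ∀ x, Submodule ℂ ((twistSum T a b).Fiber x)} (hW : IsHolSubbundle (Fin n → ℂ) W)
    {J : Finset (Fin n)} {x₀ : X} (h₀ : IsPivot (W x₀) J) :
    ∃ e : ℤ, HasDegree (Fin n → ℂ) W e ∧ e ≤ ∑ k ∈ J, d k ∧
      (e = ∑ k ∈ J, d k ↔ ∀ x, IsPivot (W x) J) := by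
  obtain ⟨N, hN, hdeg, hiff⟩ := hasDegree_of_isPivot hd hW h₀
  refine ⟨_, hdeg, by omega, ?_⟩
  rw [← hiff]
  omega

theorem hasDegree_of_forall_isPivot [T2Space X] [CompactSpace X] [ConnectedSpace X]
    {d : Fin n → ℤ} (hd : ∀ k, HasTwistDegree T (a k) (b k) (d k))
    {W : ∀ x, Submodule ℂ ((twistSum T a b).Fiber x)} (hW : IsHolSubbundle (Fin n → ℂ) W)
    {J : Finset (Fin n)} (h : ∀ x, IsPivot (W x) J) :
    HasDegree (Fin n → ℂ) W (∑ k ∈ J, d k) := by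
  obtain ⟨x₀⟩ := (inferInstance : Nonempty X)
  obtain ⟨e, he, -, hiff⟩ := hW.exists_degree_le hd (h x₀)
  rwa [hiff.2 h] at he

/-- A fibrewise direct sum of holomorphic subbundles is a holomorphic subbundle. -/
theorem IsHolSubbundle.sup {F : Type*} [NormedAddCommGroup F]
    [NormedSpace ℂ F] {E : X → Type v} [∀ x, AddCommGroup (E x)] [∀ x, Module ℂ (E x)]
    [TopologicalSpace (TotalSpace F E)] [∀ x, TopologicalSpace (E x)] [FiberBundle F E]
    {W W' : ∀ x, Submodule ℂ (E x)} (hW : IsHolSubbundle F W) (hW' : IsHolSubbundle F W')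
    (h : ∀ x, Disjoint (W x) (W' x)) : IsHolSubbundle F fun x => W x ⊔ W' x := by
  intro p
  obtain ⟨r, s, hs⟩ := hW p
  obtain ⟨r', s', hs'⟩ := hW' p
  refine ⟨r + r', fun i => Sum.elim s s' (finSumFinEquiv.symm i), fun i => ?_, ?_⟩
  · change HolAt F (Sum.elim s s' (finSumFinEquiv.symm i)) p
    rcases finSumFinEquiv.symm i with j | j
    · exact hs.1 j
    · exact hs'.1 j
  · filter_upwards [hs.2, hs'.2] with x hx hx'
    have hf : (fun i => Sum.elim s s' (finSumFinEquiv.symm i) x) =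
        (Sum.elim (fun j => s j x) fun j => s' j x) ∘ finSumFinEquiv.symm := by
      funext i
      rw [Function.comp_apply]
      rcases finSumFinEquiv.symm i with j | j <;> rfl
    rw [hf]
    constructor
    · rw [linearIndependent_equiv]
      refine LinearIndependent.sum_type hx.1 hx'.1 ?_
      rw [hx.2, hx'.2]
      exact h x
    · rw [EquivLike.range_comp, Set.Sum.elim_range, Submodule.span_union, hx.2, hx'.2]

/-- The local frame of the summand `T^(a j) K^(b j)` given by the trivialization at `p`. -/
def localFrame (T : X → Type v) [∀ x, AddCommGroup (T x)] [∀ x, Module ℂ (T x)]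
    [TopologicalSpace (TotalSpace ℂ T)] [∀ x, TopologicalSpace (T x)] [FiberBundle ℂ T]
    [VectorBundle ℂ ℂ T] [ContMDiffVectorBundle ω ℂ T 𝓘(ℂ)] (a b : Fin n → ℤ) (p : X) (j : Fin n) :
    ∀ x, (twistSum T a b).Fiber x :=
  fun x => (Pi.single j (twistCocycle T (a j) (b j) p x x) : Fin n → ℂ)

theorem localFrame_eq_smul (p : X) (j : Fin n) (x : X) :
    localFrame T a b p j x =
      twistCocycle T (a j) (b j) p x x • (Pi.single j 1 : Fin n → ℂ) := by
  rw [← Pi.single_smul, smul_eq_mul, mul_one]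
  rfl

/-- A vector of coordinate functions with respect to the trivialization at `p`, as a section. -/
theorem holAt_of_coord {p : X} {f : X → Fin n → ℂ} (hf : ∀ k, AnaAt (fun x => f x k) p) :
    HolAt (Fin n → ℂ) (E := (twistSum T a b).Fiber)
      (fun x => (fun k => twistCocycle T (a k) (b k) p x x * f x k : Fin n → ℂ)) p := by
  refine (holAt_iff T a b _ p).2 fun k => (hf k).congr ?_
  filter_upwards [eventually_mem_domain T p] with x hx
  have := twistCocycle_mul_symm T (a k) (b k) hx
  rw [← mul_assoc, this, one_mul]

theorem holAt_localFrame (p : X) (j : Fin n) :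
    HolAt (Fin n → ℂ) (localFrame T a b p j) p := by
  refine (holAt_iff T a b _ p).2 fun k => ?_
  refine (AnaAt.const ((Pi.single j 1 : Fin n → ℂ) k) p).congr ?_
  filter_upwards [eventually_mem_domain T p] with x hx
  change _ = twistCocycle T (a k) (b k) x p x *
    (Pi.single j (twistCocycle T (a j) (b j) p x x) : Fin n → ℂ) k
  by_cases hk : k = j
  · subst hk
    rw [Pi.single_eq_same, Pi.single_eq_same, twistCocycle_mul_symm T (a k) (b k) hx]
  · rw [Pi.single_eq_of_ne hk, Pi.single_eq_of_ne hk, mul_zero]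

/-- The vectors whose coordinates outside `S` vanish. -/
def coordSubspace (S : Finset (Fin n)) : Submodule ℂ (Fin n → ℂ) where
  carrier := {v | ∀ k ∉ S, v k = 0}
  add_mem' hv hw k hk := by rw [Pi.add_apply, hv k hk, hw k hk, add_zero]
  zero_mem' _ _ := rfl
  smul_mem' c v hv k hk := by rw [Pi.smul_apply, hv k hk, smul_zero]

theorem linearIndependent_single {r : ℕ} {ι : Fin r → Fin n} (hι : Function.Injective ι)
    {c : Fin r → ℂ} (hc : ∀ i, c i ≠ 0) :
    LinearIndependent ℂ fun i => (Pi.single (ι i) (c i) : Fin n → ℂ) := by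
  rw [Fintype.linearIndependent_iff]
  intro g hg i
  have := congrFun hg (ι i)
  simp only [Finset.sum_apply, Pi.smul_apply, smul_eq_mul, Pi.zero_apply] at this
  rw [Finset.sum_eq_single i] at this
  · simpa [hc i] using this
  · intro j _ hj
    rw [Pi.single_eq_of_ne (fun h => hj (hι h).symm), mul_zero]
  · simp

theorem span_single_eq {S : Finset (Fin n)} {c : Fin S.card → ℂ} (hc : ∀ i, c i ≠ 0) :
    Submodule.span ℂ (Set.range fun i => (Pi.single (S.orderEmbOfFin rfl i) (c i) : Fin n → ℂ)) =
      coordSubspace S := by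
  refine le_antisymm ?_ fun v hv => ?_
  · rw [Submodule.span_le]
    rintro _ ⟨i, rfl⟩ k hk
    refine Pi.single_eq_of_ne (fun h => hk ?_) _
    rw [h]
    exact S.orderEmbOfFin_mem rfl i
  · rw [Submodule.mem_span_range_iff_exists_fun]
    refine ⟨fun i => v (S.orderEmbOfFin rfl i) / c i, ?_⟩
    have h1 : ∀ i, (v (S.orderEmbOfFin rfl i) / c i) •
        (Pi.single (S.orderEmbOfFin rfl i) (c i) : Fin n → ℂ) =
        Pi.single (S.orderEmbOfFin rfl i) (v (S.orderEmbOfFin rfl i)) := fun i => by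
      rw [← Pi.single_smul, smul_eq_mul, div_mul_cancel₀ _ (hc i)]
    simp only [h1]
    have h2 : ∑ i, (Pi.single (S.orderEmbOfFin rfl i) (v (S.orderEmbOfFin rfl i)) : Fin n → ℂ) =
        ∑ k ∈ S, Pi.single k (v k) := by
      conv_rhs => rw [← Finset.image_orderEmbOfFin_univ S rfl]
      rw [Finset.sum_image fun i _ j _ hij => (S.orderEmbOfFin rfl).injective hij]
    rw [h2]
    conv_rhs => rw [← Finset.univ_sum_single v]
    refine Finset.sum_subset (Finset.subset_univ S) fun k _ hk => ?_
    rw [hv k hk, Pi.single_zero]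

theorem finrank_coordSubspace (S : Finset (Fin n)) :
    Module.finrank ℂ (coordSubspace S) = S.card := by
  rw [← span_single_eq (c := fun _ => 1) fun _ => one_ne_zero, finrank_span_eq_card
    (linearIndependent_single (S.orderEmbOfFin rfl).injective fun _ => one_ne_zero),
    Fintype.card_fin]

theorem isPivot_coordSubspace (S : Finset (Fin n)) : IsPivot (coordSubspace S) S := by
  refine ⟨(finrank_coordSubspace S).symm, fun v hv h => funext fun k => ?_⟩
  by_cases hk : k ∈ S
  · exact h k hk
  · exact hv k hk

theorem coordSubspace_univ : coordSubspace (Finset.univ : Finset (Fin n)) = ⊤ :=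
  eq_top_iff.2 fun _ _ k hk => absurd (Finset.mem_univ k) hk

/-- The subbundle `⨁_{k ∈ S} T^(a k) K^(b k)`. -/
theorem isHolSubbundle_coordSubspace (S : Finset (Fin n)) :
    IsHolSubbundle (Fin n → ℂ) (E := (twistSum T a b).Fiber) fun _ => coordSubspace S := by
  intro p
  refine ⟨S.card, fun i => localFrame T a b p (S.orderEmbOfFin rfl i), fun i =>
    holAt_localFrame p _, Eventually.of_forall fun x => ⟨?_, ?_⟩⟩
  · exact linearIndependent_single (S.orderEmbOfFin rfl).injective fun i =>
      twistCocycle_ne_zero T _ _ _ _ _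
  · exact span_single_eq fun i => twistCocycle_ne_zero T _ _ _ _ _

/-- **Saturation of a line.** Let `S` be a section of a bundle that becomes holomorphic near each
point after multiplication by a nowhere vanishing function, and has isolated zeros. The lines
spanned by its values extend over the zeros to a holomorphic line subbundle, generated near `p` by
the quotient of a holomorphic section by a power of the coordinate. -/
theorem exists_saturation [T1Space X] {S : ∀ x, (twistSum T a b).Fiber x}
    {s : X → ∀ x, (twistSum T a b).Fiber x} (hs : ∀ p, HolAt (Fin n → ℂ) (s p) p)
    (hsS : ∀ p, ∀ᶠ x in 𝓝 p, ∃ c : ℂ, c ≠ 0 ∧ s p x = c • S x)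
    (hS : ∀ p, ∀ᶠ x in 𝓝[≠] p, S x ≠ 0) :
    ∃ (L : ∀ x, Submodule ℂ ((twistSum T a b).Fiber x))
      (s' : X → ∀ x, (twistSum T a b).Fiber x) (m : X → ℕ),
      (∀ x, S x ∈ L x) ∧ (∀ p, IsFrameAt (Fin n → ℂ) L p fun _ : Fin 1 => s' p) ∧
      ∀ p, ∀ᶠ x in 𝓝 p, s p x = (chartAt ℂ p x - chartAt ℂ p p) ^ m p • s' p x := by
  have hnb : ∀ p : X, (𝓝[≠] p).NeBot := neBot_punctured
  have hne : ∀ p, ∀ᶠ x in 𝓝[≠] p, s p x ≠ 0 := by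
    intro p
    filter_upwards [hS p, eventually_nhdsWithin_of_eventually_nhds (hsS p)] with x hx ⟨c, hc, hx'⟩
    rw [hx']
    exact smul_ne_zero hc hx
  have hex : ∀ p, ∃ (m : ℕ) (g : X → Fin n → ℂ), (∀ k, AnaAt (fun x => g x k) p) ∧ g p ≠ 0 ∧
      ∀ᶠ x in 𝓝 p, (fun k => twistCocycle T (a k) (b k) x p x * s p x k) =
        (chartAt ℂ p x - chartAt ℂ p p) ^ m • g x := by
    intro p
    refine exists_pow_smul_of_anaAt ((holAt_iff T a b (s p) p).1 (hs p))
      (Eventually.frequently ((hne p).mono fun x hx h0 => hx (funext fun k => ?_)))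
    exact (mul_eq_zero.1 (congrFun h0 k)).resolve_left (twistCocycle_ne_zero T _ _ _ _ _)
  choose m g hg hg0 hmg using hex
  set s' : X → ∀ x, (twistSum T a b).Fiber x := fun p x =>
    (fun k => twistCocycle T (a k) (b k) p x x * g p x k : Fin n → ℂ) with hs'
  have hss' : ∀ p, ∀ᶠ x in 𝓝 p,
      s p x = (chartAt ℂ p x - chartAt ℂ p p) ^ m p • s' p x := by
    intro p
    filter_upwards [hmg p, eventually_mem_domain T p] with x hx hxd
    funext k
    have h1 := congrFun hx k
    have h2 := twistCocycle_mul_symm T (a k) (b k) hxd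
    change _ = (chartAt ℂ p x - chartAt ℂ p p) ^ m p * g p x k at h1
    change s p x k = (chartAt ℂ p x - chartAt ℂ p p) ^ m p *
      (twistCocycle T (a k) (b k) p x x * g p x k)
    linear_combination twistCocycle T (a k) (b k) p x x * h1 - s p x k * h2
  have hs'0 : ∀ p, ∀ᶠ x in 𝓝 p, s' p x ≠ 0 := by
    intro p
    obtain ⟨k, hk⟩ : ∃ k, g p p k ≠ 0 := by
      by_contra h
      push Not at h
      exact hg0 p (funext h)
    filter_upwards [(hg p k).continuousAt.eventually_ne hk] with x hx h0
    exact mul_ne_zero (twistCocycle_ne_zero T _ _ _ _ _) hx (congrFun h0 k)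
  -- where `S` does not vanish, the generators are multiples of `S`
  have hprop : ∀ p, ∀ᶠ x in 𝓝 p, S x ≠ 0 → ∃ c : ℂ, c ≠ 0 ∧ s' p x = c • S x := by
    intro p
    filter_upwards [hsS p, hss' p] with x ⟨c, hc, hx⟩ hx' hSx
    rw [hx] at hx'
    have hz : (chartAt ℂ p x - chartAt ℂ p p) ^ m p ≠ 0 := by
      intro h0
      rw [h0, zero_smul] at hx'
      exact smul_ne_zero hc hSx hx'
    refine ⟨((chartAt ℂ p x - chartAt ℂ p p) ^ m p)⁻¹ * c, mul_ne_zero (inv_ne_zero hz) hc, ?_⟩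
    rw [mul_smul, hx', inv_smul_smul₀ hz]
  refine ⟨fun x => Submodule.span ℂ {s' x x}, s', m, fun x => ?_, fun p => ⟨fun _ => ?_, ?_⟩, hss'⟩
  · by_cases hx : S x = 0
    · rw [hx]
      exact Submodule.zero_mem _
    · obtain ⟨c, hc, h⟩ := (hprop x).self_of_nhds hx
      rw [Submodule.mem_span_singleton]
      exact ⟨c⁻¹, by rw [h, inv_smul_smul₀ hc]⟩
  · exact holAt_of_coord (hg p)
  · have hcompl : ∀ᶠ x in 𝓝 p, x ≠ p → S x ≠ 0 := eventually_nhdsWithin_iff.1 (hS p)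
    filter_upwards [hs'0 p, hprop p, hcompl] with x hx0 hx hxS
    refine ⟨LinearIndependent.of_subsingleton 0 hx0, ?_⟩
    rw [Set.range_const]
    by_cases hxp : x = p
    · rw [hxp]
    · obtain ⟨c, hc, h⟩ := hx (hxS hxp)
      obtain ⟨c', hc', h'⟩ := (hprop x).self_of_nhds (hxS hxp)
      rw [h, h', Submodule.span_singleton_smul_eq hc.isUnit,
        Submodule.span_singleton_smul_eq hc'.isUnit]

/-- A nonzero morphism from the line bundle `T^k K^l` to a bundle factors through the saturation `L`
of its image, so `deg (T^k K^l) ≤ deg L`. -/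
theorem degree_le_of_saturation [T2Space X] [CompactSpace X] [ConnectedSpace X] {k l d e : ℤ}
    (hd : HasTwistDegree T k l d) {S : ∀ x, (twistSum T a b).Fiber x}
    {L : ∀ x, Submodule ℂ ((twistSum T a b).Fiber x)}
    {s s' : X → ∀ x, (twistSum T a b).Fiber x} {m : X → ℕ} {c : X → X → ℂ}
    (hc : ∀ p, AnaAt (c p) p) (hc0 : ∀ p, c p p ≠ 0)
    (hsS : ∀ p, ∀ᶠ x in 𝓝 p, s p x = (c p x * twistCocycle T k l p x x) • S x)
    (hL : ∀ p, IsFrameAt (Fin n → ℂ) L p fun _ : Fin 1 => s' p)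
    (hss' : ∀ p, ∀ᶠ x in 𝓝 p, s p x = (chartAt ℂ p x - chartAt ℂ p p) ^ m p • s' p x)
    (he : HasDegree (Fin n → ℂ) L e) : d ≤ e := by
  obtain ⟨μ, o, hμ, hofin, hosum⟩ := hd
  obtain ⟨r, σ, o', hσ, hofin', hosum'⟩ := he
  obtain rfl : r = 1 := by
    obtain ⟨p⟩ := (inferInstance : Nonempty X)
    obtain ⟨s, hs, -⟩ := hσ p
    rw [hs.card_eq, ← (hL p).card_eq]
  have h1 : ∀ p, HasMeroOrder (fun x => σ x fun _ => s' p x) p (o' p) := fun p => by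
    obtain ⟨s'', hs'', h⟩ := hσ p
    exact hs''.hasMeroOrder_of_frame (hL p) h
  have hsmul : ∀ (x : X) (z : ℂ) (w : (twistSum T a b).Fiber x),
      (σ x fun _ => z • w) = z * σ x fun _ => w := fun x z w => by
    have := (σ x).map_smul_univ (fun _ => z) fun _ => w
    simpa using this
  have h2 : ∀ p, HasMeroOrder (fun x => twistCocycle T k l p x x * σ x fun _ => S x) p
      (m p + o' p) := by
    intro p
    have := ((hasMeroOrder_coord_pow p (m p)).mul (h1 p)).div ((hc p).hasMeroOrder_zero (hc0 p))
    rw [sub_zero] at this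
    refine this.congr (eventually_nhdsWithin_of_eventually_nhds ?_)
    filter_upwards [hsS p, hss' p, (hc p).continuousAt.eventually_ne (hc0 p)] with x hx hx' hcx
    rw [← hsmul, ← hx', hx, hsmul]
    field_simp
  have h3 : ∀ p, HasMeroOrder (fun x => (σ x fun _ => S x) / μ x) p (m p + o' p - o p) := by
    intro p
    refine ((h2 p).div (hμ p)).congr (Eventually.of_forall fun x => ?_)
    rw [mul_div_mul_left _ _ (twistCocycle_ne_zero T _ _ _ _ _)]
  have hfin := finite_support_ord h3
  have hsum := finsum_ord_eq_zero h3
  have hm : (Function.support fun p => (m p : ℤ)).Finite := by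
    refine ((hfin.union hofin).union hofin').subset fun p hp => ?_
    by_contra h
    simp only [Set.mem_union, Function.mem_support, not_or, not_not] at h
    refine hp ?_
    have := h.1.1
    change (m p : ℤ) = 0
    omega
  have hmo : (Function.support fun p => (m p : ℤ) + o' p).Finite :=
    (hm.union hofin').subset (Function.support_add _ _)
  rw [finsum_sub_distrib hmo hofin, finsum_add_distrib hm hofin', hosum, hosum'] at hsum
  have : 0 ≤ ∑ᶠ p, (m p : ℤ) := finsum_nonneg fun p => by positivity
  omega

end Constructions

/-! ### Invariant subspaces of a weighted cycle -/

section Cycle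

/-- The weighted cyclic shift `e_j ↦ a_j e_{j+1}` of `ℂ⁶`. -/
def cycleMap (a : Fin 6 → ℂ) : (Fin 6 → ℂ) →ₗ[ℂ] (Fin 6 → ℂ) where
  toFun x j := a (j - 1) * x (j - 1)
  map_add' x y := by funext j; simp [mul_add]
  map_smul' c x := by funext j; simp [mul_left_comm]

theorem cycleMap_apply (a : Fin 6 → ℂ) (x : Fin 6 → ℂ) (j : Fin 6) :
    cycleMap a x (j + 1) = a j * x j := by
  simp [cycleMap]

variable {a : Fin 6 → ℂ} {U : Submodule ℂ (Fin 6 → ℂ)}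

theorem IsPivot.rotate_one (ha : ∀ j, a j ≠ 0) (hU : ∀ x ∈ U, cycleMap a x ∈ U)
    {J : Finset (Fin 6)} (hJ : IsPivot U J) : IsPivot U (J.image (· + 1)) := by
  refine ⟨by rw [Finset.card_image_of_injective _ (add_left_injective 1), hJ.1], ?_⟩
  have hinj : Function.Injective ((cycleMap a).restrict hU) := by
    rw [← LinearMap.ker_eq_bot, LinearMap.ker_eq_bot']
    intro x hx
    refine Subtype.ext (funext fun j => ?_)
    have h1 := congrFun (congrArg Subtype.val hx) (j + 1)
    rw [LinearMap.coe_restrict_apply, cycleMap_apply] at h1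
    exact (mul_eq_zero.1 h1).resolve_left (ha j)
  intro x hx h0
  obtain ⟨y, hy⟩ := LinearMap.injective_iff_surjective.1 hinj ⟨x, hx⟩
  have hy' : cycleMap a y = x := congrArg Subtype.val hy
  have : (y : Fin 6 → ℂ) = 0 := by
    refine hJ.2 y y.2 fun j hj => ?_
    have h1 := h0 (j + 1) (Finset.mem_image_of_mem _ hj)
    rw [← hy', cycleMap_apply] at h1
    exact (mul_eq_zero.1 h1).resolve_left (ha j)
  rw [← hy', this, map_zero]

/-- The pivot sets of an invariant subspace are permuted by the rotations. -/
theorem IsPivot.rotate (ha : ∀ j, a j ≠ 0) (hU : ∀ x ∈ U, cycleMap a x ∈ U)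
    {J : Finset (Fin 6)} (hJ : IsPivot U J) (k : Fin 6) : IsPivot U (J.image (· + k)) := by
  have h : ∀ n : ℕ, IsPivot U (J.image (· + n • (1 : Fin 6))) := by
    intro n
    induction n with
    | zero => simpa using hJ
    | succ n ih =>
      have := ih.rotate_one ha hU
      rw [Finset.image_image] at this
      convert this using 2
      funext j
      rw [Function.comp_apply, succ_nsmul, add_assoc]
  have hk : k.val • (1 : Fin 6) = k := by clear h; revert k; decide
  rw [← hk]
  exact h k

/-- The average of a weight over all rotations of `J`: some rotation has negative weight, unless all
of them have weight zero. -/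
theorem exists_rotate_neg_or (J : Finset (Fin 6)) (e : ℤ) (w : Fin 6 → ℤ)
    (h : 6 * e + J.card * ∑ j, w j ≤ 0) :
    (∃ k, e + ∑ j ∈ J.image (· + k), w j < 0) ∨
      (6 * e + J.card * ∑ j, w j = 0 ∧ ∀ k, e + ∑ j ∈ J.image (· + k), w j = 0) := by
  have himg : ∀ k, ∑ j ∈ J.image (· + k), w j = ∑ j ∈ J, w (j + k) := fun k =>
    Finset.sum_image fun i _ j _ hij => add_left_injective k hij
  have hsum : ∑ k, (e + ∑ j ∈ J.image (· + k), w j) = 6 * e + J.card * ∑ j, w j := by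
    simp only [himg, Finset.sum_add_distrib, Finset.sum_const, Finset.card_univ, Fintype.card_fin]
    rw [Finset.sum_comm]
    have : ∀ j ∈ J, ∑ k, w (j + k) = ∑ k, w k := fun j _ => Equiv.sum_comp (Equiv.addLeft j) w
    rw [Finset.sum_congr rfl this, Finset.sum_const]
    simp
  by_cases hneg : ∃ k, e + ∑ j ∈ J.image (· + k), w j < 0
  · exact Or.inl hneg
  · push Not at hneg
    right
    have h0 : 6 * e + J.card * ∑ j, w j = 0 :=
      le_antisymm h (hsum ▸ Finset.sum_nonneg fun k _ => hneg k)
    refine ⟨h0, fun k => ?_⟩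
    rw [← hsum] at h0
    exact (Finset.sum_eq_zero_iff_of_nonneg fun k _ => hneg k).1 h0 k (Finset.mem_univ k)

/-- A set all of whose rotations have weight zero for `(0, 1, -1, 0, 1, -1)` contains the same
number of elements of each antipodal pair. -/
theorem antipodal_of_rotate (J : Finset (Fin 6)) (h0 : J.Nonempty) (h1 : J ≠ Finset.univ)
    (h : ∀ k : Fin 6, ∑ j ∈ J.image (· + k), (![0, 1, -1, 0, 1, -1] : Fin 6 → ℤ) j = 0) :
    J.card = 3 ∧ ∀ i, ¬ (i ∈ J ∧ i + 3 ∈ J) := by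
  revert J
  decide +kernel

/-- If every pivot set of the invariant subspace `U` has nonnegative weight for
`(0, 1, -1, 0, 1, -1)`, then `U` is three-dimensional, spanned by one line in each of the antipodal
coordinate planes. -/
theorem isPivot_even_odd (ha : ∀ j, a j ≠ 0) (hU : ∀ x ∈ U, cycleMap a x ∈ U) (h0 : U ≠ ⊥)
    (h1 : U ≠ ⊤)
    (h : ∀ J, IsPivot U J → 0 ≤ ∑ j ∈ J, (![0, 1, -1, 0, 1, -1] : Fin 6 → ℤ) j) :
    IsPivot U {0, 2, 4} ∧ IsPivot U {1, 3, 5} := by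
  have key : ∀ J, IsPivot U J → J.card = 3 ∧ ∀ i, ¬ (i ∈ J ∧ i + 3 ∈ J) := by
    intro J hJ
    refine antipodal_of_rotate J ?_ ?_ ?_
    · rw [← Finset.card_pos, hJ.1]
      exact Nat.pos_of_ne_zero fun h => h0 (Submodule.finrank_eq_zero.1 h)
    · rintro rfl
      refine h1 (Submodule.eq_top_of_finrank_eq ?_)
      rw [← hJ.1]
      simp
    · rcases exists_rotate_neg_or J 0 ![0, 1, -1, 0, 1, -1] (by simp [Fin.sum_univ_six]) with
        ⟨k, hk⟩ | ⟨-, hk⟩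
      · have := h _ (hJ.rotate ha hU k)
        omega
      · exact fun k => by simpa using hk k
  have hpair : ∀ i, ∀ x ∈ U, x i = 0 → x (i + 3) = 0 := by
    intro i x hx hxi
    by_contra hne
    -- otherwise the coordinates `i` and `i + 3` belong to a common pivot set
    obtain ⟨y, hy, hyi⟩ : ∃ y ∈ U, y i ≠ 0 := by
      refine ⟨_, hU _ (hU _ (hU x hx)), ?_⟩
      rw [show i = (i + 3) + 1 + 1 + 1 by clear * - i; revert i; decide, cycleMap_apply,
        cycleMap_apply, cycleMap_apply]
      exact mul_ne_zero (ha _) (mul_ne_zero (ha _) (mul_ne_zero (ha _) hne))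
    have hi : i ≠ i + 3 := by clear * - i; revert i; decide
    obtain ⟨J, hJ, hpJ⟩ := exists_isPivot_of_linearIndepOn U {i, i + 3} fun c hc => by
      have hc1 := hc x hx
      have hc2 := hc y hy
      rw [Finset.sum_pair hi] at hc1 hc2
      have hc3 : c (i + 3) = 0 := by simpa [hxi, hne] using hc1
      have hc4 : c i = 0 := by simpa [hc3, hyi] using hc2
      simp [hc3, hc4]
    exact (key J hpJ).2 i ⟨hJ (by simp), hJ (by simp)⟩
  obtain ⟨J, hJ⟩ := exists_isPivot U
  have hrank : Module.finrank ℂ U = 3 := by rw [← hJ.1, (key J hJ).1]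
  have e0 := hpair 0
  have e1 := hpair 1
  have e2 := hpair 2
  have e3 := hpair 3
  have e4 := hpair 4
  have e5 := hpair 5
  constructor <;> refine ⟨by rw [hrank]; rfl, fun x hx hz => ?_⟩ <;>
    simp only [Finset.mem_insert, Finset.mem_singleton, forall_eq_or_imp, forall_eq] at hz
  · funext j
    fin_cases j
    exacts [hz.1, e4 x hx hz.2.2, hz.2.1, e0 x hx hz.1, hz.2.2, e2 x hx hz.2.1]
  · funext j
    fin_cases j
    exacts [e3 x hx hz.2.1, hz.1, e5 x hx hz.2.2, hz.2.1, e1 x hx hz.1, hz.2.2]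

end Cycle

/-! ### Invariant subspaces of the matrix of the Higgs field -/

section Matrix

/-- The degree of the `j`-th line bundle in `T²K, TK, T, O, T⁻¹, T⁻¹K⁻¹, T⁻²K⁻¹`, where `t = deg T`
and `k = deg K`. -/
def lineDeg (t k : ℤ) (j : Fin 7) : ℤ :=
  expT j * t + expK j * k

theorem alphaMatrix_mulVec (b d : ℂ) (v : Fin 7 → ℂ) :
    (alphaMatrix b d).mulVec v = ![d * v 5, b * v 0 + d * v 6, v 1,
      -(Complex.I * (Real.sqrt 2 : ℂ)) * b * v 2, -(Complex.I * (Real.sqrt 2 : ℂ)) * b * v 3,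
      v 4, b * v 5] := by
  funext k
  fin_cases k <;> simp [alphaMatrix, Matrix.mulVec, dotProduct, Fin.sum_univ_seven]

theorem coupling_sq : (-(Complex.I * (Real.sqrt 2 : ℂ))) ^ 2 = -2 := by
  rw [neg_sq, mul_pow, Complex.I_sq, ← Complex.ofReal_pow, Real.sq_sqrt (by norm_num)]
  norm_num

theorem coupling_ne_zero : -(Complex.I * (Real.sqrt 2 : ℂ)) ≠ 0 := by
  intro h
  have := coupling_sq
  rw [h] at this
  norm_num at this

/-- A generator of the kernel of the Higgs field, for `β, δ ≠ 0`. -/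
def kerVec (b d : ℂ) : Fin 7 → ℂ :=
  ![d, 0, 0, 0, 0, 0, -b]

/-- The image of the Higgs field, for `β, δ ≠ 0`. -/
def imageSubspace (b d : ℂ) : Submodule ℂ (Fin 7 → ℂ) where
  carrier := {v | b * v 0 = d * v 6}
  add_mem' {v w} hv hw := by
    simp only [Set.mem_ofPred_eq, Pi.add_apply] at *
    linear_combination hv + hw
  zero_mem' := by simp
  smul_mem' c v hv := by
    simp only [Set.mem_ofPred_eq, Pi.smul_apply, smul_eq_mul] at *
    linear_combination c * hv

theorem mem_imageSubspace {b d : ℂ} {v : Fin 7 → ℂ} :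
    v ∈ imageSubspace b d ↔ b * v 0 = d * v 6 :=
  Iff.rfl

variable {b d : ℂ} {V : Submodule ℂ (Fin 7 → ℂ)}

theorem mulVec_mem_imageSubspace (b d : ℂ) (v : Fin 7 → ℂ) :
    (alphaMatrix b d).mulVec v ∈ imageSubspace b d := by
  rw [mem_imageSubspace, alphaMatrix_mulVec]
  simp
  ring

/-- An invariant subspace that is not contained in the image contains the kernel, because
`Φ⁶ = -4β³δ` on the image and `Φ = 0` on the kernel. -/
theorem kerVec_mem_or_le_imageSubspace (hb : b ≠ 0)
    (hV : ∀ v ∈ V, (alphaMatrix b d).mulVec v ∈ V) :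
    kerVec b d ∈ V ∨ V ≤ imageSubspace b d := by
  by_cases h : V ≤ imageSubspace b d
  · exact Or.inr h
  left
  obtain ⟨v, hv, hne⟩ := SetLike.not_le_iff_exists.1 h
  rw [mem_imageSubspace] at hne
  have h6 := V.add_mem (hV _ (hV _ (hV _ (hV _ (hV _ (hV v hv)))))) (V.smul_mem (4 * b ^ 3 * d) hv)
  have hcoef : 2 * b ^ 2 * (b * v 0 - d * v 6) ≠ 0 :=
    mul_ne_zero (mul_ne_zero two_ne_zero (pow_ne_zero 2 hb)) (sub_ne_zero.2 hne)
  rw [← V.smul_mem_iff hcoef]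
  convert h6 using 1
  have hc := coupling_sq
  set c := -(Complex.I * (Real.sqrt 2 : ℂ)) with hcdef
  simp only [alphaMatrix_mulVec, ← hcdef]
  funext k
  fin_cases k <;> simp [kerVec]
  · linear_combination (-(d * b ^ 2 * (b * v 0 + d * v 6))) * hc
  · linear_combination (-(2 * b ^ 3 * d * v 1)) * hc
  · linear_combination (-(2 * b ^ 3 * d * v 2)) * hc
  · linear_combination (-(2 * b ^ 3 * d * v 3)) * hc
  · linear_combination (-(2 * b ^ 3 * d * v 4)) * hc
  · linear_combination (-(2 * b ^ 3 * d * v 5)) * hc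
  · linear_combination (-(b ^ 3 * (b * v 0 + d * v 6))) * hc

/-- The first six coordinates, which are coordinates on the image of the Higgs field. -/
def sixMap : (Fin 7 → ℂ) →ₗ[ℂ] (Fin 6 → ℂ) :=
  LinearMap.funLeft ℂ ℂ Fin.castSucc

/-- The weights of the Higgs field on its image. -/
def cycleWeights (b d : ℂ) : Fin 6 → ℂ :=
  ![2 * b, 1, -(Complex.I * (Real.sqrt 2 : ℂ)) * b, -(Complex.I * (Real.sqrt 2 : ℂ)) * b, 1, d]

theorem cycleWeights_ne_zero (hb : b ≠ 0) (hd : d ≠ 0) (j : Fin 6) : cycleWeights b d j ≠ 0 := by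
  fin_cases j
  · exact mul_ne_zero two_ne_zero hb
  · exact one_ne_zero
  · exact mul_ne_zero coupling_ne_zero hb
  · exact mul_ne_zero coupling_ne_zero hb
  · exact one_ne_zero
  · exact hd

theorem sixMap_mulVec {v : Fin 7 → ℂ} (hv : v ∈ imageSubspace b d) :
    sixMap ((alphaMatrix b d).mulVec v) = cycleMap (cycleWeights b d) (sixMap v) := by
  rw [mem_imageSubspace] at hv
  rw [alphaMatrix_mulVec]
  funext j
  obtain ⟨i, rfl⟩ : ∃ i, i + 1 = j := ⟨j - 1, by simp⟩
  rw [cycleMap_apply]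
  fin_cases i
  · change b * v 0 + d * v 6 = 2 * b * v 0
    linear_combination -hv
  · exact (one_mul _).symm
  · rfl
  · rfl
  · exact (one_mul _).symm
  · rfl

theorem cycleMap_mem_map (hV : ∀ v ∈ V, (alphaMatrix b d).mulVec v ∈ V)
    (hVi : V ≤ imageSubspace b d) :
    ∀ x ∈ V.map sixMap, cycleMap (cycleWeights b d) x ∈ V.map sixMap := by
  rintro _ ⟨v, hv, rfl⟩
  rw [← sixMap_mulVec (hVi hv)]
  exact ⟨_, hV v hv, rfl⟩

theorem eq_zero_of_sixMap_eq_zero (hd : d ≠ 0) {v : Fin 7 → ℂ} (hv : v ∈ imageSubspace b d)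
    (h : sixMap v = 0) : v = 0 := by
  have hj : ∀ j : Fin 6, v j.castSucc = 0 := fun j => congrFun h j
  rw [mem_imageSubspace, show v 0 = 0 from hj 0, mul_zero] at hv
  funext j
  refine Fin.lastCases ?_ hj j
  exact (mul_eq_zero.1 hv.symm).resolve_left hd

theorem finrank_map_sixMap (hd : d ≠ 0) (hVi : V ≤ imageSubspace b d) :
    Module.finrank ℂ (V.map sixMap) = Module.finrank ℂ V := by
  rw [← LinearMap.range_domRestrict]
  refine LinearMap.finrank_range_of_inj ?_
  rw [← LinearMap.ker_eq_bot, LinearMap.ker_eq_bot']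
  exact fun v hv => Subtype.ext (eq_zero_of_sixMap_eq_zero hd (hVi v.2) hv)

/-- The inclusion of the indices of `ℂ⁶` into those of `ℂ⁷` with `0 ↦ 6`; on the image of the Higgs
field the coordinates `0` and `6` are proportional. -/
def sixIndex (j : Fin 6) : Fin 7 :=
  if j = 0 then 6 else j.castSucc

theorem sixIndex_injective : Function.Injective sixIndex := by decide

theorem IsPivot.image_castSucc (hd : d ≠ 0) (hVi : V ≤ imageSubspace b d) {J : Finset (Fin 6)}
    (hJ : IsPivot (V.map sixMap) J) : IsPivot V (J.image Fin.castSucc) := by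
  refine ⟨?_, fun v hv h => ?_⟩
  · rw [Finset.card_image_of_injective _ (Fin.castSucc_injective 6), hJ.1,
      finrank_map_sixMap hd hVi]
  · exact eq_zero_of_sixMap_eq_zero hd (hVi hv) (hJ.2 _ ⟨v, hv, rfl⟩ fun j hj =>
      h _ (Finset.mem_image_of_mem _ hj))

theorem IsPivot.image_sixIndex (hb : b ≠ 0) (hd : d ≠ 0) (hVi : V ≤ imageSubspace b d)
    {J : Finset (Fin 6)} (hJ : IsPivot (V.map sixMap) J) : IsPivot V (J.image sixIndex) := by
  refine ⟨?_, fun v hv h => ?_⟩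
  · rw [Finset.card_image_of_injective _ sixIndex_injective, hJ.1, finrank_map_sixMap hd hVi]
  · refine eq_zero_of_sixMap_eq_zero hd (hVi hv) (hJ.2 _ ⟨v, hv, rfl⟩ fun j hj => ?_)
    have h1 := h _ (Finset.mem_image_of_mem _ hj)
    by_cases hj0 : j = 0
    · subst hj0
      have h2 := mem_imageSubspace.1 (hVi hv)
      rw [show v 6 = 0 from h1, mul_zero] at h2
      exact (mul_eq_zero.1 h2).resolve_left hb
    · rwa [sixIndex, if_neg hj0] at h1

/-- A pivot set of `V ∩ im Φ` together with one of the indices `0`, `6` is a pivot set of `V`, if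
`V` contains `ker Φ`. -/
theorem IsPivot.insert_image_castSucc (hb : b ≠ 0) (hd : d ≠ 0) (hn : kerVec b d ∈ V)
    {J : Finset (Fin 6)} (hJ : IsPivot ((V ⊓ imageSubspace b d).map sixMap) J) {i : Fin 7}
    (hi : i = 0 ∧ 0 ∉ J ∨ i = 6) : IsPivot V (insert i (J.image Fin.castSucc)) := by
  have hker : kerVec b d ∉ imageSubspace b d := by
    rw [mem_imageSubspace]
    change ¬ (b * d = d * -b)
    intro h
    exact mul_ne_zero (mul_ne_zero two_ne_zero hb) hd (by linear_combination h)
  have hdec : ∀ v : Fin 7 → ℂ,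
      v - ((b * v 0 - d * v 6) / (2 * b * d)) • kerVec b d ∈ imageSubspace b d := by
    intro v
    rw [mem_imageSubspace]
    simp only [kerVec, Pi.sub_apply, Pi.smul_apply, smul_eq_mul, Matrix.cons_val]
    field_simp
    ring
  have hrank : Module.finrank ℂ V = Module.finrank ℂ ↥(V ⊓ imageSubspace b d) + 1 := by
    have h1 := Submodule.finrank_sup_add_finrank_inf_eq (V ⊓ imageSubspace b d)
      (Submodule.span ℂ {kerVec b d})
    have h2 : (V ⊓ imageSubspace b d) ⊓ Submodule.span ℂ {kerVec b d} = ⊥ := by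
      rw [eq_bot_iff]
      rintro v ⟨⟨-, hv⟩, hv'⟩
      obtain ⟨c, rfl⟩ := Submodule.mem_span_singleton.1 hv'
      by_cases hc : c = 0
      · simp [hc]
      · exact absurd (((imageSubspace b d).smul_mem_iff hc).1 hv) hker
    have h3 : (V ⊓ imageSubspace b d) ⊔ Submodule.span ℂ {kerVec b d} = V := by
      refine le_antisymm (sup_le inf_le_left ((Submodule.span_singleton_le_iff_mem _ _).2 hn))
        fun v hv => ?_
      rw [← sub_add_cancel v (((b * v 0 - d * v 6) / (2 * b * d)) • kerVec b d)]
      exact Submodule.add_mem_sup ⟨V.sub_mem hv (V.smul_mem _ hn), hdec v⟩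
        (Submodule.smul_mem _ _ (Submodule.mem_span_singleton_self _))
    have h4 : kerVec b d ≠ 0 := fun h => hker (h ▸ Submodule.zero_mem _)
    rw [h2, h3, finrank_bot, finrank_span_singleton h4] at h1
    omega
  have hi' : i ∉ J.image Fin.castSucc := by
    intro h
    obtain ⟨j, hj, hji⟩ := Finset.mem_image.1 h
    rcases hi with ⟨rfl, h0⟩ | rfl
    · rw [show j = 0 from Fin.castSucc_injective 6 hji] at hj
      exact h0 hj
    · exact absurd hji (Fin.castSucc_lt_last j).ne
  refine ⟨?_, fun v hv h => ?_⟩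
  · rw [Finset.card_insert_of_notMem hi', Finset.card_image_of_injective _
      (Fin.castSucc_injective 6), hJ.1, finrank_map_sixMap hd inf_le_right, hrank]
  have hvi := h i (Finset.mem_insert_self _ _)
  have hvJ : ∀ j ∈ J, v j.castSucc = 0 := fun j hj =>
    h _ (Finset.mem_insert_of_mem (Finset.mem_image_of_mem _ hj))
  -- the component of `v` in the image vanishes at the indices in `J`
  set z := (b * v 0 - d * v 6) / (2 * b * d) with hz
  have hw : v - z • kerVec b d ∈ V ⊓ imageSubspace b d :=
    ⟨V.sub_mem hv (V.smul_mem _ hn), hdec v⟩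
  have hkj : ∀ j : Fin 6, j ≠ 0 → kerVec b d j.castSucc = 0 := by
    intro j hj
    fin_cases j
    · exact absurd rfl hj
    all_goals rfl
  have hw0 : v - z • kerVec b d = 0 := by
    refine eq_zero_of_sixMap_eq_zero hd hw.2 (hJ.2 _ ⟨_, hw, rfl⟩ fun j hj => ?_)
    change v j.castSucc - z * kerVec b d j.castSucc = 0
    by_cases hj0 : j = 0
    · subst hj0
      rcases hi with ⟨-, h0⟩ | rfl
      · exact absurd hj h0
      · have : z = 0 := by rw [hz, show v 0 = 0 from hvJ 0 hj, hvi]; simp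
        rw [hvJ _ hj, this]
        ring
    · rw [hvJ _ hj, hkj j hj0]
      ring
  rw [sub_eq_zero] at hw0
  have hz0 : z = 0 := by
    rcases hi with ⟨rfl, -⟩ | rfl
    · rw [hw0] at hvi
      exact (mul_eq_zero.1 hvi).resolve_right hd
    · rw [hw0] at hvi
      exact (mul_eq_zero.1 hvi).resolve_right (neg_ne_zero.2 hb)
  rw [hw0, hz0, zero_smul]

theorem sum_image_castSucc (t k : ℤ) (J : Finset (Fin 6)) :
    ∑ j ∈ J.image Fin.castSucc, lineDeg t k j = ∑ j ∈ J, lineDeg t k j.castSucc :=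
  Finset.sum_image fun _ _ _ _ h => Fin.castSucc_injective 6 h

theorem sum_image_sixIndex (t k : ℤ) (J : Finset (Fin 6)) :
    ∑ j ∈ J.image sixIndex, lineDeg t k j = ∑ j ∈ J, lineDeg t k (sixIndex j) :=
  Finset.sum_image fun _ _ _ _ h => sixIndex_injective h

theorem lineDeg_eq (t k : ℤ) : lineDeg t k 0 = 2 * t + k ∧ lineDeg t k 1 = t + k ∧
    lineDeg t k 2 = t ∧ lineDeg t k 3 = 0 ∧ lineDeg t k 4 = -t ∧ lineDeg t k 5 = -t - k ∧
    lineDeg t k 6 = -(2 * t) - k := by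
  simp only [lineDeg, expT, expK, Matrix.cons_val]
  refine ⟨?_, ?_, ?_, ?_, ?_, ?_, ?_⟩ <;> ring

theorem sum_castSucc (t k : ℤ) : ∑ j : Fin 6, lineDeg t k j.castSucc = 2 * t + k := by
  obtain ⟨h0, h1, h2, h3, h4, h5, -⟩ := lineDeg_eq t k
  rw [Fin.sum_univ_six]
  change lineDeg t k 0 + lineDeg t k 1 + lineDeg t k 2 + lineDeg t k 3 + lineDeg t k 4 +
    lineDeg t k 5 = _
  rw [h0, h1, h2, h3, h4, h5]
  ring

theorem sum_sixIndex (t k : ℤ) : ∑ j : Fin 6, lineDeg t k (sixIndex j) = -(2 * t) - k := by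
  obtain ⟨-, h1, h2, h3, h4, h5, h6⟩ := lineDeg_eq t k
  rw [Fin.sum_univ_six]
  change lineDeg t k 6 + lineDeg t k 1 + lineDeg t k 2 + lineDeg t k 3 + lineDeg t k 4 +
    lineDeg t k 5 = _
  rw [h1, h2, h3, h4, h5, h6]
  ring

end Matrix

/-! ### Pivot sets of invariant subspaces -/

section InvariantSubspaces

variable {b d : ℂ} {V : Submodule ℂ (Fin 7 → ℂ)}

theorem map_sixMap_ne_bot (hd : d ≠ 0) (hVi : V ≤ imageSubspace b d) (h0 : V ≠ ⊥) :
    V.map sixMap ≠ ⊥ := by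
  intro h
  rw [← Submodule.finrank_eq_zero, finrank_map_sixMap hd hVi, Submodule.finrank_eq_zero] at h
  exact h0 h

theorem IsPivot.nonempty {n : ℕ} {U : Submodule ℂ (Fin n → ℂ)} {J : Finset (Fin n)}
    (hJ : IsPivot U J) (h0 : U ≠ ⊥) : J.Nonempty := by
  rw [← Finset.card_pos, hJ.1]
  exact Nat.pos_of_ne_zero fun h => h0 (Submodule.finrank_eq_zero.1 h)

/-- **Pivot sets of negative degree.** For `β, δ ≠ 0`, every proper nonzero invariant subspace has a
pivot set of negative degree, except possibly if `T²K` has degree zero; a subspace without one then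
has two pivot sets of degree zero that differ by exchanging the indices `0` and `6`. -/
theorem exists_isPivot_neg_or (t k : ℤ) (hb : b ≠ 0) (hd : d ≠ 0)
    (hV : ∀ v ∈ V, (alphaMatrix b d).mulVec v ∈ V) (h0 : V ≠ ⊥) (h1 : V ≠ ⊤) :
    (∃ J, IsPivot V J ∧ ∑ j ∈ J, lineDeg t k j < 0) ∨
      (2 * t + k = 0 ∧ ∃ I : Finset (Fin 7), 0 ∉ I ∧ 6 ∉ I ∧
        IsPivot V (insert 0 I) ∧ IsPivot V (insert 6 I) ∧
        ∑ j ∈ insert 0 I, lineDeg t k j = 0 ∧ ∑ j ∈ insert 6 I, lineDeg t k j = 0) := by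
  obtain ⟨l0, -, -, -, -, -, l6⟩ := lineDeg_eq t k
  have ha := cycleWeights_ne_zero hb hd
  have h06 : ∀ J : Finset (Fin 6), (0 : Fin 7) ∉ (J.erase 0).image Fin.castSucc ∧
      (6 : Fin 7) ∉ J.image Fin.castSucc := by
    intro J
    constructor
    · intro h
      obtain ⟨j, hj, hj0⟩ := Finset.mem_image.1 h
      exact (Finset.mem_erase.1 hj).1 (Fin.castSucc_injective 6 hj0)
    · intro h
      obtain ⟨j, hj, hj0⟩ := Finset.mem_image.1 h
      exact absurd hj0 (Fin.castSucc_lt_last j).ne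
  rcases (kerVec_mem_or_le_imageSubspace hb hV).symm with hVi | hn
  · -- `V` is contained in the image
    have hU := cycleMap_mem_map hV hVi
    obtain ⟨J, hJ⟩ := exists_isPivot (V.map sixMap)
    have hJ0 := hJ.nonempty (map_sixMap_ne_bot hd hVi h0)
    have hcard : (0 : ℤ) < J.card := by exact_mod_cast hJ0.card_pos
    by_cases hneg : 2 * t + k < 0
    · rcases exists_rotate_neg_or J 0 (fun j => lineDeg t k j.castSucc)
        (by rw [sum_castSucc]; nlinarith) with ⟨s, hs⟩ | ⟨hs, -⟩
      · refine Or.inl ⟨_, (hJ.rotate ha hU s).image_castSucc hd hVi, ?_⟩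
        rw [sum_image_castSucc]
        omega
      · rw [sum_castSucc] at hs
        nlinarith
    rcases exists_rotate_neg_or J 0 (fun j => lineDeg t k (sixIndex j))
        (by rw [sum_sixIndex]; nlinarith) with ⟨s, hs⟩ | ⟨hs, hall⟩
    · refine Or.inl ⟨_, (hJ.rotate ha hU s).image_sixIndex hb hd hVi, ?_⟩
      rw [sum_image_sixIndex]
      omega
    right
    rw [sum_sixIndex] at hs
    have ht : 2 * t + k = 0 := by
      rcases mul_eq_zero.1 (show (J.card : ℤ) * (-(2 * t) - k) = 0 by omega) with h | h <;> omega
    obtain ⟨j, hj⟩ := hJ0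
    have hJs := hJ.rotate ha hU (-j)
    set J' := J.image (· + -j) with hJ'
    have h0J : (0 : Fin 6) ∈ J' := Finset.mem_image.2 ⟨j, hj, add_neg_cancel j⟩
    have e6 : insert 6 ((J'.erase 0).image Fin.castSucc) = J'.image sixIndex := by
      conv_rhs => rw [← Finset.insert_erase h0J, Finset.image_insert]
      congr 1
      exact Finset.image_congr fun i hi => by
        rw [sixIndex, if_neg (Finset.mem_erase.1 (Finset.mem_coe.1 hi)).1]
    have e0 : insert 0 ((J'.erase 0).image Fin.castSucc) = J'.image Fin.castSucc := by
      conv_rhs => rw [← Finset.insert_erase h0J, Finset.image_insert]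
      rfl
    have hs6 : ∑ j ∈ insert 6 ((J'.erase 0).image Fin.castSucc), lineDeg t k j = 0 := by
      rw [e6, sum_image_sixIndex, ← zero_add (∑ j ∈ J', _)]
      exact hall (-j)
    have h6' : (6 : Fin 7) ∉ (J'.erase 0).image Fin.castSucc := (h06 (J'.erase 0)).2
    refine ⟨ht, (J'.erase 0).image Fin.castSucc, (h06 J').1, h6', ?_, ?_, ?_, hs6⟩
    · rw [e0]
      exact hJs.image_castSucc hd hVi
    · rw [e6]
      exact hJs.image_sixIndex hb hd hVi
    · rw [Finset.sum_insert h6'] at hs6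
      rw [Finset.sum_insert (h06 J').1]
      omega
  · -- `V` contains the kernel
    have hVi : V ⊓ imageSubspace b d ≤ imageSubspace b d := inf_le_right
    have hV' : ∀ v ∈ V ⊓ imageSubspace b d,
        (alphaMatrix b d).mulVec v ∈ V ⊓ imageSubspace b d :=
      fun v hv => ⟨hV v hv.1, mulVec_mem_imageSubspace b d v⟩
    have hU := cycleMap_mem_map hV' hVi
    obtain ⟨J, hJ⟩ := exists_isPivot ((V ⊓ imageSubspace b d).map sixMap)
    have hJu : J ≠ Finset.univ := by
      rintro rfl
      have h2 := hJ.insert_image_castSucc hb hd hn (i := 6) (Or.inr rfl)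
      refine h1 (Submodule.eq_top_of_finrank_eq ?_)
      rw [← h2.1, Module.finrank_fin_fun, Finset.card_insert_of_notMem (h06 _).2,
        Finset.card_image_of_injective _ (Fin.castSucc_injective 6)]
      simp
    have hcard : (J.card : ℤ) < 6 := by
      have := (Finset.card_lt_iff_ne_univ J).2 hJu
      rw [Fintype.card_fin] at this
      exact_mod_cast this
    -- if both `0` and `6` are pivots, then their degrees cancel
    have hsix : ∀ J' : Finset (Fin 6), 0 ∈ J' →
        ∑ j ∈ insert 6 (J'.image Fin.castSucc), lineDeg t k j =
          ∑ j ∈ J'.erase 0, lineDeg t k j.castSucc := by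
      intro J' hJ'
      rw [Finset.sum_insert (h06 J').2, sum_image_castSucc,
        ← Finset.add_sum_erase J' _ hJ']
      change lineDeg t k 6 + (lineDeg t k 0 + _) = _
      rw [l0, l6]
      ring
    -- a rotation `J'` gives the pivot set `{6} ∪ J'` if it contains `0`, and `{i} ∪ J'` otherwise;
    -- in either case its degree is the weight of `J'` for the weights in which `-d_i` replaces `d₀`
    have hval : ∀ (i : Fin 7) (J' : Finset (Fin 6)), (i = 0 ∨ i = 6) →
        lineDeg t k i + ∑ j ∈ J', (if j = 0 then - lineDeg t k i else lineDeg t k j.castSucc) =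
          ∑ j ∈ insert (if 0 ∈ J' then 6 else i) (J'.image Fin.castSucc), lineDeg t k j := by
      intro i J' hi
      by_cases hJ' : 0 ∈ J'
      · rw [if_pos hJ', hsix J' hJ', ← Finset.add_sum_erase J' _ hJ', if_pos rfl,
          add_neg_cancel_left]
        exact Finset.sum_congr rfl fun j hj => if_neg (Finset.mem_erase.1 hj).1
      · rw [if_neg hJ', Finset.sum_insert, sum_image_castSucc]
        · congr 1
          exact Finset.sum_congr rfl fun j hj => if_neg fun h : j = 0 => hJ' (h ▸ hj)
        · rcases hi with rfl | rfl
          · rw [← Finset.erase_eq_of_notMem hJ']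
            exact (h06 J').1
          · exact (h06 J').2
    have hpiv : ∀ (i : Fin 7) (J' : Finset (Fin 6)), (i = 0 ∨ i = 6) →
        IsPivot ((V ⊓ imageSubspace b d).map sixMap) J' →
        IsPivot V (insert (if 0 ∈ J' then 6 else i) (J'.image Fin.castSucc)) := by
      intro i J' hi hJ'
      refine hJ'.insert_image_castSucc hb hd hn ?_
      by_cases h0J : 0 ∈ J'
      · rw [if_pos h0J]
        exact Or.inr rfl
      · rw [if_neg h0J]
        exact hi.imp (fun h => ⟨h, h0J⟩) id
    have hw : ∀ i : Fin 7, ∑ j : Fin 6, (if j = 0 then - lineDeg t k i else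
        lineDeg t k j.castSucc) = - lineDeg t k i := by
      intro i
      have h2 := sum_castSucc t k
      rw [Fin.sum_univ_succ] at h2 ⊢
      rw [show lineDeg t k (Fin.castSucc 0) = 2 * t + k from l0] at h2
      rw [if_pos rfl, Finset.sum_congr rfl fun j _ => if_neg (Fin.succ_ne_zero j)]
      omega
    have main : ∀ i : Fin 7, (i = 0 ∨ i = 6) → lineDeg t k i ≤ 0 →
        (∃ J, IsPivot V J ∧ ∑ j ∈ J, lineDeg t k j < 0) ∨ (lineDeg t k i = 0 ∧ ∀ s,
          ∑ j ∈ insert (if 0 ∈ J.image (· + s) then 6 else i)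
            ((J.image (· + s)).image Fin.castSucc), lineDeg t k j = 0) := by
      intro i hi hle
      rcases exists_rotate_neg_or J (lineDeg t k i) (fun j => if j = 0 then - lineDeg t k i else
        lineDeg t k j.castSucc) (by rw [hw]; nlinarith) with ⟨s, hs⟩ | ⟨hs, hall⟩
      · refine Or.inl ⟨_, hpiv i _ hi (hJ.rotate ha hU s), ?_⟩
        rwa [← hval i _ hi]
      · right
        rw [hw] at hs
        constructor
        · by_contra hne
          have : lineDeg t k i < 0 := lt_of_le_of_ne hle hne
          nlinarith
        · intro s
          rw [← hval i _ hi]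
          exact hall s
    by_cases hneg : 2 * t + k < 0
    · rcases main 0 (Or.inl rfl) (by omega) with h | ⟨h, -⟩
      · exact Or.inl h
      · omega
    rcases main 6 (Or.inr rfl) (by omega) with h | ⟨h, hall⟩
    · exact Or.inl h
    right
    obtain ⟨j, hj⟩ : ∃ j, j ∉ J := by
      by_contra h
      push Not at h
      exact hJu (Finset.eq_univ_of_forall h)
    have hJs := hJ.rotate ha hU (-j)
    have hs6 := hall (-j)
    set J' := J.image (· + -j) with hJ'
    have h0J : (0 : Fin 6) ∉ J' := by
      intro h
      obtain ⟨i, hi, hij⟩ := Finset.mem_image.1 h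
      rw [add_neg_eq_zero.1 hij] at hi
      exact hj hi
    rw [if_neg h0J] at hs6
    have h0' : (0 : Fin 7) ∉ J'.image Fin.castSucc := by
      have := (h06 J').1
      rwa [Finset.erase_eq_of_notMem h0J] at this
    refine ⟨by omega, J'.image Fin.castSucc, h0', (h06 J').2,
      hJs.insert_image_castSucc hb hd hn (Or.inl ⟨rfl, h0J⟩),
      hJs.insert_image_castSucc hb hd hn (Or.inr rfl), ?_, hs6⟩
    rw [Finset.sum_insert (h06 J').2] at hs6
    rw [Finset.sum_insert h0']
    omega

/-- A vector of an invariant subspace `V` whose coordinates in `I` vanish has coordinates `0` and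
`6` in the ratio `±δ : β`, if `I ∪ {0}` is a pivot set of `V`: it lies in the image, or is a
multiple of the generator of the kernel. -/
theorem sq_eq_sq_of_isPivot (hb : b ≠ 0) (hd : d ≠ 0)
    (hV : ∀ v ∈ V, (alphaMatrix b d).mulVec v ∈ V) {I : Finset (Fin 7)} (h0 : 0 ∉ I) (h6 : 6 ∉ I)
    (hI : IsPivot V (insert 0 I)) {v : Fin 7 → ℂ} (hv : v ∈ V) (hvI : ∀ i ∈ I, v i = 0) :
    (b * v 0) ^ 2 = (d * v 6) ^ 2 := by
  rcases kerVec_mem_or_le_imageSubspace hb hV with hn | hVi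
  · have hk : ∀ i : Fin 7, i ≠ 0 → i ≠ 6 → kerVec b d i = 0 := by
      intro i hi0 hi6
      fin_cases i
      · exact absurd rfl hi0
      · rfl
      · rfl
      · rfl
      · rfl
      · rfl
      · exact absurd rfl hi6
    have hw : v - (v 0 / d) • kerVec b d = 0 := by
      refine hI.2 _ (V.sub_mem hv (V.smul_mem _ hn)) fun j hj => ?_
      rw [Finset.mem_insert] at hj
      change v j - v 0 / d * kerVec b d j = 0
      rcases hj with rfl | hj
      · rw [show kerVec b d 0 = d from rfl, div_mul_cancel₀ _ hd, sub_self]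
      · rw [hvI j hj, hk j (fun h => h0 (h ▸ hj)) (fun h => h6 (h ▸ hj)), mul_zero, sub_zero]
    have h66 : v 6 - v 0 / d * (-b) = 0 := congrFun hw 6
    have : d * v 6 = -(b * v 0) := by
      field_simp at h66
      linear_combination h66
    rw [this, neg_sq]
  · rw [mem_imageSubspace.1 (hVi hv)]

theorem finrank_imageSubspace_le (hd : d ≠ 0) : Module.finrank ℂ (imageSubspace b d) ≤ 6 := by
  rw [← finrank_map_sixMap hd le_rfl]
  exact (Submodule.finrank_le _).trans (Module.finrank_fin_fun ℂ).le

/-- If `deg T²K = 0`, an invariant subspace of the image all of whose pivot sets have nonnegative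
degree is three-dimensional, with pivot sets `{0, 2, 4}` and `{1, 3, 5}`. -/
theorem isPivot_of_forall_nonneg {t k : ℤ} (htk : 2 * t + k = 0) (hk : 0 < k) (hb : b ≠ 0)
    (hd : d ≠ 0) (hV : ∀ v ∈ V, (alphaMatrix b d).mulVec v ∈ V) (hVi : V ≤ imageSubspace b d)
    (h0 : V ≠ ⊥) (h1 : V ≠ imageSubspace b d)
    (h : ∀ J, IsPivot V J → 0 ≤ ∑ j ∈ J, lineDeg t k j) :
    IsPivot V {0, 2, 4} ∧ IsPivot V {1, 3, 5} := by
  have hU := cycleMap_mem_map hV hVi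
  have h1' : V.map sixMap ≠ ⊤ := by
    intro htop
    refine h1 (Submodule.eq_of_le_of_finrank_le hVi ?_)
    rw [← finrank_map_sixMap hd hVi, htop, finrank_top, Module.finrank_fin_fun]
    exact finrank_imageSubspace_le hd
  have hw : ∀ j : Fin 6, lineDeg t k j.castSucc =
      -t * (![0, 1, -1, 0, 1, -1] : Fin 6 → ℤ) j := by
    obtain ⟨l0, l1, l2, l3, l4, l5, -⟩ := lineDeg_eq t k
    intro j
    fin_cases j
    · change lineDeg t k 0 = -t * 0; omega
    · change lineDeg t k 1 = -t * 1; omega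
    · change lineDeg t k 2 = -t * -1; omega
    · change lineDeg t k 3 = -t * 0; omega
    · change lineDeg t k 4 = -t * 1; omega
    · change lineDeg t k 5 = -t * -1; omega
  have hU' := isPivot_even_odd (cycleWeights_ne_zero hb hd) hU (map_sixMap_ne_bot hd hVi h0) h1'
    fun J hJ => by
      have h2 := h _ (hJ.image_castSucc hd hVi)
      rw [sum_image_castSucc, Finset.sum_congr rfl fun j _ => hw j, ← Finset.mul_sum] at h2
      by_contra hneg
      push Not at hneg
      nlinarith
  exact ⟨hU'.1.image_castSucc hd hVi, hU'.2.image_castSucc hd hVi⟩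

end InvariantSubspaces

/-! ### Subspaces invariant under a weighted shift -/

section Shift

variable {n : ℕ}

theorem finrank_le_card_of_injective {V : Submodule ℂ (Fin n → ℂ)} {I : Finset (Fin n)}
    (h : ∀ v ∈ V, (∀ j ∈ I, v j = 0) → v = 0) : Module.finrank ℂ V ≤ I.card := by
  set f : V →ₗ[ℂ] (I → ℂ) := (LinearMap.funLeft ℂ ℂ fun i : I => (i : Fin n)).comp V.subtype
  have hf : Function.Injective f := by
    rw [← LinearMap.ker_eq_bot, LinearMap.ker_eq_bot']
    intro v hv
    exact Subtype.ext (h v v.2 fun j hj => congrFun hv ⟨j, hj⟩)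
  have := LinearMap.finrank_le_finrank_of_injective hf
  rwa [Module.finrank_fintype_fun_eq_card, Fintype.card_coe] at this

/-- A nonzero subspace invariant under a weighted shift `e_j ↦ a_j e_{j+1}`, `a_j ≠ 0`, is one of
the spans of `e_j, e_{j+1}, …`; here only its pivot set is recorded. -/
theorem exists_isPivot_Ici {f : (Fin n → ℂ) → Fin n → ℂ} {a : Fin n → ℂ} (ha : ∀ i, a i ≠ 0)
    (hf0 : ∀ x (i : Fin n), (i : ℕ) = 0 → f x i = 0)
    (hf : ∀ x (i j : Fin n), (j : ℕ) = i + 1 → f x j = a i * x i) {U : Submodule ℂ (Fin n → ℂ)}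
    (hU : ∀ x ∈ U, f x ∈ U) (h0 : U ≠ ⊥) : ∃ j : Fin n, IsPivot U (Finset.Ici j) := by
  obtain ⟨j, ⟨x, hx, hxj⟩, hmin⟩ : ∃ j, (∃ x ∈ U, x j ≠ 0) ∧
      ∀ i < j, ∀ y ∈ U, y i = 0 := by
    obtain ⟨j, hj, hmin⟩ := exists_minimal_of_wellFoundedLT (fun j : Fin n => ∃ x ∈ U, x j ≠ 0) (by
      obtain ⟨x, hx, hx0⟩ := Submodule.exists_mem_ne_zero_of_ne_bot h0
      obtain ⟨j, hj⟩ := Function.ne_iff.1 hx0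
      exact ⟨j, x, hx, hj⟩)
    refine ⟨j, hj, fun i hi y hy => ?_⟩
    by_contra hyi
    exact absurd (hmin ⟨y, hy, hyi⟩ hi.le) (not_le.2 hi)
  have hit : ∀ m : ℕ, f^[m] x ∈ U ∧ (∀ i : Fin n, (i : ℕ) < j + m → (f^[m] x) i = 0) ∧
      ∀ i : Fin n, (i : ℕ) = j + m → (f^[m] x) i ≠ 0 := by
    intro m
    induction m with
    | zero =>
      refine ⟨hx, fun i hi => hmin i (by simpa using hi) x hx, fun i hi => ?_⟩
      rw [show i = j from Fin.ext (by simpa using hi)]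
      exact hxj
    | succ m ih =>
      rw [Function.iterate_succ_apply']
      refine ⟨hU _ ih.1, fun i hi => ?_, fun i hi => ?_⟩
      · rcases Nat.eq_zero_or_pos (i : ℕ) with h | h
        · exact hf0 _ i h
        · rw [hf _ ⟨i - 1, by omega⟩ i (by simp; omega), ih.2.1 _ (by simp; omega), mul_zero]
      · rw [hf _ ⟨i - 1, by omega⟩ i (by simp; omega)]
        exact mul_ne_zero (ha _) (ih.2.2 _ (by simp; omega))
  have hinj : ∀ v ∈ U, (∀ i ∈ Finset.Ici j, v i = 0) → v = 0 := by
    intro v hv h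
    funext i
    by_cases hij : i < j
    · exact hmin i hij v hv
    · exact h i (Finset.mem_Ici.2 (not_lt.1 hij))
  obtain ⟨J, hJ, hpJ⟩ := exists_isPivot_of_linearIndepOn U (Finset.Ici j) fun c hc => by
    have hstep : ∀ m : ℕ, ∀ i : Fin n, (i : ℕ) + m + 1 = n → j ≤ i → c i = 0 := by
      intro m
      induction m using Nat.strong_induction_on with
      | _ m ih =>
        intro i hi hji
        have h1 := hc _ (hit ((i : ℕ) - j)).1
        have hji' : (j : ℕ) ≤ i := hji
        rw [Finset.sum_eq_single i] at h1
        · exact (mul_eq_zero.1 h1).resolve_right ((hit ((i : ℕ) - j)).2.2 i (by omega))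
        · intro l hl hli
          have hjl : j ≤ l := Finset.mem_Ici.1 hl
          have hl' : (j : ℕ) ≤ l := hjl
          rcases lt_or_gt_of_ne (fun h => hli (Fin.ext h) : (l : ℕ) ≠ i) with h | h
          · rw [(hit ((i : ℕ) - j)).2.1 l (by omega), mul_zero]
          · rw [ih (n - 1 - l) (by omega) l (by omega) hjl, zero_mul]
        · intro h
          exact absurd (Finset.mem_Ici.2 hji) h
    exact fun i hi => hstep (n - 1 - i) i (by omega) (Finset.mem_Ici.1 hi)
  refine ⟨j, le_antisymm ?_ (finrank_le_card_of_injective hinj), hinj⟩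
  rw [← hpJ.1]
  exact Finset.card_le_card hJ

end Shift

/-! ### Stability of chains of line bundles -/

section Stability

open Filter

variable {X : Type u} [TopologicalSpace X] [ChartedSpace ℂ X] [IsManifold 𝓘(ℂ) ω X]
variable {T : X → Type v} [∀ x, AddCommGroup (T x)] [∀ x, Module ℂ (T x)]
  [TopologicalSpace (TotalSpace ℂ T)] [∀ x, TopologicalSpace (T x)] [FiberBundle ℂ T]
  [VectorBundle ℂ ℂ T] [ContMDiffVectorBundle ω ℂ T 𝓘(ℂ)]
variable {β : HolSection T (-1) 1} {δ : HolSection T 3 3}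

/-- The Higgs field at `x`, in the preferred trivializations at `x`. -/
def higgsAt (β : HolSection T (-1) 1) (δ : HolSection T 3 3) (x : X) : Matrix (Fin 7) (Fin 7) ℂ :=
  alphaMatrix (fiberCoord β x) (fiberCoord δ x)

theorem tangentCoord_surjective (x : X) : Function.Surjective (tangentCoord x) := by
  intro z
  have hx := FiberBundle.mem_baseSet_trivializationAt' (F := ℂ)
    (E := fun x : X => TangentSpace 𝓘(ℂ) x) x
  refine ⟨(trivializationAt ℂ (fun x : X => TangentSpace 𝓘(ℂ) x) x).symm x z, ?_⟩
  have h := Trivialization.continuousLinearMapAt_apply_of_mem ℂ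
    (trivializationAt ℂ (fun x : X => TangentSpace 𝓘(ℂ) x) x) hx
    ((trivializationAt ℂ (fun x : X => TangentSpace 𝓘(ℂ) x) x).symm x z)
  rw [tangentCoord]
  refine h.trans ?_
  rw [Trivialization.apply_mk_symm _ hx]

theorem isHiggsSub_iff {W : ∀ x, Submodule ℂ ((alphaBundle T).Fiber x)} :
    IsHiggsSub (alphaHiggs β δ) W ↔ IsHolSubbundle (Fin 7 → ℂ) W ∧
      ∀ x, ∀ w : Fin 7 → ℂ, w ∈ W x → (higgsAt β δ x).mulVec w ∈ W x := by
  refine and_congr_right fun _ => forall_congr' fun x => ⟨fun h w hw => ?_, fun h v w hw => ?_⟩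
  · obtain ⟨v, hv⟩ := tangentCoord_surjective x 1
    have h' := h v w hw
    change tangentCoord x v • (higgsAt β δ x).mulVec w ∈ W x at h'
    rwa [hv, one_smul] at h'
  · exact (W x).smul_mem (tangentCoord x v) (h w hw)

section Rank

variable [PreconnectedSpace X] {n : ℕ} {a b : Fin n → ℤ}
  {W W' : ∀ x, Submodule ℂ ((twistSum T a b).Fiber x)}

theorem IsHolSubbundle.apply_ne (hW : IsHolSubbundle (Fin n → ℂ) W)
    (hW' : IsHolSubbundle (Fin n → ℂ) W') (hle : W' ≤ W) (hne : W' ≠ W) (x : X) :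
    W' x ≠ W x := by
  intro h
  have key : ∀ U U' : Submodule ℂ (Fin n → ℂ), U ≤ U' → Module.finrank ℂ U = Module.finrank ℂ U' →
      U = U' := fun U U' => Submodule.eq_of_le_of_finrank_eq
  exact hne (funext fun y => key _ _ (hle y)
    ((hW'.finrank_eq y x).trans (h ▸ hW.finrank_eq x y)))

theorem IsHolSubbundle.apply_ne_bot (hW : IsHolSubbundle (Fin n → ℂ) W) (hne : W ≠ ⊥) (x : X) :
    W x ≠ ⊥ := by
  intro h
  have key : ∀ U : Submodule ℂ (Fin n → ℂ), Module.finrank ℂ U = 0 → U = ⊥ :=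
    fun U => Submodule.finrank_eq_zero.1
  refine hne (funext fun y => key _ ((hW.finrank_eq y x).trans ?_))
  rw [h]
  exact finrank_bot ℂ (Fin n → ℂ)

end Rank

variable [T2Space X] [CompactSpace X] [ConnectedSpace X] {t k : ℤ}

/-- To bound the degree of a subbundle it suffices to find one pivot set in one fibre. -/
theorem isStableSub_of_exists_isPivot
    (hd : ∀ j, HasTwistDegree T (expT j) (expK j) (lineDeg t k j))
    {W : ∀ x, Submodule ℂ ((alphaBundle T).Fiber x)} (hW : IsHiggsSub (alphaHiggs β δ) W)
    (h0 : W ≠ ⊥) (hdeg : HasDegree (Fin 7 → ℂ) W 0)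
    (h : ∀ W', IsHiggsSub (alphaHiggs β δ) W' → W' ≤ W → W' ≠ ⊥ → W' ≠ W →
      ∃ x J, IsPivot (W' x) J ∧ ∑ j ∈ J, lineDeg t k j < 0) : IsStableSub (alphaHiggs β δ) W := by
  refine ⟨hW, h0, hdeg, fun W' hW' hle hne hne' => ?_⟩
  obtain ⟨x, J, hJ, hneg⟩ := h W' hW' hle hne hne'
  obtain ⟨e, he, hle, -⟩ := hW'.1.exists_degree_le hd hJ
  exact ⟨e, he, hle.trans_lt hneg⟩

theorem coordSubspace_ne_bot {n : ℕ} {S : Finset (Fin n)} (hS : S.Nonempty) :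
    coordSubspace S ≠ ⊥ := by
  intro h
  have := finrank_coordSubspace S
  rw [h, finrank_bot] at this
  exact hS.card_pos.ne this

/-- A sum of line bundles of total degree zero, each of which the Higgs field maps to the next one,
is stable if all its proper tails have negative degree: at a point where the maps are nonzero, the
tails are the only invariant subspaces. -/
theorem isStableSub_coordSubspace
    (hd : ∀ j, HasTwistDegree T (expT j) (expK j) (lineDeg t k j)) {n : ℕ} {c : Fin (n + 1) → Fin 7}
    (hc : Function.Injective c) {S : Finset (Fin 7)} (hS : Finset.univ.image c = S)
    (hinv : ∀ x, ∀ v ∈ coordSubspace S,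
      (higgsAt β δ x).mulVec v ∈ coordSubspace S)
    {x₀ : X} {a : Fin (n + 1) → ℂ} (ha : ∀ i, a i ≠ 0)
    (h0 : ∀ v ∈ coordSubspace S, (higgsAt β δ x₀).mulVec v (c 0) = 0)
    (hs : ∀ v ∈ coordSubspace S, ∀ i : Fin n,
      (higgsAt β δ x₀).mulVec v (c i.succ) = a i.castSucc * v (c i.castSucc))
    (hsum : ∑ i, lineDeg t k (c i) = 0)
    (htail : ∀ j, j ≠ 0 → ∑ i ∈ Finset.Ici j, lineDeg t k (c i) < 0) :
    IsStableSub (alphaHiggs β δ) fun _ => coordSubspace S := by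
  subst hS
  have hsumc : ∀ J : Finset (Fin (n + 1)), ∑ j ∈ J.image c, lineDeg t k j =
      ∑ i ∈ J, lineDeg t k (c i) := fun J => Finset.sum_image fun _ _ _ _ h => hc h
  have hhol := isHolSubbundle_coordSubspace (T := T) (a := expT) (b := expK) (Finset.univ.image c)
  refine isStableSub_of_exists_isPivot hd (isHiggsSub_iff.2 ⟨hhol, hinv⟩) ?_ ?_ ?_
  · intro h
    exact coordSubspace_ne_bot (Finset.univ_nonempty.image c) (congrFun h x₀)
  · have := hasDegree_of_forall_isPivot hd hhol fun _ => isPivot_coordSubspace _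
    rwa [hsumc, hsum] at this
  intro W' hW' hle hne hne'
  rw [isHiggsSub_iff] at hW'
  set V : Submodule ℂ (Fin 7 → ℂ) := W' x₀ with hV
  have hVle : V ≤ coordSubspace (Finset.univ.image c) := hle x₀
  have hV0 : V ≠ ⊥ := hW'.1.apply_ne_bot hne x₀
  have hV1 : V ≠ coordSubspace (Finset.univ.image c) := hhol.apply_ne hW'.1 hle hne' x₀
  have hinj : ∀ v ∈ V, LinearMap.funLeft ℂ ℂ c v = 0 → v = 0 := by
    intro v hv h
    funext j
    by_cases hj : j ∈ Finset.univ.image c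
    · obtain ⟨i, -, rfl⟩ := Finset.mem_image.1 hj
      exact congrFun h i
    · exact hVle hv j hj
  have hrank : Module.finrank ℂ (V.map (LinearMap.funLeft ℂ ℂ c)) = Module.finrank ℂ V := by
    rw [← LinearMap.range_domRestrict]
    refine LinearMap.finrank_range_of_inj ?_
    rw [← LinearMap.ker_eq_bot, LinearMap.ker_eq_bot']
    exact fun v hv => Subtype.ext (hinj v v.2 hv)
  obtain ⟨j, hj⟩ := exists_isPivot_Ici (U := V.map (LinearMap.funLeft ℂ ℂ c))
    (f := fun y => Fin.cons 0 fun i => a i.castSucc * y i.castSucc) (a := a) ha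
    (fun y i hi => by rw [show i = 0 from Fin.ext hi, Fin.cons_zero])
    (fun y i j hij => by
      obtain ⟨l, rfl⟩ := Fin.eq_succ_of_ne_zero (i := j) (by rintro rfl; simp at hij)
      rw [Fin.cons_succ, show i = l.castSucc from Fin.ext (by simp at hij; simp [hij])])
    (by
      rintro _ ⟨v, hv, rfl⟩
      refine ⟨_, hW'.2 x₀ v hv, funext fun i => ?_⟩
      refine Fin.cases ?_ (fun l => ?_) i
      · exact h0 v (hVle hv)
      · exact hs v (hVle hv) l)
    (by
      intro h
      rw [← Submodule.finrank_eq_zero, hrank, Submodule.finrank_eq_zero] at h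
      exact hV0 h)
  have hpiv : IsPivot V ((Finset.Ici j).image c) := by
    refine ⟨?_, fun v hv h => hinj v hv (hj.2 _ ⟨v, hv, rfl⟩ fun i hi =>
      h _ (Finset.mem_image_of_mem _ hi))⟩
    rw [Finset.card_image_of_injective _ hc, hj.1, hrank]
  refine ⟨x₀, _, hpiv, ?_⟩
  rw [hsumc]
  refine htail j ?_
  rintro rfl
  refine hV1 (Submodule.eq_of_le_of_finrank_eq hVle ?_)
  rw [finrank_coordSubspace, ← hpiv.1]
  congr 2
  exact (Finset.Ici_bot (α := Fin (n + 1))).symm ▸ rfl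

theorem isPolystable_of_isStable (h : IsStable (alphaHiggs β δ)) :
    IsPolystable (alphaHiggs β δ) := by
  refine ⟨1, fun _ => ⊤, fun _ => h, fun x => ?_⟩
  rw [DirectSum.isInternal_submodule_iff_iSupIndep_and_iSup_eq_top]
  refine ⟨?_, ?_⟩
  · intro i
    simp [Subsingleton.elim _ i]
  · simp

/-- A partition of the indices decomposes `ℂⁿ`. -/
theorem isInternal_coordSubspace {n m : ℕ} {S : Fin m → Finset (Fin n)}
    (hS : ∀ j, ∃ i, j ∈ S i ∧ ∀ l, j ∈ S l → l = i) :
    DirectSum.IsInternal fun i => coordSubspace (S i) := by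
  rw [DirectSum.isInternal_submodule_iff_iSupIndep_and_iSup_eq_top]
  constructor
  · rw [iSupIndep_def]
    intro i
    have hle : ⨆ (l) (_ : l ≠ i), coordSubspace (S l) ≤ coordSubspace (S i)ᶜ := by
      refine iSup₂_le fun l hl v hv j hj => hv j fun hjl => hl ?_
      rw [Finset.mem_compl, not_not] at hj
      obtain ⟨i', -, h'⟩ := hS j
      exact (h' l hjl).trans (h' i hj).symm
    rw [Submodule.disjoint_def]
    intro v hv hv'
    funext j
    by_cases hj : j ∈ S i
    · exact hle hv' j (by rwa [Finset.mem_compl, not_not])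
    · exact hv j hj
  · rw [eq_top_iff]
    intro v _
    rw [← Finset.univ_sum_single v]
    refine Submodule.sum_mem _ fun j _ => ?_
    obtain ⟨i, hi, -⟩ := hS j
    refine Submodule.mem_iSup_of_mem i fun l hl => Pi.single_eq_of_ne ?_ _
    rintro rfl
    exact hl hi

end Stability

/-! ### Degenerate `α`-cyclic Higgs bundles: direct sums of stable pieces -/

section Degenerate

open Filter

variable {X : Type u} [TopologicalSpace X] [ChartedSpace ℂ X] [IsManifold 𝓘(ℂ) ω X]
variable {T : X → Type v} [∀ x, AddCommGroup (T x)] [∀ x, Module ℂ (T x)]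
  [TopologicalSpace (TotalSpace ℂ T)] [∀ x, TopologicalSpace (T x)] [FiberBundle ℂ T]
  [VectorBundle ℂ ℂ T] [ContMDiffVectorBundle ω ℂ T 𝓘(ℂ)]
variable {β : HolSection T (-1) 1} {δ : HolSection T 3 3}

theorem higgsAt_mulVec (x : X) (v : Fin 7 → ℂ) : (higgsAt β δ x).mulVec v =
    ![fiberCoord δ x * v 5, fiberCoord β x * v 0 + fiberCoord δ x * v 6, v 1,
      -(Complex.I * (Real.sqrt 2 : ℂ)) * fiberCoord β x * v 2,
      -(Complex.I * (Real.sqrt 2 : ℂ)) * fiberCoord β x * v 3, v 4, fiberCoord β x * v 5] :=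
  alphaMatrix_mulVec _ _ v

theorem fiberCoord_zero {a b : ℤ} (x : X) : fiberCoord (0 : HolSection T a b) x = 0 :=
  rfl

variable [T2Space X] [CompactSpace X] [ConnectedSpace X] {t k : ℤ}

theorem not_isStable_of_isStableSub {W : ∀ x, Submodule ℂ ((alphaBundle T).Fiber x)}
    (hW : IsStableSub (alphaHiggs β δ) W) (h : W ≠ ⊤) : ¬ IsStable (alphaHiggs β δ) := by
  intro hs
  obtain ⟨d, hd, hneg⟩ := hs.2.2.2 W hW.1 le_top hW.2.1 h
  rw [hd.unique hW.2.2.1] at hneg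
  exact lt_irrefl _ hneg

/-- For `δ = 0` and `β ≠ 0` the Higgs field is a single chain of seven line bundles. -/
theorem isStable_of_right_eq_zero
    (hd : ∀ j, HasTwistDegree T (expT j) (expK j) (lineDeg t k j)) (hk : 0 < k)
    (htk : 0 < 2 * t + k) (hβ : β ≠ 0) (hδ : δ = 0) : IsStable (alphaHiggs β δ) := by
  subst hδ
  obtain ⟨x₀, hx₀⟩ := HolSection.exists_ne_zero hβ
  obtain ⟨l0, l1, l2, l3, l4, l5, l6⟩ := lineDeg_eq t k
  have htop : (⊤ : ∀ x, Submodule ℂ ((alphaBundle T).Fiber x)) =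
      fun _ => coordSubspace (Finset.univ : Finset (Fin 7)) := by
    rw [coordSubspace_univ]
    rfl
  rw [IsStable, htop]
  set b := fiberCoord β x₀ with hb
  set c := -(Complex.I * (Real.sqrt 2 : ℂ)) with hc
  have hc0 : c ≠ 0 := coupling_ne_zero
  refine isStableSub_coordSubspace hd (n := 6) (c := id) Function.injective_id
    Finset.image_id ?_ (x₀ := x₀)
    (a := ![b, 1, c * b, c * b, 1, b, 1]) ?_ ?_ ?_ ?_ ?_
  · intro x v _ j hj
    exact absurd (Finset.mem_univ j) hj
  · intro i
    fin_cases i <;> simp [hx₀, hc0]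
  · intro v _
    rw [higgsAt_mulVec]
    simp [fiberCoord_zero]
  · intro v _ i
    rw [higgsAt_mulVec]
    fin_cases i <;> simp [fiberCoord_zero, ← hb, ← hc]
  · change ∑ j : Fin 7, lineDeg t k j = 0
    rw [Fin.sum_univ_seven]
    omega
  · intro j hj
    rw [← Finset.filter_le_eq_Ici, Finset.sum_filter]
    change ∑ i : Fin 7, (if j ≤ i then lineDeg t k i else 0) < 0
    rw [Fin.sum_univ_seven, l0, l1, l2, l3, l4, l5, l6]
    fin_cases j
    · exact absurd rfl hj
    all_goals
      simp [Fin.le_def]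
      omega

/-- The Higgs subbundle `T⁻²K⁻¹ → TK → T` for `β = 0`. -/
theorem isStableSub_six_one_two
    (hd : ∀ j, HasTwistDegree T (expT j) (expK j) (lineDeg t k j)) (hk : 0 < k)
    (htk : 2 * t + k < 0) (hβ : β = 0) (hδ : δ ≠ 0) :
    IsStableSub (alphaHiggs β δ) fun _ => coordSubspace {6, 1, 2} := by
  subst hβ
  obtain ⟨x₀, hx₀⟩ := HolSection.exists_ne_zero hδ
  obtain ⟨l0, l1, l2, -, l4, l5, l6⟩ := lineDeg_eq t k
  have hv : ∀ v : Fin 7 → ℂ, v ∈ coordSubspace {6, 1, 2} →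
      v 0 = 0 ∧ v 3 = 0 ∧ v 4 = 0 ∧ v 5 = 0 := fun v hv =>
    ⟨hv 0 (by decide), hv 3 (by decide), hv 4 (by decide), hv 5 (by decide)⟩
  refine isStableSub_coordSubspace hd (n := 2) (c := ![6, 1, 2]) (by decide) (by decide)
    ?_ (x₀ := x₀) (a := ![fiberCoord δ x₀, 1, 1]) ?_ ?_ ?_ ?_ ?_
  · intro x v hv' j hj
    obtain ⟨h0, h3, h4, h5⟩ := hv v hv'
    rw [higgsAt_mulVec]
    fin_cases j <;> first
      | exact absurd (by decide) hj
      | simp [fiberCoord_zero, h0, h3, h4, h5]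
  · intro i
    fin_cases i <;> simp [hx₀]
  · intro v hv'
    obtain ⟨h0, h3, h4, h5⟩ := hv v hv'
    rw [higgsAt_mulVec]
    simp [fiberCoord_zero, h0, h3, h4, h5]
  · intro v hv' i
    rw [higgsAt_mulVec]
    fin_cases i <;> simp [fiberCoord_zero]
  · simp [Fin.sum_univ_succ, l6, l1, l2]
    omega
  · intro j hj
    rw [← Finset.filter_le_eq_Ici, Finset.sum_filter]
    fin_cases j
    · exact absurd rfl hj
    all_goals
      simp [Fin.sum_univ_succ, Fin.le_def, l1, l2]
      omega

/-- The Higgs subbundle `T⁻¹ → T⁻¹K⁻¹ → T²K` for `β = 0`. -/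
theorem isStableSub_four_five_zero
    (hd : ∀ j, HasTwistDegree T (expT j) (expK j) (lineDeg t k j)) (hk : 0 < k)
    (htk : 2 * t + k < 0) (hβ : β = 0) (hδ : δ ≠ 0) :
    IsStableSub (alphaHiggs β δ) fun _ => coordSubspace {4, 5, 0} := by
  subst hβ
  obtain ⟨x₀, hx₀⟩ := HolSection.exists_ne_zero hδ
  obtain ⟨l0, l1, l2, -, l4, l5, l6⟩ := lineDeg_eq t k
  have hv : ∀ v : Fin 7 → ℂ, v ∈ coordSubspace {4, 5, 0} →
      v 1 = 0 ∧ v 2 = 0 ∧ v 3 = 0 ∧ v 6 = 0 := fun v hv =>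
    ⟨hv 1 (by decide), hv 2 (by decide), hv 3 (by decide), hv 6 (by decide)⟩
  refine isStableSub_coordSubspace hd (n := 2) (c := ![4, 5, 0]) (by decide) (by decide)
    ?_ (x₀ := x₀) (a := ![1, fiberCoord δ x₀, 1]) ?_ ?_ ?_ ?_ ?_
  · intro x v hv' j hj
    obtain ⟨h1, h2, h3, h6⟩ := hv v hv'
    rw [higgsAt_mulVec]
    fin_cases j <;> first
      | exact absurd (by decide) hj
      | simp [fiberCoord_zero, h1, h2, h3, h6]
  · intro i
    fin_cases i <;> simp [hx₀]
  · intro v hv'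
    obtain ⟨h1, h2, h3, h6⟩ := hv v hv'
    rw [higgsAt_mulVec]
    simp [fiberCoord_zero, h1, h2, h3, h6]
  · intro v hv' i
    rw [higgsAt_mulVec]
    fin_cases i <;> simp [fiberCoord_zero]
  · simp [Fin.sum_univ_succ, l4, l5, l0]
    omega
  · intro j hj
    rw [← Finset.filter_le_eq_Ici, Finset.sum_filter]
    fin_cases j
    · exact absurd rfl hj
    all_goals
      simp [Fin.sum_univ_succ, Fin.le_def, l5, l0]
      omega

/-- The Higgs subbundle `TK → T` for `β = δ = 0`. -/
theorem isStableSub_one_two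
    (hd : ∀ j, HasTwistDegree T (expT j) (expK j) (lineDeg t k j)) (hk : 0 < k)
    (htk : 2 * t + k = 0) (hβ : β = 0) (hδ : δ = 0) :
    IsStableSub (alphaHiggs β δ) fun _ => coordSubspace {1, 2} := by
  subst hβ
  subst hδ
  obtain ⟨x₀⟩ := (inferInstance : Nonempty X)
  obtain ⟨l0, l1, l2, -, l4, l5, l6⟩ := lineDeg_eq t k
  have hv : ∀ v : Fin 7 → ℂ, v ∈ coordSubspace {1, 2} →
      v 0 = 0 ∧ v 3 = 0 ∧ v 4 = 0 ∧ v 5 = 0 ∧ v 6 = 0 := fun v hv =>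
    ⟨hv 0 (by decide), hv 3 (by decide), hv 4 (by decide), hv 5 (by decide), hv 6 (by decide)⟩
  refine isStableSub_coordSubspace hd (n := 1) (c := ![1, 2]) (by decide) (by decide)
    ?_ (x₀ := x₀) (a := ![1, 1]) ?_ ?_ ?_ ?_ ?_
  · intro x v hv' j hj
    obtain ⟨h0, h3, h4, h5, h6⟩ := hv v hv'
    rw [higgsAt_mulVec]
    fin_cases j <;> first
      | exact absurd (by decide) hj
      | simp [fiberCoord_zero, h0, h3, h4, h5, h6]
  · intro i
    fin_cases i <;> simp
  · intro v hv'
    obtain ⟨h0, h3, h4, h5, h6⟩ := hv v hv'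
    rw [higgsAt_mulVec]
    simp [fiberCoord_zero, h0, h3, h4, h5, h6]
  · intro v hv' i
    rw [higgsAt_mulVec]
    fin_cases i
    simp [fiberCoord_zero]
  · simp [Fin.sum_univ_succ, l1, l2]
    omega
  · intro j hj
    rw [← Finset.filter_le_eq_Ici, Finset.sum_filter]
    fin_cases j
    · exact absurd rfl hj
    all_goals
      simp [Fin.sum_univ_succ, Fin.le_def, l2]
      omega

/-- The Higgs subbundle `T⁻¹ → T⁻¹K⁻¹` for `β = δ = 0`. -/
theorem isStableSub_four_five
    (hd : ∀ j, HasTwistDegree T (expT j) (expK j) (lineDeg t k j)) (hk : 0 < k)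
    (htk : 2 * t + k = 0) (hβ : β = 0) (hδ : δ = 0) :
    IsStableSub (alphaHiggs β δ) fun _ => coordSubspace {4, 5} := by
  subst hβ
  subst hδ
  obtain ⟨x₀⟩ := (inferInstance : Nonempty X)
  obtain ⟨l0, l1, l2, -, l4, l5, l6⟩ := lineDeg_eq t k
  have hv : ∀ v : Fin 7 → ℂ, v ∈ coordSubspace {4, 5} →
      v 0 = 0 ∧ v 1 = 0 ∧ v 2 = 0 ∧ v 3 = 0 ∧ v 6 = 0 := fun v hv =>
    ⟨hv 0 (by decide), hv 1 (by decide), hv 2 (by decide), hv 3 (by decide), hv 6 (by decide)⟩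
  refine isStableSub_coordSubspace hd (n := 1) (c := ![4, 5]) (by decide) (by decide)
    ?_ (x₀ := x₀) (a := ![1, 1]) ?_ ?_ ?_ ?_ ?_
  · intro x v hv' j hj
    obtain ⟨h0, h1, h2, h3, h6⟩ := hv v hv'
    rw [higgsAt_mulVec]
    fin_cases j <;> first
      | exact absurd (by decide) hj
      | simp [fiberCoord_zero, h0, h1, h2, h3, h6]
  · intro i
    fin_cases i <;> simp
  · intro v hv'
    obtain ⟨h0, h1, h2, h3, h6⟩ := hv v hv'
    rw [higgsAt_mulVec]
    simp [fiberCoord_zero, h0, h1, h2, h3, h6]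
  · intro v hv' i
    rw [higgsAt_mulVec]
    fin_cases i
    simp [fiberCoord_zero]
  · simp [Fin.sum_univ_succ, l4, l5]
    omega
  · intro j hj
    rw [← Finset.filter_le_eq_Ici, Finset.sum_filter]
    fin_cases j
    · exact absurd rfl hj
    all_goals
      simp [Fin.sum_univ_succ, Fin.le_def, l5]
      omega

theorem isStableSub_line
    (hd : ∀ j, HasTwistDegree T (expT j) (expK j) (lineDeg t k j)) {j : Fin 7}
    (hj : lineDeg t k j = 0) (h : ∀ x, (higgsAt β δ x).mulVec (Pi.single j 1) = 0) :
    IsStableSub (alphaHiggs β δ) fun _ => coordSubspace {j} := by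
  have h' : ∀ x, ∀ v ∈ coordSubspace {j}, (higgsAt β δ x).mulVec v = 0 := by
    intro x v hv
    have : v = v j • Pi.single j 1 := by
      funext i
      by_cases hi : i = j
      · subst hi; simp
      · rw [hv i (by simpa using hi)]; simp [hi]
    rw [this, Matrix.mulVec_smul, h, smul_zero]
  obtain ⟨x₀⟩ := (inferInstance : Nonempty X)
  refine isStableSub_coordSubspace hd (n := 0) (c := fun _ => j)
    (fun _ _ _ => Subsingleton.elim (α := Fin 1) _ _) (Finset.image_const Finset.univ_nonempty j)
    (fun x v hv => ?_) (x₀ := x₀) (a := fun _ => 1) (fun _ => one_ne_zero) (fun v hv => ?_)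
    (fun v hv i => i.elim0) ?_ fun j hj => ?_
  · rw [h' x v hv]
    exact Submodule.zero_mem _
  · rw [h' x₀ v hv, Pi.zero_apply]
  · simpa using hj
  · exact absurd (Subsingleton.elim (α := Fin 1) _ _) hj

theorem isStableSub_three
    (hd : ∀ j, HasTwistDegree T (expT j) (expK j) (lineDeg t k j)) (hβ : β = 0) :
    IsStableSub (alphaHiggs β δ) fun _ => coordSubspace {3} := by
  refine isStableSub_line hd (lineDeg_eq t k).2.2.2.1 fun x => ?_
  subst hβ
  rw [higgsAt_mulVec]
  funext j
  fin_cases j <;> simp [fiberCoord_zero]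

theorem not_isStable_of_left_eq_zero
    (hd : ∀ j, HasTwistDegree T (expT j) (expK j) (lineDeg t k j)) (hβ : β = 0) :
    ¬ IsStable (alphaHiggs β δ) := by
  refine not_isStable_of_isStableSub (isStableSub_three hd hβ) fun h => ?_
  obtain ⟨x₀⟩ := (inferInstance : Nonempty X)
  have h' : coordSubspace {3} = (⊤ : Submodule ℂ (Fin 7 → ℂ)) := congrFun h x₀
  have := finrank_coordSubspace ({3} : Finset (Fin 7))
  rw [h', finrank_top, Module.finrank_fin_fun] at this
  exact absurd this (by decide)

/-- For `β = 0` the Higgs bundle is the sum of two chains of length three and the trivial bundle. -/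
theorem isStrictlyPolystable_of_left_eq_zero
    (hd : ∀ j, HasTwistDegree T (expT j) (expK j) (lineDeg t k j)) (hk : 0 < k)
    (htk : 2 * t + k < 0) (hβ : β = 0) (hδ : δ ≠ 0) :
    IsStrictlyPolystable (alphaHiggs β δ) := by
  refine ⟨⟨3, fun i _ => coordSubspace ((![{6, 1, 2}, {4, 5, 0}, {3}] : Fin 3 → Finset (Fin 7)) i),
    fun i => ?_, fun x => isInternal_coordSubspace (by decide)⟩, not_isStable_of_left_eq_zero hd hβ⟩
  fin_cases i
  · exact isStableSub_six_one_two hd hk htk hβ hδ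
  · exact isStableSub_four_five_zero hd hk htk hβ hδ
  · exact isStableSub_three hd hβ

/-- For `β = δ = 0` the Higgs bundle is the sum of two chains of length two and three line bundles
killed by the Higgs field. -/
theorem isStrictlyPolystable_of_eq_zero
    (hd : ∀ j, HasTwistDegree T (expT j) (expK j) (lineDeg t k j)) (hk : 0 < k)
    (htk : 2 * t + k = 0) (hβ : β = 0) (hδ : δ = 0) :
    IsStrictlyPolystable (alphaHiggs β δ) := by
  refine ⟨⟨5, fun i _ => coordSubspace
      ((![{1, 2}, {4, 5}, {3}, {0}, {6}] : Fin 5 → Finset (Fin 7)) i),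
    fun i => ?_, fun x => isInternal_coordSubspace (by decide)⟩, not_isStable_of_left_eq_zero hd hβ⟩
  obtain ⟨l0, -, -, -, -, -, l6⟩ := lineDeg_eq t k
  fin_cases i
  · exact isStableSub_one_two hd hk htk hβ hδ
  · exact isStableSub_four_five hd hk htk hβ hδ
  · exact isStableSub_three hd hβ
  all_goals
    refine isStableSub_line hd (by omega) fun x => ?_
    subst hβ hδ
    rw [higgsAt_mulVec]
    funext j
    fin_cases j <;> simp [fiberCoord_zero]

end Degenerate

/-! ### Components of sections in a direct sum decomposition -/

section Components

open Filter

variable {X : Type u} [TopologicalSpace X] [ChartedSpace ℂ X] [IsManifold 𝓘(ℂ) ω X]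
variable {T : X → Type v} [∀ x, AddCommGroup (T x)] [∀ x, Module ℂ (T x)]
  [TopologicalSpace (TotalSpace ℂ T)] [∀ x, TopologicalSpace (T x)] [FiberBundle ℂ T]
  [VectorBundle ℂ ℂ T] [ContMDiffVectorBundle ω ℂ T 𝓘(ℂ)]
variable {n : ℕ} {a b : Fin n → ℤ}

theorem exists_mem_sum_eq {m : ℕ} {V : Fin m → Submodule ℂ (Fin n → ℂ)}
    (hV : DirectSum.IsInternal V) (u : Fin n → ℂ) :
    ∃ w : Fin m → Fin n → ℂ, (∀ i, w i ∈ V i) ∧ ∑ i, w i = u := by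
  have hu : u ∈ ⨆ i ∈ (Finset.univ : Finset (Fin m)), V i := by
    simp only [Finset.mem_univ, iSup_pos, hV.submodule_iSup_eq_top, Submodule.mem_top]
  obtain ⟨w, hw⟩ := (Submodule.mem_iSup_finset_iff_exists_sum V u).1 hu
  exact ⟨fun i => w i, fun i => (w i).2, hw⟩

theorem eq_of_mem_of_sum_eq {m : ℕ} {V : Fin m → Submodule ℂ (Fin n → ℂ)}
    (hV : DirectSum.IsInternal V) {w w' : Fin m → Fin n → ℂ} (hw : ∀ i, w i ∈ V i)
    (hw' : ∀ i, w' i ∈ V i) (h : ∑ i, w i = ∑ i, w' i) (i : Fin m) : w i = w' i := by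
  exact (iSupIndep_iff_finsetSum_eq_imp_eq V).1 hV.submodule_iSupIndep Finset.univ w w'
    (fun i _ => ⟨hw i, hw' i⟩) h i (Finset.mem_univ i)

theorem eq_zero_of_sum_mem {m : ℕ} {V : Fin m → Submodule ℂ (Fin n → ℂ)}
    (hV : DirectSum.IsInternal V) {w : Fin m → Fin n → ℂ} (hw : ∀ i, w i ∈ V i) {u : Fin n → ℂ}
    (h : ∑ i, w i = u) {i : Fin m} (hu : u ∈ V i) {l : Fin m} (hl : l ≠ i) : w l = 0 := by
  have hu' : ∀ l, (Pi.single i u : Fin m → Fin n → ℂ) l ∈ V l := by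
    intro l
    by_cases hli : l = i
    · subst hli
      rwa [Pi.single_eq_same]
    · rw [Pi.single_eq_of_ne hli]
      exact (V l).zero_mem
  rw [eq_of_mem_of_sum_eq hV hw hu' ?_ l, Pi.single_eq_of_ne hl]
  rw [h, Finset.sum_eq_single i (fun l _ hl => Pi.single_eq_of_ne hl _)
    fun hi => absurd (Finset.mem_univ i) hi, Pi.single_eq_same]

/-- Bases of the summands of a direct sum, collected in an invertible matrix. -/
theorem exists_equiv_det_ne_zero {m : ℕ} {V : Fin m → Submodule ℂ (Fin n → ℂ)}
    (hV : DirectSum.IsInternal V) {r : Fin m → ℕ} {f : ∀ i, Fin (r i) → Fin n → ℂ}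
    (hf : ∀ i, LinearIndependent ℂ (f i)) (hfV : ∀ i, Submodule.span ℂ (Set.range (f i)) = V i) :
    ∃ e : (Σ i, Fin (r i)) ≃ Fin n,
      (Matrix.of fun j l => f (e.symm l).1 (e.symm l).2 j).det ≠ 0 := by
  have hB := hV.collectedBasis_coe fun i =>
    (Module.Basis.span (hf i)).map (LinearEquiv.ofEq _ _ (hfV i))
  set B := hV.collectedBasis fun i =>
    (Module.Basis.span (hf i)).map (LinearEquiv.ofEq _ _ (hfV i)) with hBdef
  have hBf : ∀ a, B a = f a.1 a.2 := by
    intro a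
    rw [hB]
    simp [Module.Basis.span_apply]
  have hcard : Fintype.card (Σ i, Fin (r i)) = Fintype.card (Fin n) := by
    rw [← Module.finrank_eq_card_basis B, Module.finrank_fin_fun, Fintype.card_fin]
  refine ⟨Fintype.equivOfCardEq hcard, ?_⟩
  rw [← isUnit_iff_ne_zero, ← Matrix.isUnit_iff_isUnit_det,
    ← Matrix.linearIndependent_cols_iff_isUnit]
  have h := (B.reindex (Fintype.equivOfCardEq hcard)).linearIndependent
  rwa [show ⇑(B.reindex (Fintype.equivOfCardEq hcard)) = fun l =>
    f ((Fintype.equivOfCardEq hcard).symm l).1 ((Fintype.equivOfCardEq hcard).symm l).2 from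
    funext fun l => by rw [Module.Basis.reindex_apply, hBf]] at h

theorem HolAt.eventually_or {p : X} {s : ∀ x, (twistSum T a b).Fiber x}
    (hs : HolAt (Fin n → ℂ) s p) : (∀ᶠ x in 𝓝 p, s x = 0) ∨ ∀ᶠ x in 𝓝[≠] p, s x ≠ 0 := by
  have h := (holAt_iff T a b s p).1 hs
  by_cases hz : ∀ k, ∀ᶠ x in 𝓝 p, twistCocycle T (a k) (b k) x p x * s x k = 0
  · left
    filter_upwards [eventually_all.2 hz] with x hx
    funext k
    exact (mul_eq_zero.1 (hx k)).resolve_left (twistCocycle_ne_zero T _ _ _ _ _)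
  · right
    rw [not_forall] at hz
    obtain ⟨k, hk⟩ := hz
    filter_upwards [(h k).eventually_or.resolve_left hk] with x hx h0
    exact hx (by rw [h0]; exact mul_zero _)

theorem HolAt.eq_zero_of_punctured {p : X} {s : ∀ x, (twistSum T a b).Fiber x}
    (hs : HolAt (Fin n → ℂ) s p) (h : ∀ᶠ x in 𝓝[≠] p, s x = 0) : s p = 0 := by
  have hnb : (𝓝[≠] p).NeBot := neBot_punctured p
  rcases hs.eventually_or with h' | h'
  · exact h'.self_of_nhds
  · obtain ⟨x, hx, hx'⟩ := (h.and h').exists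
    exact absurd hx hx'

theorem sum_smul_apply {r : ℕ} (c : Fin r → ℂ) (w : Fin r → Fin n → ℂ) (k : Fin n) :
    (∑ l, c l • w l) k = ∑ l, c l * w l k := by
  rw [Finset.sum_apply]
  rfl

theorem HolAt.sum_smul {p : X} {r : ℕ} {c : Fin r → X → ℂ}
    {s : Fin r → ∀ x, (twistSum T a b).Fiber x} (hc : ∀ l, AnaAt (c l) p)
    (hs : ∀ l, HolAt (Fin n → ℂ) (s l) p) :
    HolAt (Fin n → ℂ) (fun x => ∑ l, c l x • s l x) p := by
  refine (holAt_iff T a b _ p).2 fun k => ?_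
  refine (AnaAt.sum Finset.univ fun l _ => (hc l).mul ((holAt_iff T a b _ p).1 (hs l) k)).congr
    (Eventually.of_forall fun x => ?_)
  refine Eq.trans ?_ (congrArg (twistCocycle T (a k) (b k) x p x * ·)
    (sum_smul_apply (fun l => c l x) (fun l => s l x) k)).symm
  rw [Finset.mul_sum]
  exact Finset.sum_congr rfl fun l _ => by ring

/-- Up to a nonvanishing function, a holomorphic section is a sum of holomorphic sections of the
summands of a direct sum decomposition, by Cramer's rule. -/
theorem exists_components {m : ℕ} {W : Fin m → ∀ x, Submodule ℂ ((twistSum T a b).Fiber x)}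
    (hW : ∀ i, IsHolSubbundle (Fin n → ℂ) (W i)) {p : X}
    (hint : DirectSum.IsInternal fun i => W i p) {u : ∀ x, (twistSum T a b).Fiber x}
    (hu : HolAt (Fin n → ℂ) u p) :
    ∃ (D : X → ℂ) (s : Fin m → ∀ x, (twistSum T a b).Fiber x), AnaAt D p ∧ D p ≠ 0 ∧
      (∀ i, HolAt (Fin n → ℂ) (s i) p) ∧
      ∀ᶠ x in 𝓝 p, (∀ i, s i x ∈ W i x) ∧ ∑ i, s i x = D x • u x := by
  choose r f hf using fun i => hW i p
  have hfp := fun i => (hf i).2.self_of_nhds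
  obtain ⟨e, he⟩ := exists_equiv_det_ne_zero (n := n) (V := fun i => W i p) hint
    (f := fun i l => f i l p) (fun i => (hfp i).1) fun i => (hfp i).2
  set M : X → Matrix (Fin n) (Fin n) ℂ := fun x => Matrix.of fun j l =>
    twistCocycle T (a j) (b j) x p x * f (e.symm l).1 (e.symm l).2 x j with hM
  set v : X → Fin n → ℂ := fun x j => twistCocycle T (a j) (b j) x p x * u x j with hv
  have hMa : ∀ j l, AnaAt (fun x => M x j l) p := fun j l =>
    (holAt_iff T a b _ p).1 ((hf (e.symm l).1).1 (e.symm l).2) j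
  have hva : ∀ j, AnaAt (fun x => v x j) p := (holAt_iff T a b u p).1 hu
  have hca : ∀ l, AnaAt (fun x => (M x).cramer (v x) l) p := by
    intro l
    simp only [Matrix.cramer_apply]
    refine AnaAt.det fun i j => ?_
    simp only [Matrix.updateCol_apply]
    split_ifs
    · exact hva i
    · exact hMa i j
  have hMp : (M p).det ≠ 0 := by
    convert he using 3
    funext j l
    rw [twistCocycle_self T (a j) (b j) p p (mem_domain T p), one_mul]
  refine ⟨fun x => (M x).det,
    fun i x => ∑ l, (M x).cramer (v x) (e ⟨i, l⟩) • f i l x,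
    AnaAt.det hMa, hMp, fun i => HolAt.sum_smul (fun l => hca (e ⟨i, l⟩)) (hf i).1, ?_⟩
  filter_upwards [eventually_all.2 fun i => (hf i).2] with x hx
  refine ⟨fun i => ?_, ?_⟩
  · refine (W i x).sum_mem fun l _ => (W i x).smul_mem _ ?_
    rw [← (hx i).2]
    exact Submodule.subset_span (Set.mem_range_self l)
  · funext k
    have h1 := congrFun (Matrix.mulVec_cramer (M x) (v x)) k
    have h2 : ∑ l, M x k l * (M x).cramer (v x) l = (M x).det * v x k := h1
    rw [← Equiv.sum_comp e, Fintype.sum_sigma] at h2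
    refine mul_left_cancel₀ (twistCocycle_ne_zero T (a k) (b k) x p x) ?_
    refine Eq.trans ?_ (h2.trans (by
      change _ * (_ * _) = _ * (_ * _)
      ring))
    have h3 : ∀ w : Fin m → Fin n → ℂ, (∑ i, w i) k = ∑ i, w i k := fun w =>
      Finset.sum_apply k _ w
    refine (congrArg (twistCocycle T (a k) (b k) x p x * ·)
      ((h3 _).trans (Finset.sum_congr rfl fun i _ => sum_smul_apply
        (fun l => (M x).cramer (v x) (e ⟨i, l⟩)) (fun l => f i l x) k))).trans ?_
    rw [Finset.mul_sum]
    refine Finset.sum_congr rfl fun i _ => ?_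
    rw [Finset.mul_sum]
    refine Finset.sum_congr rfl fun l _ => ?_
    have h4 : M x k (e ⟨i, l⟩) =
        twistCocycle T (a k) (b k) x p x * (f i l x : Fin n → ℂ) k :=
      congrArg (fun q : Σ i, Fin (r i) =>
        twistCocycle T (a k) (b k) x p x * (f q.1 q.2 x : Fin n → ℂ) k) (e.symm_apply_apply ⟨i, l⟩)
    rw [h4]
    ring

end Components

/-! ### Degrees of the summands killed by the Higgs field -/

section Killed

open Filter

variable {X : Type u} [TopologicalSpace X] [ChartedSpace ℂ X] [IsManifold 𝓘(ℂ) ω X]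
variable {T : X → Type v} [∀ x, AddCommGroup (T x)] [∀ x, Module ℂ (T x)]
  [TopologicalSpace (TotalSpace ℂ T)] [∀ x, TopologicalSpace (T x)] [FiberBundle ℂ T]
  [VectorBundle ℂ ℂ T] [ContMDiffVectorBundle ω ℂ T 𝓘(ℂ)]
variable {β : HolSection T (-1) 1} {δ : HolSection T 3 3}

/-- A holomorphic section that the Higgs field kills away from `p` is killed at `p`. -/
theorem mulVec_eq_zero_of_punctured {p : X} {s : ∀ x, (alphaBundle T).Fiber x}
    (hs : HolAt (Fin 7 → ℂ) s p) (h : ∀ᶠ x in 𝓝[≠] p, (higgsAt β δ x).mulVec (s x) = 0) :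
    (higgsAt β δ p).mulVec (s p) = 0 := by
  have hnb : (𝓝[≠] p).NeBot := neBot_punctured p
  -- the coordinates of the image in the trivializations at `p`
  set G : X → Fin 7 → ℂ := fun x =>
    (alphaMatrix (twistCocycle T (-1) 1 x p x * fiberCoord β x)
      (twistCocycle T 3 3 x p x * fiberCoord δ x)).mulVec
      fun j => twistCocycle T (expT j) (expK j) x p x * s x j with hG
  have hGs : ∀ x k, twistCocycle T (expT k) (expK k) x p x * (higgsAt β δ x).mulVec (s x) k =
      transition (fun x : X => TangentSpace 𝓘(ℂ) x) x p x * G x k := by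
    intro x k
    have := alphaMatrix_equivariant (transition_ne_zero (L := T) x p x)
      (transition_ne_zero (L := fun x : X => TangentSpace 𝓘(ℂ) x) x p x)
      (fiberCoord β x) (fiberCoord δ x) 1 (s x) k
    rw [one_smul, mul_one] at this
    exact this
  have hsa := (holAt_iff T expT expK s p).1 hs
  have hGa : ∀ k, AnaAt (fun x => G x k) p := by
    have hβ := HolSection.anaAt β p
    have hδ := HolSection.anaAt δ p
    intro k
    simp only [hG, alphaMatrix_mulVec]
    fin_cases k
    · exact hδ.mul (hsa 5)
    · exact (hβ.mul (hsa 0)).add (hδ.mul (hsa 6))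
    · exact hsa 1
    · exact ((AnaAt.const _ p).mul hβ).mul (hsa 2)
    · exact ((AnaAt.const _ p).mul hβ).mul (hsa 3)
    · exact hsa 4
    · exact hβ.mul (hsa 5)
  funext k
  have hGp : G p k = 0 := by
    rcases (hGa k).eventually_or with h' | h'
    · exact h'.self_of_nhds
    · obtain ⟨x, hx, hx'⟩ := (h.and h').exists
      have h1 := hGs x k
      rw [hx, Pi.zero_apply, mul_zero] at h1
      exact absurd ((mul_eq_zero.1 h1.symm).resolve_left (transition_ne_zero _ _ _)) hx'
  have h1 := hGs p k
  rw [hGp, mul_zero] at h1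
  exact (mul_eq_zero.1 h1).resolve_left (twistCocycle_ne_zero T _ _ _ _ _)

/-- A holomorphic section with values in a summand away from `p` has its value at `p` in it. -/
theorem mem_of_punctured {n m : ℕ} {a b : Fin n → ℤ}
    {W : Fin m → ∀ x, Submodule ℂ ((twistSum T a b).Fiber x)}
    (hW : ∀ i, IsHolSubbundle (Fin n → ℂ) (W i)) (hint : ∀ x, DirectSum.IsInternal fun i => W i x)
    {p : X} {u : ∀ x, (twistSum T a b).Fiber x} (hu : HolAt (Fin n → ℂ) u p) {i : Fin m}
    (h : ∀ᶠ x in 𝓝[≠] p, u x ∈ W i x) : u p ∈ W i p := by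
  obtain ⟨D, s, -, hD0, hs, hev⟩ := exists_components hW (hint p) hu
  have hz : ∀ l, l ≠ i → s l p = 0 := by
    intro l hl
    refine (hs l).eq_zero_of_punctured ?_
    filter_upwards [h, eventually_nhdsWithin_of_eventually_nhds hev] with x hx hx'
    exact eq_zero_of_sum_mem (hint x) (w := fun l => s l x) hx'.1 hx'.2 ((W i x).smul_mem (D x) hx)
      hl
  obtain ⟨hmem, hsum⟩ := hev.self_of_nhds
  rw [Finset.sum_eq_single i (fun l _ hl => hz l hl)
    fun hi => absurd (Finset.mem_univ i) hi] at hsum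
  have h1 := hmem i
  rw [hsum] at h1
  exact ((W i p).smul_mem_iff hD0).1 h1

variable [T2Space X] [CompactSpace X] [ConnectedSpace X] {t k : ℤ}

/-- In a polystable Higgs bundle, a summand `L_j` killed by the Higgs field has degree at most zero:
it maps to the stable summands of degree zero, and the saturation of the image in one of them is a
Higgs subbundle. If `L_j` is also in the image of the Higgs field at a point, then the saturation is
not the whole summand, since the Higgs field would vanish on it. -/
theorem lineDeg_nonpos_of_isPolystable
    (hd : ∀ j, HasTwistDegree T (expT j) (expK j) (lineDeg t k j))
    (hP : IsPolystable (alphaHiggs β δ)) {j : Fin 7}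
    (hj : ∀ x, (higgsAt β δ x).mulVec (Pi.single j 1) = 0) (x₀ : X) :
    lineDeg t k j ≤ 0 ∧
      ∀ w : Fin 7 → ℂ, (higgsAt β δ x₀).mulVec w = Pi.single j 1 → lineDeg t k j < 0 := by
  obtain ⟨m, W, hW, hint⟩ := hP
  have hWi := fun i => isHiggsSub_iff.1 (hW i).1
  have hhol := fun i => (hWi i).1
  have hnb : ∀ p : X, (𝓝[≠] p).NeBot := neBot_punctured
  -- the components of the constant section `e_j`
  have hex : ∀ x, ∃ S : Fin m → Fin 7 → ℂ, (∀ i, S i ∈ W i x) ∧ ∑ i, S i = Pi.single j 1 :=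
    fun x => exists_mem_sum_eq (n := 7) (hint x) _
  choose S hSW hSsum using hex
  have huniq : ∀ x (w w' : Fin m → Fin 7 → ℂ), (∀ i, w i ∈ W i x) → (∀ i, w' i ∈ W i x) →
      ∑ i, w i = ∑ i, w' i → ∀ i, w i = w' i := fun x w w' hw hw' h =>
    eq_of_mem_of_sum_eq (hint x) hw hw' h
  have hAS : ∀ x i, (higgsAt β δ x).mulVec (S x i) = 0 := by
    intro x i
    refine huniq x (fun i => (higgsAt β δ x).mulVec (S x i)) (fun _ => 0)
      (fun i => (hWi i).2 x _ (hSW x i)) (fun i => (W i x).zero_mem) ?_ i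
    have h1 := hj x
    rw [← hSsum x, Matrix.mulVec_sum] at h1
    rw [h1, Finset.sum_const_zero]
  obtain ⟨i, hi⟩ : ∃ i, S x₀ i ≠ 0 := by
    by_contra h
    push Not at h
    have h1 := hSsum x₀
    rw [Finset.sum_congr rfl fun i _ => h i, Finset.sum_const_zero] at h1
    have := congrFun h1 j
    rw [Pi.single_eq_same] at this
    exact zero_ne_one this
  have hcomp := fun p => exists_components hhol (hint p)
    (holAt_localFrame (T := T) (a := expT) (b := expK) p j)
  choose D s hD hD0 hs hev using hcomp
  have hsS : ∀ p, ∀ᶠ x in 𝓝 p,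
      s p i x = (D p x * twistCocycle T (expT j) (expK j) p x x) • (S x i : Fin 7 → ℂ) := by
    intro p
    filter_upwards [hev p] with x ⟨hx, hx'⟩
    refine huniq x (fun i => s p i x)
      (fun i => (D p x * twistCocycle T (expT j) (expK j) p x x) • (S x i : Fin 7 → ℂ)) hx
      (fun i => (W i x).smul_mem _ (hSW x i)) ?_ i
    rw [← Finset.smul_sum, hSsum x, mul_smul]
    rw [localFrame_eq_smul] at hx'
    exact hx'
  have hDne : ∀ p, ∀ᶠ x in 𝓝 p, D p x * twistCocycle T (expT j) (expK j) p x x ≠ 0 := fun p =>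
    ((hD p).continuousAt.eventually_ne (hD0 p)).mono fun x hx =>
      mul_ne_zero hx (twistCocycle_ne_zero T _ _ _ _ _)
  have hor : ∀ p, (∀ᶠ x in 𝓝 p, S x i = 0) ∨ ∀ᶠ x in 𝓝[≠] p, S x i ≠ 0 := by
    intro p
    refine (hs p i).eventually_or.imp (fun h => ?_) fun h => ?_
    · filter_upwards [h, hsS p, hDne p] with x hx hx' hne
      rw [hx'] at hx
      exact (smul_eq_zero.1 hx).resolve_left hne
    · filter_upwards [h, eventually_nhdsWithin_of_eventually_nhds (hsS p)] with x hx hx' h0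
      rw [h0, smul_zero] at hx'
      exact hx hx'
  have hS : ∀ p, ∀ᶠ x in 𝓝[≠] p, S x i ≠ 0 := by
    refine (eventually_punctured_or (fun x => S x i ≠ 0) fun p => ?_).resolve_left fun h => ?_
    · exact (hor p).imp_left fun h => (eventually_nhdsWithin_of_eventually_nhds h).mono
        fun x hx => not_not.2 hx
    · have h1 := (hor x₀).resolve_left fun h0 => hi h0.self_of_nhds
      obtain ⟨x, hx, hx'⟩ := ((h x₀).and h1).exists
      exact hx hx'
  obtain ⟨L, s', μ, hSL, hL, hss'⟩ := exists_saturation (T := T) (a := expT) (b := expK)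
    (S := fun x => S x i) (s := fun p => s p i) (fun p => hs p i)
    (fun p => ((hsS p).and (hDne p)).mono fun x hx => ⟨_, hx.2, hx.1⟩) hS
  -- away from the zeros, the generator of `L` is a multiple of the component of `e_j`
  have hmul : ∀ p, ∀ᶠ x in 𝓝[≠] p, ∃ c : ℂ, s' p x = c • (S x i : Fin 7 → ℂ) := by
    intro p
    filter_upwards [(hasMeroOrder_coord_pow p (μ p)).eventually_ne_zero,
      eventually_nhdsWithin_of_eventually_nhds ((hss' p).and (hsS p))] with x hz ⟨hx, hx'⟩
    refine ⟨((chartAt ℂ p x - chartAt ℂ p p) ^ μ p)⁻¹ *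
      (D p x * twistCocycle T (expT j) (expK j) p x x), ?_⟩
    rw [mul_smul]
    refine Eq.trans ?_ (congrArg (((chartAt ℂ p x - chartAt ℂ p p) ^ μ p)⁻¹ • ·)
      (hx.symm.trans hx'))
    exact (inv_smul_smul₀ hz (s' p x : Fin 7 → ℂ)).symm
  have hLspan : ∀ p, ∀ w ∈ L p, ∃ c : ℂ, w = c • (s' p p : Fin 7 → ℂ) := by
    intro p w hw
    rw [← (hL p).2.self_of_nhds.2, Set.range_const, Submodule.mem_span_singleton] at hw
    obtain ⟨c, hc⟩ := hw
    exact ⟨c, hc.symm⟩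
  have hLW : L ≤ W i := by
    intro p w hw
    obtain ⟨c, rfl⟩ := hLspan p w hw
    refine (W i p).smul_mem c (mem_of_punctured hhol hint ((hL p).1 0) ?_)
    filter_upwards [hmul p] with x ⟨c, hc⟩
    rw [hc]
    exact (W i x).smul_mem c (hSW x i)
  have hLA : ∀ x, ∀ w : Fin 7 → ℂ, w ∈ L x → (higgsAt β δ x).mulVec w = 0 := by
    intro p w hw
    obtain ⟨c, rfl⟩ := hLspan p w hw
    suffices h0 : (higgsAt β δ p).mulVec (s' p p) = 0 from
      (Matrix.mulVec_smul (higgsAt β δ p) c (s' p p)).trans (by rw [h0, smul_zero])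
    refine mulVec_eq_zero_of_punctured ((hL p).1 0) ?_
    filter_upwards [hmul p] with x ⟨c, hc⟩
    rw [hc, Matrix.mulVec_smul, hAS, smul_zero]
  have hLH : IsHiggsSub (alphaHiggs β δ) L := by
    refine isHiggsSub_iff.2 ⟨fun p => ⟨1, _, hL p⟩, fun x w hw => ?_⟩
    rw [hLA x w hw]
    exact (L x).zero_mem
  have hL0 : L ≠ ⊥ := by
    rintro rfl
    exact hi (hSL x₀)
  have hle : ∀ e, HasDegree (Fin 7 → ℂ) L e → lineDeg t k j ≤ e := fun e he =>
    degree_le_of_saturation (hd j) hD hD0 hsS hL hss' he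
  by_cases hLi : L = W i
  · refine ⟨hle 0 (hLi ▸ (hW i).2.2.1), fun w hw => absurd ?_ hi⟩
    obtain ⟨v, hvW, hv⟩ := exists_mem_sum_eq (n := 7) (hint x₀) w
    rw [← hv, Matrix.mulVec_sum] at hw
    have h1 := huniq x₀ (S x₀) (fun i => (higgsAt β δ x₀).mulVec (v i)) (hSW x₀)
      (fun i => (hWi i).2 x₀ _ (hvW i)) ((hSsum x₀).trans hw.symm) i
    rw [h1]
    exact hLA x₀ _ (hLi ▸ hvW i)
  · obtain ⟨e, he, hneg⟩ := (hW i).2.2.2 L hLH hLW hL0 hLi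
    exact ⟨((hle e he).trans_lt hneg).le, fun _ _ => (hle e he).trans_lt hneg⟩

end Killed

/-! ### The generic locus: stability -/

section Generic

open Filter

variable {X : Type u} [TopologicalSpace X] [ChartedSpace ℂ X] [IsManifold 𝓘(ℂ) ω X]
variable {T : X → Type v} [∀ x, AddCommGroup (T x)] [∀ x, Module ℂ (T x)]
  [TopologicalSpace (TotalSpace ℂ T)] [∀ x, TopologicalSpace (T x)] [FiberBundle ℂ T]
  [VectorBundle ℂ ℂ T] [ContMDiffVectorBundle ω ℂ T 𝓘(ℂ)]

/-- If `J` is a pivot set of a subbundle near `p`, then the subbundle has a local section whose only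
nonzero coordinate in `J` is the one with a given index. -/
theorem exists_section_of_isPivot {n : ℕ} {a b : Fin n → ℤ}
    {W : ∀ x, Submodule ℂ ((twistSum T a b).Fiber x)} (hW : IsHolSubbundle (Fin n → ℂ) W)
    {J : Finset (Fin n)} (hJ : ∀ x, IsPivot (W x) J) {j : Fin n} (hj : j ∈ J) (p : X) :
    ∃ u : X → Fin n → ℂ, HolAt (Fin n → ℂ) (E := (twistSum T a b).Fiber) u p ∧
      ∀ᶠ x in 𝓝 p, u x ∈ W x ∧ u x j ≠ 0 ∧ ∀ i ∈ J, i ≠ j → u x i = 0 := by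
  obtain ⟨r, s, hs⟩ : ∃ (r : ℕ) (s : Fin r → X → Fin n → ℂ),
      IsFrameAt (Fin n → ℂ) (E := (twistSum T a b).Fiber) W p s := hW p
  have hr : J.card = r := (hJ p).1.trans hs.card_eq.symm
  obtain ⟨l₀, hl₀⟩ : ∃ l, J.orderEmbOfFin hr l = j := by
    have := Finset.range_orderEmbOfFin J hr
    rw [Set.ext_iff] at this
    exact (this j).2 hj
  set M : X → Matrix (Fin r) (Fin r) ℂ := fun x => Matrix.of fun i l =>
    twistCocycle T (a (J.orderEmbOfFin hr l)) (b (J.orderEmbOfFin hr l)) x p x *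
      s i x (J.orderEmbOfFin hr l) with hM
  have hMa : ∀ i l, AnaAt (fun x => M x i l) p := fun i l =>
    (holAt_iff T a b (s i) p).1 (hs.1 i) _
  set c : Fin r → X → ℂ := fun i x => (M x).transpose.cramer (Pi.single l₀ 1) i with hc
  have hca : ∀ i, AnaAt (c i) p := by
    intro i
    simp only [hc, Matrix.cramer_apply]
    refine AnaAt.det fun i' j' => ?_
    simp only [Matrix.updateCol_apply]
    split_ifs
    · exact AnaAt.const _ p
    · exact hMa j' i'
  refine ⟨fun x => ∑ i, c i x • s i x, HolAt.sum_smul hca hs.1, ?_⟩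
  filter_upwards [hs.2] with x hx
  have hdet : (M x).det ≠ 0 := (frameMinor_ne_zero_iff hx.1 hx.2 hr).2 (hJ x)
  have hcoord : ∀ l, twistCocycle T (a (J.orderEmbOfFin hr l)) (b (J.orderEmbOfFin hr l)) x p x *
      (∑ i, c i x • s i x) (J.orderEmbOfFin hr l) =
      (M x).det * (Pi.single l₀ 1 : Fin r → ℂ) l := by
    intro l
    have h1 := congrFun (Matrix.mulVec_cramer (M x).transpose (Pi.single l₀ 1)) l
    rw [Matrix.det_transpose] at h1
    refine Eq.trans ?_ h1
    rw [sum_smul_apply, Finset.mul_sum]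
    exact Finset.sum_congr rfl fun i _ => by
      change _ = M x i l * c i x
      simp only [hM, Matrix.of_apply]
      ring
  refine ⟨?_, ?_, fun i hi hij => ?_⟩
  · refine (W x).sum_mem fun l _ => (W x).smul_mem _ ?_
    rw [← hx.2]
    exact Submodule.subset_span (Set.mem_range_self l)
  · have h1 := hcoord l₀
    rw [hl₀, Pi.single_eq_same, mul_one] at h1
    intro h0
    rw [h0, mul_zero] at h1
    exact hdet h1.symm
  · obtain ⟨l, rfl⟩ : ∃ l, J.orderEmbOfFin hr l = i := by
      have := Finset.range_orderEmbOfFin J hr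
      rw [Set.ext_iff] at this
      exact (this i).2 hi
    have h1 := hcoord l
    rw [Pi.single_eq_of_ne (by rintro rfl; exact hij hl₀), mul_zero] at h1
    exact (mul_eq_zero.1 h1).resolve_left (twistCocycle_ne_zero T _ _ _ _ _)

theorem twistCocycle_mul (a b a' b' : ℤ) (x y z : X) :
    twistCocycle T a b x y z * twistCocycle T a' b' x y z =
      twistCocycle T (a + a') (b + b') x y z := by
  rw [twistCocycle, twistCocycle, twistCocycle, zpow_add₀ (transition_ne_zero _ _ _), neg_add,
    zpow_add₀ (transition_ne_zero _ _ _)]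
  ring

variable {β : HolSection T (-1) 1} {δ : HolSection T 3 3}

theorem HolSection.exists_hasMeroOrder [T1Space X] [ConnectedSpace X] {a b : ℤ}
    {σ : HolSection T a b} (hσ : σ ≠ 0) (p : X) :
    ∃ m : ℤ, HasMeroOrder (fun x => twistCocycle T a b x p x * fiberCoord σ x) p m := by
  have hnb : (𝓝[≠] p).NeBot := neBot_punctured p
  refine (HolSection.anaAt σ p).meroAt.exists_hasMeroOrder (Eventually.frequently ?_)
  filter_upwards [HolSection.eventually_ne_zero hσ p] with x hx
  exact mul_ne_zero (twistCocycle_ne_zero T _ _ _ _ _) hx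

/-- If a Higgs subbundle has the pivot sets `I ∪ {0}` and `I ∪ {6}` everywhere, then its local
section with vanishing coordinates in `I` has coordinates `0` and `6` without zeros; their ratio is
`±δ : β`. -/
theorem sameDivisor_of_isPivot [T2Space X] [ConnectedSpace X]
    {W : ∀ x, Submodule ℂ ((alphaBundle T).Fiber x)} (hW : IsHiggsSub (alphaHiggs β δ) W)
    (hβ : β ≠ 0) (hδ : δ ≠ 0) {I : Finset (Fin 7)} (h0 : 0 ∉ I) (h6 : 6 ∉ I)
    (hI0 : ∀ x, IsPivot (W x) (insert 0 I)) (hI6 : ∀ x, IsPivot (W x) (insert 6 I)) :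
    SameDivisor β δ := by
  intro p
  rw [isHiggsSub_iff] at hW
  obtain ⟨u, hu, hu'⟩ := exists_section_of_isPivot hW.1 hI0 (Finset.mem_insert_self 0 I) p
  have huI : ∀ᶠ x in 𝓝 p, u x ∈ W x ∧ u x 0 ≠ 0 ∧ u x 6 ≠ 0 ∧ ∀ i ∈ I, u x i = 0 := by
    filter_upwards [hu'] with x ⟨hx, hx0, hxI⟩
    have hxI' : ∀ i ∈ I, u x i = 0 := fun i hi =>
      hxI i (Finset.mem_insert_of_mem hi) fun h => h0 (h ▸ hi)
    refine ⟨hx, hx0, fun hx6 => hx0 ?_, hxI'⟩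
    refine congrFun ((hI6 x).2 (u x) hx fun i hi => ?_) 0
    rcases Finset.mem_insert.1 hi with rfl | hi
    · exact hx6
    · exact hxI' i hi
  have ha := (holAt_iff T expT expK u p).1 hu
  obtain ⟨-, hp0, hp6, -⟩ := huI.self_of_nhds
  have ho0 := (ha 0).hasMeroOrder_zero (mul_ne_zero (twistCocycle_ne_zero T _ _ _ _ _) hp0)
  have ho6 := (ha 6).hasMeroOrder_zero (mul_ne_zero (twistCocycle_ne_zero T _ _ _ _ _) hp6)
  obtain ⟨m, hm⟩ := HolSection.exists_hasMeroOrder hβ p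
  obtain ⟨m', hm'⟩ := HolSection.exists_hasMeroOrder hδ p
  have h1 := (hm.mul ho0).mul (hm.mul ho0)
  have h2 := (hm'.mul ho6).mul (hm'.mul ho6)
  have h12 : m + 0 + (m + 0) = m' + 0 + (m' + 0) := by
    refine h1.unique (h2.congr ?_)
    filter_upwards [HolSection.eventually_ne_zero hβ p, HolSection.eventually_ne_zero hδ p,
      eventually_nhdsWithin_of_eventually_nhds huI] with x hb hd hx'
    obtain ⟨hx, -, -, hxI⟩ := hx'
    have h3 := sq_eq_sq_of_isPivot hb hd (hW.2 x) h0 h6 (hI0 x) hx hxI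
    have e1 := twistCocycle_mul (T := T) (-1) 1 2 1 x p x
    have e2 := twistCocycle_mul (T := T) 3 3 (-2) (-1) x p x
    change twistCocycle T 3 3 x p x * fiberCoord δ x * (twistCocycle T (-2) (-1) x p x * u x 6) *
        (twistCocycle T 3 3 x p x * fiberCoord δ x * (twistCocycle T (-2) (-1) x p x * u x 6)) =
      twistCocycle T (-1) 1 x p x * fiberCoord β x * (twistCocycle T 2 1 x p x * u x 0) *
        (twistCocycle T (-1) 1 x p x * fiberCoord β x * (twistCocycle T 2 1 x p x * u x 0))
    calc _ = (twistCocycle T 3 3 x p x * twistCocycle T (-2) (-1) x p x) ^ 2 *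
          (fiberCoord δ x * u x 6) ^ 2 := by ring
      _ = (twistCocycle T (-1) 1 x p x * twistCocycle T 2 1 x p x) ^ 2 *
          (fiberCoord β x * u x 0) ^ 2 := by rw [h3, e1, e2]; norm_num
      _ = _ := by ring
  rw [vanishingOrder_eq_ordAt, vanishingOrder_eq_ordAt, (hasMeroOrder_iff.1 hm).2,
    (hasMeroOrder_iff.1 hm').2]
  norm_cast
  omega

theorem exists_ne_zero_and_ne_zero [T1Space X] [ConnectedSpace X] (hβ : β ≠ 0) (hδ : δ ≠ 0) :
    ∃ x, fiberCoord β x ≠ 0 ∧ fiberCoord δ x ≠ 0 := by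
  obtain ⟨p⟩ := (inferInstance : Nonempty X)
  have hnb : (𝓝[≠] p).NeBot := neBot_punctured p
  exact ((HolSection.eventually_ne_zero hβ p).and (HolSection.eventually_ne_zero hδ p)).exists

variable [T2Space X] [CompactSpace X] [ConnectedSpace X] {t k : ℤ}

/-- For `β, δ ≠ 0` a Higgs subbundle that does not have negative degree has degree zero, and then
the pivot sets of `exists_isPivot_neg_or` are pivot sets everywhere. -/
theorem isStable_of_ne_zero
    (hd : ∀ j, HasTwistDegree T (expT j) (expK j) (lineDeg t k j)) (hβ : β ≠ 0) (hδ : δ ≠ 0)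
    (h : ¬ (2 * t + k = 0 ∧ SameDivisor β δ)) : IsStable (alphaHiggs β δ) := by
  obtain ⟨x₀, hb, hd0⟩ := exists_ne_zero_and_ne_zero hβ hδ
  have htop : IsPivot (⊤ : Submodule ℂ (Fin 7 → ℂ)) Finset.univ := by
    rw [← coordSubspace_univ]
    exact isPivot_coordSubspace _
  have hhol : IsHolSubbundle (Fin 7 → ℂ) (⊤ : ∀ x, Submodule ℂ ((alphaBundle T).Fiber x)) := by
    have := isHolSubbundle_coordSubspace (T := T) (a := expT) (b := expK) Finset.univ
    rw [coordSubspace_univ] at this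
    exact this
  have htd : HasDegree (Fin 7 → ℂ) (⊤ : ∀ x, Submodule ℂ ((alphaBundle T).Fiber x)) 0 := by
    have h1 := hasDegree_of_forall_isPivot hd hhol (J := Finset.univ) fun _ => htop
    obtain ⟨l0, l1, l2, l3, l4, l5, l6⟩ := lineDeg_eq t k
    rw [Fin.sum_univ_seven] at h1
    convert h1 using 1
    omega
  refine ⟨isHiggsSub_iff.2 ⟨hhol, fun _ _ _ => trivial⟩, fun h => ?_, htd, ?_⟩
  · have h1 : (⊤ : Submodule ℂ (Fin 7 → ℂ)) = ⊥ := congrFun h x₀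
    exact top_ne_bot h1
  intro W hW _ h0 h1
  have hW' := isHiggsSub_iff.1 hW
  rcases exists_isPivot_neg_or t k hb hd0 (hW'.2 x₀) (hW'.1.apply_ne_bot h0 x₀)
    (hhol.apply_ne hW'.1 le_top h1 x₀) with ⟨J, hJ, hneg⟩ | ⟨htk, I, hI0, hI6, hp0, hp6, hs0, hs6⟩
  · obtain ⟨e, he, hle, -⟩ := hW'.1.exists_degree_le hd hJ
    exact ⟨e, he, hle.trans_lt hneg⟩
  · obtain ⟨e, he, hle, hiff⟩ := hW'.1.exists_degree_le hd hp0
    obtain ⟨e', he', -, hiff'⟩ := hW'.1.exists_degree_le hd hp6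
    obtain rfl := he.unique he'
    rw [hs0] at hle hiff
    rw [hs6] at hiff'
    refine ⟨e, he, lt_of_le_of_ne hle fun h2 => h ⟨htk, ?_⟩⟩
    exact sameDivisor_of_isPivot hW hβ hδ hI0 hI6 (hiff.1 h2) (hiff'.1 h2)

end Generic

/-! ### The exceptional locus: strict polystability -/

section Exceptional

open Filter

variable {X : Type u} [TopologicalSpace X] [ChartedSpace ℂ X] [IsManifold 𝓘(ℂ) ω X]
variable {T : X → Type v} [∀ x, AddCommGroup (T x)] [∀ x, Module ℂ (T x)]
  [TopologicalSpace (TotalSpace ℂ T)] [∀ x, TopologicalSpace (T x)] [FiberBundle ℂ T]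
  [VectorBundle ℂ ℂ T] [ContMDiffVectorBundle ω ℂ T 𝓘(ℂ)]

section Diag

variable {n : ℕ} {ε : Fin n → ℂ} {V : Submodule ℂ (Fin n → ℂ)}

/-- The diagonal map with entries `ε`. -/
def diagMap (ε : Fin n → ℂ) : (Fin n → ℂ) →ₗ[ℂ] (Fin n → ℂ) where
  toFun v k := ε k * v k
  map_add' _ _ := funext fun _ => mul_add _ _ _
  map_smul' _ _ := funext fun _ => mul_left_comm _ _ _

/-- The image of a subspace under a diagonal map. -/
def diagSub (ε : Fin n → ℂ) (V : Submodule ℂ (Fin n → ℂ)) : Submodule ℂ (Fin n → ℂ) :=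
  V.map (diagMap ε)

theorem diagMap_injective (hε : ∀ k, ε k ≠ 0) : Function.Injective (diagMap ε) :=
  fun _ _ h => funext fun k => mul_left_cancel₀ (hε k) (congrFun h k)

theorem finrank_diagSub (hε : ∀ k, ε k ≠ 0) :
    Module.finrank ℂ (diagSub ε V) = Module.finrank ℂ V :=
  (Submodule.equivMapOfInjective _ (diagMap_injective hε) V).finrank_eq.symm

theorem IsPivot.diagSub (hε : ∀ k, ε k ≠ 0) {J : Finset (Fin n)} (hJ : IsPivot V J) :
    IsPivot (diagSub ε V) J := by
  refine ⟨hJ.1.trans (finrank_diagSub hε).symm, ?_⟩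
  rintro _ ⟨v, hv, rfl⟩ h
  rw [hJ.2 v hv fun j hj => (mul_eq_zero.1 (h j hj)).resolve_left (hε j), map_zero]

theorem isHolSubbundle_diagSub {a b : Fin n → ℤ}
    {W : ∀ x, Submodule ℂ ((twistSum T a b).Fiber x)} (hW : IsHolSubbundle (Fin n → ℂ) W)
    (hε : ∀ k, ε k ≠ 0) :
    IsHolSubbundle (Fin n → ℂ) (E := (twistSum T a b).Fiber) fun x => diagSub ε (W x) := by
  intro p
  obtain ⟨r, s, hs⟩ : ∃ (r : ℕ) (s : Fin r → X → Fin n → ℂ),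
      IsFrameAt (Fin n → ℂ) (E := (twistSum T a b).Fiber) W p s := hW p
  refine ⟨r, fun i x => (diagMap ε (s i x) : Fin n → ℂ), fun i =>
    (holAt_iff T a b _ p).2 fun k => ?_, ?_⟩
  · refine ((AnaAt.const (ε k) p).mul ((holAt_iff T a b _ p).1 (hs.1 i) k)).congr
      (Eventually.of_forall fun x => ?_)
    change ε k * (_ * s i x k) = _ * (ε k * s i x k)
    ring
  · filter_upwards [hs.2] with x hx
    have h1 : LinearIndependent ℂ fun i => s i x := hx.1
    have h2 : Submodule.span ℂ (Set.range fun i => s i x) = W x := hx.2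
    refine ⟨h1.map' (diagMap ε) (LinearMap.ker_eq_bot.2 (diagMap_injective hε)), ?_⟩
    change Submodule.span ℂ (Set.range (diagMap ε ∘ fun i => s i x)) = diagSub ε (W x)
    rw [Set.range_comp, ← Submodule.map_span, h2]
    rfl

end Diag

/-- The signs `(-1)^j` of the grading for which the Higgs field is odd. -/
def paritySign : Fin 7 → ℂ := ![1, -1, 1, -1, 1, -1, 1]

theorem paritySign_ne_zero (k : Fin 7) : paritySign k ≠ 0 := by
  fin_cases k <;> simp [paritySign]

/-- The signs that exchange the lines spanned by `(u₀, 0, …, 0, ± u₆)`. -/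
def lastSign : Fin 7 → ℂ := ![1, 1, 1, 1, 1, 1, -1]

theorem lastSign_ne_zero (k : Fin 7) : lastSign k ≠ 0 := by
  fin_cases k <;> simp [lastSign]

theorem alphaMatrix_mulVec_paritySign (b d : ℂ) (v : Fin 7 → ℂ) :
    (alphaMatrix b d).mulVec (diagMap paritySign v) =
      -diagMap paritySign ((alphaMatrix b d).mulVec v) := by
  rw [alphaMatrix_mulVec, alphaMatrix_mulVec]
  funext k
  fin_cases k <;> simp [diagMap, paritySign]

variable {β : HolSection T (-1) 1} {δ : HolSection T 3 3}

/-- If `β` and `δ` have the same divisor, then the kernel of the Higgs field extends to a line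
subbundle generated by `u₀ e₀ + u₆ e₆` with `u₀`, `u₆` without zeros. -/
theorem exists_kernel_subbundle [T2Space X] [ConnectedSpace X] (hβ : β ≠ 0) (hδ : δ ≠ 0)
    (h : SameDivisor β δ) :
    ∃ (L : ∀ x, Submodule ℂ ((alphaBundle T).Fiber x)) (u : X → Fin 7 → ℂ),
      IsHolSubbundle (Fin 7 → ℂ) L ∧ ∀ x, L x = Submodule.span ℂ {u x} ∧ u x 0 ≠ 0 ∧ u x 6 ≠ 0 ∧
        (∀ i, i ≠ 0 → i ≠ 6 → u x i = 0) ∧ (higgsAt β δ x).mulVec (u x) = 0 := by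
  set S : X → Fin 7 → ℂ := fun x => kerVec (fiberCoord β x) (fiberCoord δ x) with hSdef
  have hmid : ∀ i : Fin 7, i ≠ 0 → i ≠ 6 → ∀ x, S x i = 0 := by
    intro i hi0 hi6 x
    fin_cases i
    · exact absurd rfl hi0
    · rfl
    · rfl
    · rfl
    · rfl
    · rfl
    · exact absurd rfl hi6
  have hAS : ∀ x, (higgsAt β δ x).mulVec (S x) = 0 := by
    intro x
    rw [higgsAt_mulVec]
    funext k
    fin_cases k <;> simp [hSdef, kerVec]
    ring
  set s : X → X → Fin 7 → ℂ := fun p x => twistCocycle T 1 2 x p x • S x with hs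
  have e0 : ∀ p x, twistCocycle T (expT 0) (expK 0) x p x * s p x 0 =
      twistCocycle T 3 3 x p x * fiberCoord δ x := by
    intro p x
    change twistCocycle T 2 1 x p x * (twistCocycle T 1 2 x p x * fiberCoord δ x) = _
    rw [← mul_assoc, twistCocycle_mul]
    norm_num
  have e6 : ∀ p x, twistCocycle T (expT 6) (expK 6) x p x * s p x 6 =
      -(twistCocycle T (-1) 1 x p x * fiberCoord β x) := by
    intro p x
    change twistCocycle T (-2) (-1) x p x * (twistCocycle T 1 2 x p x * -fiberCoord β x) = _
    rw [← mul_assoc, twistCocycle_mul]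
    norm_num
  have hsmid : ∀ i : Fin 7, i ≠ 0 → i ≠ 6 → ∀ p x, s p x i = 0 := fun i h0 h6 p x => by
    rw [hs]
    change _ * S x i = 0
    rw [hmid i h0 h6, mul_zero]
  have hsH : ∀ p, HolAt (Fin 7 → ℂ) (E := (alphaBundle T).Fiber) (s p) p := by
    intro p
    refine (holAt_iff T expT expK _ p).2 fun k => ?_
    by_cases h0 : k = 0
    · subst h0
      exact (HolSection.anaAt δ p).congr (Eventually.of_forall fun x => (e0 p x).symm)
    by_cases h6 : k = 6
    · subst h6
      exact (HolSection.anaAt β p).neg.congr (Eventually.of_forall fun x => (e6 p x).symm)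
    · refine (AnaAt.const 0 p).congr (Eventually.of_forall fun x => ?_)
      rw [hsmid k h0 h6, mul_zero]
  obtain ⟨L, s', m, -, hL, hss'⟩ := exists_saturation (T := T) (a := expT) (b := expK) (S := S)
    (s := s) hsH (fun p => Eventually.of_forall fun x =>
      ⟨_, twistCocycle_ne_zero T 1 2 x p x, rfl⟩) fun p =>
      (HolSection.eventually_ne_zero hδ p).mono fun x hx h0 => hx (congrFun h0 0)
  have hss : ∀ p, ∀ᶠ x in 𝓝[≠] p, (chartAt ℂ p x - chartAt ℂ p p) ^ m p ≠ 0 ∧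
      ∀ k, s p x k = (chartAt ℂ p x - chartAt ℂ p p) ^ m p * (s' p x : Fin 7 → ℂ) k := by
    intro p
    filter_upwards [(hasMeroOrder_coord_pow p (m p)).eventually_ne_zero,
      eventually_nhdsWithin_of_eventually_nhds (hss' p)] with x hz hx
    exact ⟨hz, fun k => congrFun hx k⟩
  refine ⟨L, fun p => s' p p, fun p => ⟨1, _, hL p⟩, fun p => ?_⟩
  have hframe := (hL p).2.self_of_nhds
  have ha := (holAt_iff T expT expK (s' p) p).1 ((hL p).1 0)
  have hmid' : ∀ i : Fin 7, i ≠ 0 → i ≠ 6 → (s' p p : Fin 7 → ℂ) i = 0 := by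
    intro i hi0 hi6
    have hnb : (𝓝[≠] p).NeBot := neBot_punctured p
    have h1 : ∀ᶠ x in 𝓝[≠] p, twistCocycle T (expT i) (expK i) x p x * s' p x i = 0 := by
      filter_upwards [hss p] with x ⟨hz, hx⟩
      have h2 := hx i
      rw [hsmid i hi0 hi6] at h2
      rw [(mul_eq_zero.1 h2.symm).resolve_left hz, mul_zero]
    rcases (ha i).eventually_or with h2 | h2
    · exact (mul_eq_zero.1 h2.self_of_nhds).resolve_left (twistCocycle_ne_zero T _ _ _ _ _)
    · obtain ⟨x, hx, hx'⟩ := (h1.and h2).exists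
      exact absurd hx hx'
  -- `u₀` and `u₆` have the same order
  obtain ⟨o, ho⟩ := HolSection.exists_hasMeroOrder hβ p
  obtain ⟨o', ho'⟩ := HolSection.exists_hasMeroOrder hδ p
  have hoo : o = o' := by
    have h1 := h p
    rw [vanishingOrder_eq_ordAt, vanishingOrder_eq_ordAt, (hasMeroOrder_iff.1 ho).2,
      (hasMeroOrder_iff.1 ho').2] at h1
    exact_mod_cast h1
  have h0 : HasMeroOrder (fun x => twistCocycle T (expT 0) (expK 0) x p x * s' p x 0) p
      (o' - m p) := by
    refine (ho'.div (hasMeroOrder_coord_pow p (m p))).congr ?_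
    filter_upwards [hss p] with x ⟨hz, hx⟩
    rw [← e0, hx, div_eq_iff hz]
    ring
  have h6 : HasMeroOrder (fun x => twistCocycle T (expT 6) (expK 6) x p x * s' p x 6) p
      (o - m p) := by
    have hneg : HasMeroOrder (fun _ : X => (-1 : ℂ)) p 0 :=
      (AnaAt.const (-1) p).hasMeroOrder_zero (neg_ne_zero.2 one_ne_zero)
    have h1 := (hneg.mul ho).div (hasMeroOrder_coord_pow p (m p))
    rw [zero_add] at h1
    refine h1.congr ?_
    filter_upwards [hss p] with x ⟨hz, hx⟩
    rw [neg_one_mul, ← e6, hx, div_eq_iff hz]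
    ring
  have hiff : ∀ k : Fin 7, ∀ l : ℤ,
      HasMeroOrder (fun x => twistCocycle T (expT k) (expK k) x p x * s' p x k) p l →
      (l = 0 ↔ (s' p p : Fin 7 → ℂ) k ≠ 0) := by
    intro k l hl
    have h1 := (ha k).ordAt_eq_zero_iff
    rw [(hasMeroOrder_iff.1 hl).2] at h1
    have h2 : (twistCocycle T (expT k) (expK k) p p p * s' p p k ≠ 0) ↔
        (s' p p : Fin 7 → ℂ) k ≠ 0 := by
      rw [mul_ne_zero_iff]
      exact and_iff_right (twistCocycle_ne_zero T _ _ _ _ _)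
    rw [← h2, ← h1]
    norm_cast
  have hne : (s' p p : Fin 7 → ℂ) ≠ 0 := hframe.1.ne_zero 0
  have h06 : (s' p p : Fin 7 → ℂ) 0 ≠ 0 ↔ (s' p p : Fin 7 → ℂ) 6 ≠ 0 := by
    rw [← hiff 0 _ h0, ← hiff 6 _ h6, hoo]
  have hu0 : (s' p p : Fin 7 → ℂ) 0 ≠ 0 := by
    intro hz
    refine hne (funext fun i => ?_)
    by_cases hi0 : i = 0
    · rw [hi0]
      exact hz
    by_cases hi6 : i = 6
    · rw [hi6]
      exact not_not.1 fun h => h06.2 h hz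
    · exact hmid' i hi0 hi6
  refine ⟨?_, hu0, h06.1 hu0, hmid', mulVec_eq_zero_of_punctured ((hL p).1 0) ?_⟩
  · rw [← hframe.2, Set.range_const]
    rfl
  · filter_upwards [hss p] with x ⟨hz, hx⟩
    have h1 : (higgsAt β δ x).mulVec (s p x) = 0 := by
      rw [hs, Matrix.mulVec_smul, hAS, smul_zero]
    have h2 : s p x = (chartAt ℂ p x - chartAt ℂ p p) ^ m p • (s' p x : Fin 7 → ℂ) := funext hx
    rw [h2] at h1
    have h3 := (Matrix.mulVec_smul (higgsAt β δ x) ((chartAt ℂ p x - chartAt ℂ p p) ^ m p)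
      (s' p x : Fin 7 → ℂ)).symm.trans h1
    exact (smul_eq_zero.1 h3).resolve_left hz

section Linear

variable {b d : ℂ}

theorem isPivot_imageSubspace (hd : d ≠ 0) :
    IsPivot (imageSubspace b d) (Finset.univ.image Fin.castSucc) := by
  refine IsPivot.image_castSucc hd le_rfl ?_
  have htop : (imageSubspace b d).map sixMap = ⊤ := by
    rw [eq_top_iff]
    intro y _
    refine ⟨Fin.snoc y (b * y 0 / d), ?_, funext fun j => ?_⟩
    · change b * Fin.snoc (α := fun _ => ℂ) y (b * y 0 / d) (Fin.castSucc 0) =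
        d * Fin.snoc (α := fun _ => ℂ) y (b * y 0 / d) (Fin.last 6)
      rw [Fin.snoc_castSucc, Fin.snoc_last, mul_div_cancel₀ _ hd]
    · exact Fin.snoc_castSucc (α := fun _ => ℂ) _ _ _
  rw [htop, ← coordSubspace_univ]
  exact isPivot_coordSubspace _

theorem finrank_imageSubspace (hd : d ≠ 0) : Module.finrank ℂ (imageSubspace b d) = 6 := by
  rw [← (isPivot_imageSubspace (b := b) hd).1,
    Finset.card_image_of_injective _ (Fin.castSucc_injective 6), Finset.card_univ, Fintype.card_fin]

/-- The hyperplane `u₆ v₀ + u₀ v₆ = 0`, complementary to `u = u₀ e₀ + u₆ e₆`. -/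
theorem coordSubspace_sup_diagSub {u : Fin 7 → ℂ} (h0 : u 0 ≠ 0) :
    coordSubspace {1, 2, 3, 4, 5} ⊔ diagSub lastSign (Submodule.span ℂ {u}) =
      imageSubspace (u 6) (-(u 0)) := by
  have hmem : diagMap lastSign u ∈ imageSubspace (u 6) (-(u 0)) := by
    rw [mem_imageSubspace]
    change u 6 * (1 * u 0) = -(u 0) * (-1 * u 6)
    ring
  refine le_antisymm (sup_le (fun v hv => ?_) ?_) fun v hv => ?_
  · rw [mem_imageSubspace, hv 0 (by decide), hv 6 (by decide), mul_zero, mul_zero]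
  · rw [diagSub, Submodule.map_span, Set.image_singleton, Submodule.span_singleton_le_iff_mem]
    exact hmem
  · have h1 : v - (v 0 / u 0) • diagMap lastSign u ∈ coordSubspace {1, 2, 3, 4, 5} := by
      intro i hi
      rw [mem_imageSubspace] at hv
      fin_cases i <;> first | exact absurd (by decide) hi | skip
      · change v 0 - v 0 / u 0 * (1 * u 0) = 0
        field_simp
        ring
      · change v 6 - v 0 / u 0 * (-1 * u 6) = 0
        field_simp
        linear_combination hv
    rw [← sub_add_cancel v ((v 0 / u 0) • diagMap lastSign u)]
    exact Submodule.add_mem_sup h1 (Submodule.smul_mem _ _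
      (Submodule.mem_map_of_mem (Submodule.mem_span_singleton_self u)))

theorem disjoint_coordSubspace_diagSub {u : Fin 7 → ℂ} (h0 : u 0 ≠ 0) :
    Disjoint (coordSubspace {1, 2, 3, 4, 5}) (diagSub lastSign (Submodule.span ℂ {u})) := by
  rw [Submodule.disjoint_def]
  rintro _ hv ⟨w, hw, rfl⟩
  obtain ⟨c, rfl⟩ := Submodule.mem_span_singleton.1 hw
  have h1 : (1 : ℂ) * (c * u 0) = 0 := hv 0 (by decide)
  rw [one_mul] at h1
  rw [(mul_eq_zero.1 h1).resolve_right h0, zero_smul, map_zero]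

theorem disjoint_span_imageSubspace {u : Fin 7 → ℂ} (h0 : u 0 ≠ 0) (h6 : u 6 ≠ 0) :
    Disjoint (Submodule.span ℂ {u}) (imageSubspace (u 6) (-(u 0))) := by
  rw [Submodule.disjoint_def]
  intro v hv hv'
  obtain ⟨c, rfl⟩ := Submodule.mem_span_singleton.1 hv
  have h1 : u 6 * (c * u 0) = -(u 0) * (c * u 6) := hv'
  have h2 : c * (2 * u 0 * u 6) = 0 := by linear_combination h1
  rw [(mul_eq_zero.1 h2).resolve_right (mul_ne_zero (mul_ne_zero two_ne_zero h0) h6), zero_smul]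

/-- A subspace with pivot sets `{0, 2, 4}` and `{1, 3, 5}` meets its image under the grading
involution in zero: the even and odd parts of a common vector belong to the subspace, and each of
them vanishes on one of the pivot sets. -/
theorem disjoint_diagSub_paritySign {V : Submodule ℂ (Fin 7 → ℂ)} (he : IsPivot V {0, 2, 4})
    (ho : IsPivot V {1, 3, 5}) :
    Disjoint V (diagSub paritySign V) := by
  rw [Submodule.disjoint_def]
  rintro _ hv ⟨w, hw, rfl⟩
  have h1 : diagMap paritySign w + w = 0 := by
    refine ho.2 _ (V.add_mem hv hw) fun j hj => ?_
    have hj' : paritySign j = -1 := by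
      simp only [Finset.mem_insert, Finset.mem_singleton] at hj
      rcases hj with rfl | rfl | rfl <;> rfl
    change paritySign j * w j + w j = 0
    rw [hj']
    ring
  have h2 : diagMap paritySign w - w = 0 := by
    refine he.2 _ (V.sub_mem hv hw) fun j hj => ?_
    have hj' : paritySign j = 1 := by
      simp only [Finset.mem_insert, Finset.mem_singleton] at hj
      rcases hj with rfl | rfl | rfl <;> rfl
    change paritySign j * w j - w j = 0
    rw [hj']
    ring
  have h3 : (2 : ℂ) • diagMap paritySign w = 0 := by
    rw [two_smul]
    linear_combination (exp := 1) h1 + h2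
  exact (smul_eq_zero.1 h3).resolve_left two_ne_zero

theorem diagSub_paritySign_le {V : Submodule ℂ (Fin 7 → ℂ)} (hV : V ≤ imageSubspace b d) :
    diagSub paritySign V ≤ imageSubspace b d := by
  rintro _ ⟨w, hw, rfl⟩
  have h1 := mem_imageSubspace.1 (hV hw)
  change b * (1 * w 0) = d * (1 * w 6)
  rw [one_mul, one_mul, h1]

theorem sup_eq_top_of_disjoint {n : ℕ} {V V' : Submodule ℂ (Fin n → ℂ)} (h : Disjoint V V')
    (hr : n ≤ Module.finrank ℂ V + Module.finrank ℂ V') :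
    V ⊔ V' = ⊤ := by
  refine Submodule.eq_top_of_finrank_eq (le_antisymm (Submodule.finrank_le _) ?_)
  have h1 := Submodule.finrank_sup_add_finrank_inf_eq V V'
  rw [h.eq_bot, finrank_bot, add_zero] at h1
  rw [h1, Module.finrank_fin_fun]
  exact hr

theorem sup_diagSub_paritySign (hd : d ≠ 0) {V : Submodule ℂ (Fin 7 → ℂ)}
    (hV : V ≤ imageSubspace b d) (he : IsPivot V {0, 2, 4}) (ho : IsPivot V {1, 3, 5}) :
    V ⊔ diagSub paritySign V = imageSubspace b d := by
  refine Submodule.eq_of_le_of_finrank_eq (sup_le hV (diagSub_paritySign_le hV)) ?_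
  have h1 := Submodule.finrank_sup_add_finrank_inf_eq V (diagSub paritySign V)
  rw [(disjoint_diagSub_paritySign he ho).eq_bot, finrank_bot, add_zero,
    finrank_diagSub paritySign_ne_zero, ← he.1] at h1
  rw [h1, finrank_imageSubspace hd]
  decide

theorem isInternal_triple {n : ℕ} {V₀ V₁ V₂ P : Submodule ℂ (Fin n → ℂ)} (hP : V₁ ⊔ V₂ = P)
    (h12 : Disjoint V₁ V₂) (h0 : Disjoint V₀ P) (htop : V₀ ⊔ P = ⊤) :
    DirectSum.IsInternal ![V₀, V₁, V₂] := by
  subst hP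
  rw [DirectSum.isInternal_submodule_iff_iSupIndep_and_iSup_eq_top, iSupIndep_fin_three]
  refine ⟨⟨h0, ?_, ?_⟩, ?_⟩
  · exact (sup_comm V₂ V₀) ▸ h12.disjoint_sup_right_of_disjoint_sup_left h0.symm
  · change Disjoint V₂ (V₀ ⊔ V₁)
    rw [sup_comm V₀ V₁]
    exact h12.symm.disjoint_sup_right_of_disjoint_sup_left (sup_comm V₁ V₂ ▸ h0.symm)
  · rw [eq_top_iff, ← htop]
    exact sup_le (le_iSup ![V₀, V₁, V₂] 0)
      (sup_le (le_iSup ![V₀, V₁, V₂] 1) (le_iSup ![V₀, V₁, V₂] 2))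

end Linear

variable [T2Space X] [CompactSpace X] [ConnectedSpace X] {t k : ℤ}
  {P : ∀ x, Submodule ℂ ((alphaBundle T).Fiber x)} {x₀ : X}

/-- A proper Higgs subbundle of the image bundle `P` that does not have negative degree has the
pivot sets `{0, 2, 4}` and `{1, 3, 5}` everywhere. -/
theorem isPivot_of_not_degree_neg
    (hd : ∀ j, HasTwistDegree T (expT j) (expK j) (lineDeg t k j)) (hk : 0 < k)
    (htk : 2 * t + k = 0) (hb : fiberCoord β x₀ ≠ 0) (hd0 : fiberCoord δ x₀ ≠ 0)
    (hP : IsHolSubbundle (Fin 7 → ℂ) P)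
    (hP₀ : P x₀ = imageSubspace (fiberCoord β x₀) (fiberCoord δ x₀))
    {W : ∀ x, Submodule ℂ ((alphaBundle T).Fiber x)} (hW : IsHiggsSub (alphaHiggs β δ) W)
    (hle : W ≤ P) (h0 : W ≠ ⊥) (h1 : W ≠ P) (hn : ¬ ∃ d : ℤ, HasDegree (Fin 7 → ℂ) W d ∧ d < 0) :
    (∀ x, IsPivot (W x) {0, 2, 4}) ∧ ∀ x, IsPivot (W x) {1, 3, 5} := by
  rw [isHiggsSub_iff] at hW
  obtain ⟨l0, l1, l2, l3, l4, l5, -⟩ := lineDeg_eq t k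
  have hne := hP.apply_ne hW.1 hle h1 x₀
  rw [hP₀] at hne
  have hle₀ := hle x₀
  rw [hP₀] at hle₀
  have hpiv := isPivot_of_forall_nonneg htk hk hb hd0 (hW.2 x₀) hle₀ (hW.1.apply_ne_bot h0 x₀) hne
    fun J hJ => by
      by_contra hneg
      obtain ⟨e, he, hle, -⟩ := hW.1.exists_degree_le hd hJ
      exact hn ⟨e, he, hle.trans_lt (not_le.1 hneg)⟩
  have key : ∀ J, IsPivot (W x₀) J → ∑ j ∈ J, lineDeg t k j = 0 → ∀ x, IsPivot (W x) J := by
    intro J hJ hsum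
    obtain ⟨e, he, hle, hiff⟩ := hW.1.exists_degree_le hd hJ
    rw [hsum] at hle hiff
    exact hiff.1 (le_antisymm hle (not_lt.1 fun hneg => hn ⟨e, he, hneg⟩))
  refine ⟨key _ hpiv.1 ?_, key _ hpiv.2 ?_⟩
  · rw [Finset.sum_insert (by decide), Finset.sum_pair (by decide)]
    omega
  · rw [Finset.sum_insert (by decide), Finset.sum_pair (by decide)]
    omega

/-- A Higgs subbundle of `P` with the pivot set `{0, 2, 4}` everywhere has degree zero and is
stable: a Higgs subbundle of it that does not have negative degree has the same rank. -/
theorem isStableSub_of_isPivot_even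
    (hd : ∀ j, HasTwistDegree T (expT j) (expK j) (lineDeg t k j)) (hk : 0 < k)
    (htk : 2 * t + k = 0) (hb : fiberCoord β x₀ ≠ 0) (hd0 : fiberCoord δ x₀ ≠ 0)
    (hP : IsHolSubbundle (Fin 7 → ℂ) P)
    (hP₀ : P x₀ = imageSubspace (fiberCoord β x₀) (fiberCoord δ x₀))
    {W : ∀ x, Submodule ℂ ((alphaBundle T).Fiber x)} (hW : IsHiggsSub (alphaHiggs β δ) W)
    (hle : W ≤ P) (h : ∀ x, IsPivot (W x) {0, 2, 4}) : IsStableSub (alphaHiggs β δ) W := by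
  obtain ⟨l0, l1, l2, l3, l4, l5, -⟩ := lineDeg_eq t k
  refine ⟨hW, ?_, ?_, fun W' hW' hle' h0 h1 => ?_⟩
  · rintro rfl
    have h2 : ({0, 2, 4} : Finset (Fin 7)).card = _ := (h x₀).1
    exact absurd (h2.trans (finrank_bot ℂ (Fin 7 → ℂ))) (by decide)
  · have h2 := hasDegree_of_forall_isPivot hd hW.1 h
    rw [Finset.sum_insert (by decide), Finset.sum_pair (by decide)] at h2
    convert h2 using 1
    omega
  · by_contra hn
    have hne : W' ≠ P := by
      rintro rfl
      exact h1 (le_antisymm hle' hle)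
    have h2 := (isPivot_of_not_degree_neg hd hk htk hb hd0 hP hP₀ hW' (hle'.trans hle) h0 hne hn).1
    have key : ∀ U U' : Submodule ℂ (Fin 7 → ℂ), U ≤ U' → IsPivot U {0, 2, 4} →
        IsPivot U' {0, 2, 4} → U = U' := fun U U' hUU' hU hU' =>
      Submodule.eq_of_le_of_finrank_eq hUU' (hU.1.symm.trans hU'.1)
    exact hW.1.apply_ne hW'.1 hle' h1 x₀ (key _ _ (hle' x₀) (h2 x₀) (h x₀))

/-- A line subbundle of degree zero is stable. -/
theorem isStableSub_of_isPivot_zero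
    (hd : ∀ j, HasTwistDegree T (expT j) (expK j) (lineDeg t k j)) (htk : 2 * t + k = 0)
    {L : ∀ x, Submodule ℂ ((alphaBundle T).Fiber x)} (hL : IsHiggsSub (alphaHiggs β δ) L)
    (h : ∀ x, IsPivot (L x) {0}) : IsStableSub (alphaHiggs β δ) L := by
  obtain ⟨x₀⟩ := (inferInstance : Nonempty X)
  refine ⟨hL, ?_, ?_, fun W hW hle h0 h1 => absurd ?_ (hL.1.apply_ne hW.1 hle h1 x₀)⟩
  · rintro rfl
    have h2 : ({0} : Finset (Fin 7)).card = _ := (h x₀).1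
    exact absurd (h2.trans (finrank_bot ℂ (Fin 7 → ℂ))) (by decide)
  · have h2 := hasDegree_of_forall_isPivot hd hL.1 h
    rw [Finset.sum_singleton] at h2
    convert h2 using 1
    exact ((lineDeg_eq t k).1.trans htk).symm
  · have key : ∀ U U' : Submodule ℂ (Fin 7 → ℂ), U ≤ U' → U ≠ ⊥ → IsPivot U' {0} → U = U' := by
      intro U U' hUU' hU hU'
      refine Submodule.eq_of_le_of_finrank_le hUU' ?_
      rw [← hU'.1]
      exact Nat.one_le_iff_ne_zero.2 fun h => hU (Submodule.finrank_eq_zero.1 h)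
    exact key _ _ (hle x₀) (hW.1.apply_ne_bot h0 x₀) (h x₀)

/-- If `deg T²K = 0` and `β`, `δ` have the same divisor, then the kernel and the image of the Higgs
field extend to complementary Higgs subbundles of degree zero. The image is either stable or the sum
of two stable subbundles of rank three. -/
theorem isStrictlyPolystable_of_sameDivisor
    (hd : ∀ j, HasTwistDegree T (expT j) (expK j) (lineDeg t k j)) (hk : 0 < k)
    (htk : 2 * t + k = 0) (hβ : β ≠ 0) (hδ : δ ≠ 0) (h : SameDivisor β δ) :
    IsStrictlyPolystable (alphaHiggs β δ) := by
  obtain ⟨x₀, hb, hd0⟩ := exists_ne_zero_and_ne_zero hβ hδ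
  obtain ⟨L, u, hL, hu⟩ := exists_kernel_subbundle hβ hδ h
  have hLu := fun x => (hu x).1
  have hu0 := fun x => (hu x).2.1
  have hu6 := fun x => (hu x).2.2.1
  have hAu := fun x => (hu x).2.2.2.2
  have hrel : ∀ x, fiberCoord β x * u x 0 + fiberCoord δ x * u x 6 = 0 := by
    intro x
    have h1 := congrFun (hAu x) 1
    rw [higgsAt_mulVec] at h1
    exact h1
  -- the kernel is a stable line subbundle, so the bundle is not stable
  have hLH : IsHiggsSub (alphaHiggs β δ) L := by
    refine isHiggsSub_iff.2 ⟨hL, fun x w hw => ?_⟩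
    have hw' : w ∈ (Submodule.span ℂ {u x} : Submodule ℂ (Fin 7 → ℂ)) := by
      rw [hLu] at hw
      exact hw
    obtain ⟨c, rfl⟩ := Submodule.mem_span_singleton.1 hw'
    have h1 : (higgsAt β δ x).mulVec (c • u x) = 0 := by
      rw [Matrix.mulVec_smul, hAu, smul_zero]
    have h2 := (L x).zero_mem
    exact h1 ▸ h2
  have hLr : ∀ x, Module.finrank ℂ (Submodule.span ℂ {u x}) = 1 := fun x =>
    finrank_span_singleton fun h0 => hu0 x (congrFun h0 0)
  have hLp : ∀ x, IsPivot (L x) {0} := by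
    intro x
    rw [hLu]
    refine ⟨(hLr x).symm, fun v hv h0 => ?_⟩
    obtain ⟨c, rfl⟩ := Submodule.mem_span_singleton.1 hv
    rw [(mul_eq_zero.1 (h0 0 (Finset.mem_singleton_self 0))).resolve_right (hu0 x), zero_smul]
  have hLs := isStableSub_of_isPivot_zero hd htk hLH hLp
  refine ⟨?_, not_isStable_of_isStableSub hLs fun h1 => ?_⟩
  swap
  · have h2 := hLr x₀
    rw [← hLu, h1] at h2
    exact absurd (h2.symm.trans ((finrank_top ℂ (Fin 7 → ℂ)).trans (Module.finrank_fin_fun ℂ)))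
      (by decide)
  -- the image extends over the zeros of `β` and `δ` as the hyperplane `u₆ v₀ + u₀ v₆ = 0`
  set P : X → Submodule ℂ (Fin 7 → ℂ) := fun x => imageSubspace (u x 6) (-(u x 0)) with hPdef
  have hP : IsHolSubbundle (Fin 7 → ℂ) (E := (alphaBundle T).Fiber) P := by
    have h1 := (isHolSubbundle_coordSubspace (T := T) (a := expT) (b := expK) {1, 2, 3, 4, 5}).sup
      (isHolSubbundle_diagSub hL lastSign_ne_zero) fun x => by
        rw [hLu]
        exact disjoint_coordSubspace_diagSub (hu0 x)
    have h2 : P = fun x => coordSubspace {1, 2, 3, 4, 5} ⊔ diagSub lastSign (L x) := by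
      funext x
      rw [hLu]
      exact (coordSubspace_sup_diagSub (hu0 x)).symm
    exact h2 ▸ h1
  have hAP : ∀ x v, (higgsAt β δ x).mulVec v ∈ P x := by
    intro x v
    rw [higgsAt_mulVec, hPdef, mem_imageSubspace]
    change u x 6 * (fiberCoord δ x * v 5) = -(u x 0) * (fiberCoord β x * v 5)
    linear_combination v 5 * hrel x
  have hPH : IsHiggsSub (alphaHiggs β δ) P := isHiggsSub_iff.2 ⟨hP, fun x v _ => hAP x v⟩
  have hP₀ : P x₀ = imageSubspace (fiberCoord β x₀) (fiberCoord δ x₀) := by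
    ext v
    rw [hPdef, mem_imageSubspace, mem_imageSubspace]
    have h1 := hrel x₀
    have h2 := hu0 x₀
    constructor <;> intro h3
    · refine mul_left_cancel₀ h2 ?_
      linear_combination v 0 * h1 - fiberCoord δ x₀ * h3
    · refine mul_left_cancel₀ hd0 ?_
      linear_combination v 0 * h1 - u x₀ 0 * h3
  have hPr : ∀ x, Module.finrank ℂ (P x) = 6 := fun x =>
    finrank_imageSubspace (neg_ne_zero.2 (hu0 x))
  have hLP : ∀ x, Disjoint (Submodule.span ℂ {u x}) (P x) := fun x =>
    disjoint_span_imageSubspace (hu0 x) (hu6 x)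
  have hLPtop : ∀ x, Submodule.span ℂ {u x} ⊔ P x = ⊤ := fun x =>
    sup_eq_top_of_disjoint (hLP x) (by rw [hLr, hPr])
  have hPd : HasDegree (Fin 7 → ℂ) (E := (alphaBundle T).Fiber) P 0 := by
    have h1 := hasDegree_of_forall_isPivot hd hP fun x =>
      isPivot_imageSubspace (b := u x 6) (neg_ne_zero.2 (hu0 x))
    rwa [sum_image_castSucc, sum_castSucc, htk] at h1
  have hP0 : P ≠ ⊥ := by
    intro h1
    have h2 := hPr x₀
    rw [h1] at h2
    exact absurd ((finrank_bot ℂ (Fin 7 → ℂ)).symm.trans h2) (by decide)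
  by_cases hPs : IsStableSub (alphaHiggs β δ) P
  · refine ⟨2, ![L, P], fun i => ?_, fun x => ?_⟩
    · fin_cases i
      · exact hLs
      · exact hPs
    · have h1 : DirectSum.IsInternal ![Submodule.span ℂ {u x}, P x] := by
        rw [DirectSum.isInternal_submodule_iff_isCompl _ zero_ne_one
          (by ext i; fin_cases i <;> simp)]
        exact ⟨hLP x, codisjoint_iff.2 (hLPtop x)⟩
      have h2 : (fun i => (![L, P] i x : Submodule ℂ (Fin 7 → ℂ))) =
          ![Submodule.span ℂ {u x}, P x] := by
        funext i
        fin_cases i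
        · exact hLu x
        · rfl
      exact h2 ▸ h1
  · -- the image splits into two stable subbundles exchanged by the grading involution
    have h1 : ∃ W : ∀ x, Submodule ℂ ((alphaBundle T).Fiber x), IsHiggsSub (alphaHiggs β δ) W ∧
        W ≤ P ∧ W ≠ ⊥ ∧ W ≠ P ∧ ¬ ∃ d : ℤ, HasDegree (Fin 7 → ℂ) W d ∧ d < 0 := by
      by_contra hcon
      refine hPs ⟨hPH, hP0, hPd, fun W hW hle h0 hne => ?_⟩
      by_contra hn
      exact hcon ⟨W, hW, hle, h0, hne, hn⟩
    obtain ⟨W, hW, hle, h0, hne, hn⟩ := h1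
    obtain ⟨he, ho⟩ := isPivot_of_not_degree_neg hd hk htk hb hd0 hP hP₀ hW hle h0 hne hn
    have hWs := isStableSub_of_isPivot_even hd hk htk hb hd0 hP hP₀ hW hle he
    have hW' := isHiggsSub_iff.1 hW
    set W₂ : X → Submodule ℂ (Fin 7 → ℂ) := fun x => diagSub paritySign (W x) with hW₂
    have hW₂H : IsHiggsSub (alphaHiggs β δ) W₂ := by
      refine isHiggsSub_iff.2 ⟨isHolSubbundle_diagSub hW'.1 paritySign_ne_zero, ?_⟩
      rintro x _ ⟨w, hw, rfl⟩
      refine ⟨-(higgsAt β δ x).mulVec w, (W x).neg_mem (hW'.2 x w hw), ?_⟩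
      rw [map_neg]
      exact (alphaMatrix_mulVec_paritySign _ _ w).symm
    have hle₂ : W₂ ≤ P := fun x => diagSub_paritySign_le (hle x)
    have hW₂s := isStableSub_of_isPivot_even hd hk htk hb hd0 hP hP₀ hW₂H hle₂
      fun x => (he x).diagSub paritySign_ne_zero
    refine ⟨3, ![L, W, W₂], fun i => ?_, fun x => ?_⟩
    · fin_cases i
      · exact hLs
      · exact hWs
      · exact hW₂s
    · have h1 : DirectSum.IsInternal ![Submodule.span ℂ {u x}, W x, W₂ x] :=
        isInternal_triple
          (sup_diagSub_paritySign (neg_ne_zero.2 (hu0 x)) (hle x) (he x) (ho x))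
          (disjoint_diagSub_paritySign (he x) (ho x)) (hLP x) (hLPtop x)
      have h2 : (fun i => (![L, W, W₂] i x : Submodule ℂ (Fin 7 → ℂ))) =
          ![Submodule.span ℂ {u x}, W x, W₂ x] := by
        funext i
        fin_cases i
        · exact hLu x
        · rfl
        · rfl
      exact h2 ▸ h1

end Exceptional

/-! ### Necessary conditions for polystability -/

section Converse

variable {X : Type u} [TopologicalSpace X] [ChartedSpace ℂ X] [IsManifold 𝓘(ℂ) ω X]
variable {T : X → Type v} [∀ x, AddCommGroup (T x)] [∀ x, Module ℂ (T x)]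
  [TopologicalSpace (TotalSpace ℂ T)] [∀ x, TopologicalSpace (T x)] [FiberBundle ℂ T]
  [VectorBundle ℂ ℂ T] [ContMDiffVectorBundle ω ℂ T 𝓘(ℂ)]
variable {β : HolSection T (-1) 1} {δ : HolSection T 3 3}

theorem higgsAt_mulVec_single_zero (hβ : β = 0) (x : X) :
    (higgsAt β δ x).mulVec (Pi.single 0 1) = 0 := by
  subst hβ
  rw [higgsAt_mulVec]
  ext j
  fin_cases j <;> simp [fiberCoord_zero]

theorem higgsAt_mulVec_single_six (hδ : δ = 0) (x : X) :
    (higgsAt β δ x).mulVec (Pi.single 6 1) = 0 := by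
  subst hδ
  rw [higgsAt_mulVec]
  ext j
  fin_cases j <;> simp [fiberCoord_zero]

variable [T2Space X] [CompactSpace X] [ConnectedSpace X] {t k : ℤ}

/-- If `δ = 0` then `T⁻²K⁻¹` lies in the kernel of the Higgs field, and if moreover `β ≠ 0` it also
lies generically in the image. -/
theorem nonneg_of_isPolystable_of_right_eq_zero
    (hd : ∀ j, HasTwistDegree T (expT j) (expK j) (lineDeg t k j)) (hδ : δ = 0)
    (hP : IsPolystable (alphaHiggs β δ)) : 0 ≤ 2 * t + k ∧ (β ≠ 0 → 0 < 2 * t + k) := by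
  obtain ⟨-, -, -, -, -, -, l6⟩ := lineDeg_eq t k
  have h := lineDeg_nonpos_of_isPolystable hd hP (higgsAt_mulVec_single_six hδ)
  obtain ⟨p⟩ := (inferInstance : Nonempty X)
  refine ⟨by have := (h p).1; omega, fun hβ => ?_⟩
  obtain ⟨x₀, hb⟩ := HolSection.exists_ne_zero hβ
  have h1 := (h x₀).2 (Pi.single 5 (fiberCoord β x₀)⁻¹) (by
    subst hδ
    rw [higgsAt_mulVec]
    ext j
    fin_cases j <;> simp [fiberCoord_zero, hb])
  omega

/-- If `β = 0` then `T²K` lies in the kernel of the Higgs field, and if moreover `δ ≠ 0` it also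
lies generically in the image. -/
theorem nonpos_of_isPolystable_of_left_eq_zero
    (hd : ∀ j, HasTwistDegree T (expT j) (expK j) (lineDeg t k j)) (hβ : β = 0)
    (hP : IsPolystable (alphaHiggs β δ)) : 2 * t + k ≤ 0 ∧ (δ ≠ 0 → 2 * t + k < 0) := by
  obtain ⟨l0, -⟩ := lineDeg_eq t k
  have h := lineDeg_nonpos_of_isPolystable hd hP (higgsAt_mulVec_single_zero hβ)
  obtain ⟨p⟩ := (inferInstance : Nonempty X)
  refine ⟨by have := (h p).1; omega, fun hδ => ?_⟩
  obtain ⟨x₀, hd0⟩ := HolSection.exists_ne_zero hδ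
  have h1 := (h x₀).2 (Pi.single 5 (fiberCoord δ x₀)⁻¹) (by
    subst hβ
    rw [higgsAt_mulVec]
    ext j
    fin_cases j <;> simp [fiberCoord_zero, hd0])
  omega

end Converse

end AlphaCyclic

end

theorem mainTheorem8 {X : Type*} [TopologicalSpace X] [T2Space X] [CompactSpace X]
    [ConnectedSpace X] [ChartedSpace ℂ X] [IsManifold 𝓘(ℂ) ω X]
    (g : ℕ) (hg : 2 ≤ g) (hX : AlphaCyclic.HasGenus X g)
    (T : X → Type*) [∀ x, AddCommGroup (T x)] [∀ x, Module ℂ (T x)]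
    [TopologicalSpace (TotalSpace ℂ T)] [∀ x, TopologicalSpace (T x)] [FiberBundle ℂ T]
    [VectorBundle ℂ ℂ T] [ContMDiffVectorBundle ω ℂ T 𝓘(ℂ)]
    (t : ℤ) (ht : AlphaCyclic.HasBundleDegree ℂ T t)
    (β : AlphaCyclic.HolSection T (-1) 1) (δ : AlphaCyclic.HolSection T 3 3) :
    -- degree bound
    (AlphaCyclic.IsPolystable (AlphaCyclic.alphaHiggs β δ) →
      -2 * (g : ℤ) + 2 ≤ t ∧ t ≤ 2 * (g : ℤ) - 2) ∧
    -- generic locus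
    (δ ≠ 0 → β ≠ 0 →
      (AlphaCyclic.IsPolystable (AlphaCyclic.alphaHiggs β δ) ↔
        -2 * (g : ℤ) + 2 ≤ t ∧ t ≤ 2 * (g : ℤ) - 2) ∧
      (¬ (t = -(g : ℤ) + 1 ∧ AlphaCyclic.SameDivisor β δ) →
        AlphaCyclic.IsStable (AlphaCyclic.alphaHiggs β δ)) ∧
      (t = -(g : ℤ) + 1 ∧ AlphaCyclic.SameDivisor β δ →
        AlphaCyclic.IsStrictlyPolystable (AlphaCyclic.alphaHiggs β δ))) ∧
    -- the locus where only `δ` vanishes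
    (δ = 0 → β ≠ 0 →
      (AlphaCyclic.IsPolystable (AlphaCyclic.alphaHiggs β δ) ↔
        -(g : ℤ) + 1 < t ∧ t ≤ 2 * (g : ℤ) - 2) ∧
      (-(g : ℤ) + 1 < t ∧ t ≤ 2 * (g : ℤ) - 2 →
        AlphaCyclic.IsStable (AlphaCyclic.alphaHiggs β δ))) ∧
    -- the locus where only `β` vanishes
    (β = 0 → δ ≠ 0 →
      (AlphaCyclic.IsPolystable (AlphaCyclic.alphaHiggs β δ) ↔
        -2 * (g : ℤ) + 2 ≤ t ∧ t < -(g : ℤ) + 1) ∧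
      (-2 * (g : ℤ) + 2 ≤ t ∧ t < -(g : ℤ) + 1 →
        AlphaCyclic.IsStrictlyPolystable (AlphaCyclic.alphaHiggs β δ))) ∧
    -- the locus where both vanish
    (β = 0 → δ = 0 →
      (AlphaCyclic.IsPolystable (AlphaCyclic.alphaHiggs β δ) ↔ t = -(g : ℤ) + 1) ∧
      (t = -(g : ℤ) + 1 →
        AlphaCyclic.IsStrictlyPolystable (AlphaCyclic.alphaHiggs β δ))) := by
  have hk : 0 < 2 * (g : ℤ) - 2 := by omega
  have hd : ∀ j, AlphaCyclic.HasTwistDegree T (AlphaCyclic.expT j) (AlphaCyclic.expK j)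
      (AlphaCyclic.lineDeg t (2 * (g : ℤ) - 2) j) := fun j => AlphaCyclic.hasTwistDegree hX ht _ _
  -- `T⁻¹K` and `T³K³` have nonnegative degree if they have nonzero sections
  have hβt : β ≠ 0 → t ≤ 2 * (g : ℤ) - 2 := fun hβ => by
    have := AlphaCyclic.HolSection.degree_nonneg hβ (AlphaCyclic.hasTwistDegree hX ht (-1) 1)
    omega
  have hδt : δ ≠ 0 → -2 * (g : ℤ) + 2 ≤ t := fun hδ => by
    have := AlphaCyclic.HolSection.degree_nonneg hδ (AlphaCyclic.hasTwistDegree hX ht 3 3)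
    omega
  have hpos := fun h => AlphaCyclic.nonneg_of_isPolystable_of_right_eq_zero (β := β) (δ := δ) hd h
  have hneg := fun h => AlphaCyclic.nonpos_of_isPolystable_of_left_eq_zero (β := β) (δ := δ) hd h
  have hgen : δ ≠ 0 → β ≠ 0 → ¬ (t = -(g : ℤ) + 1 ∧ AlphaCyclic.SameDivisor β δ) →
      AlphaCyclic.IsStable (AlphaCyclic.alphaHiggs β δ) := fun hδ hβ h =>
    AlphaCyclic.isStable_of_ne_zero hd hβ hδ fun h' => h ⟨by omega, h'.2⟩
  have hexc : δ ≠ 0 → β ≠ 0 → t = -(g : ℤ) + 1 ∧ AlphaCyclic.SameDivisor β δ →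
      AlphaCyclic.IsStrictlyPolystable (AlphaCyclic.alphaHiggs β δ) := fun hδ hβ h =>
    AlphaCyclic.isStrictlyPolystable_of_sameDivisor hd hk (by omega) hβ hδ h.2
  have hright : δ = 0 → β ≠ 0 → -(g : ℤ) + 1 < t →
      AlphaCyclic.IsStable (AlphaCyclic.alphaHiggs β δ) := fun hδ hβ h =>
    AlphaCyclic.isStable_of_right_eq_zero hd hk (by omega) hβ hδ
  have hleft : β = 0 → δ ≠ 0 → t < -(g : ℤ) + 1 →
      AlphaCyclic.IsStrictlyPolystable (AlphaCyclic.alphaHiggs β δ) := fun hβ hδ h =>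
    AlphaCyclic.isStrictlyPolystable_of_left_eq_zero hd hk (by omega) hβ hδ
  have hzero : β = 0 → δ = 0 → t = -(g : ℤ) + 1 →
      AlphaCyclic.IsStrictlyPolystable (AlphaCyclic.alphaHiggs β δ) := fun hβ hδ h =>
    AlphaCyclic.isStrictlyPolystable_of_eq_zero hd hk (by omega) hβ hδ
  refine ⟨fun hP => ?_, fun hδ hβ => ⟨⟨fun _ => ⟨hδt hδ, hβt hβ⟩, fun _ => ?_⟩, hgen hδ hβ,
    hexc hδ hβ⟩, fun hδ hβ => ⟨⟨fun hP => ⟨?_, hβt hβ⟩, fun h => ?_⟩, fun h => hright hδ hβ h.1⟩,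
    fun hβ hδ => ⟨⟨fun hP => ⟨hδt hδ, ?_⟩, fun h => (hleft hβ hδ h.2).1⟩, fun h => hleft hβ hδ h.2⟩,
    fun hβ hδ => ⟨⟨fun hP => ?_, fun h => (hzero hβ hδ h).1⟩, hzero hβ hδ⟩⟩
  · by_cases hβ : β = 0 <;> by_cases hδ : δ = 0
    · have h1 := (hneg hβ hP).1
      have h2 := (hpos hδ hP).1
      omega
    · have h1 := (hneg hβ hP).1
      have h2 := hδt hδ
      omega
    · have h1 := (hpos hδ hP).1
      have h2 := hβt hβ
      omega
    · exact ⟨hδt hδ, hβt hβ⟩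
  · by_cases h : t = -(g : ℤ) + 1 ∧ AlphaCyclic.SameDivisor β δ
    · exact (hexc hδ hβ h).1
    · exact AlphaCyclic.isPolystable_of_isStable (hgen hδ hβ h)
  · have := (hpos hδ hP).2 hβ
    omega
  · exact AlphaCyclic.isPolystable_of_isStable (hright hδ hβ h.1)
  · have := (hneg hβ hP).2 hδ
    omega
  · have h1 := (hneg hβ hP).1
    have h2 := (hpos hδ hP).1
    omega
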